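/- **Graphs.** A graph $\tau$ consists of finite sets $F_\tau$ (flags) and $V_\tau$ (vertices), a map $\partial_\tau:F_\tau\to V_\tau$ and an involution $j_\tau$ of $F_\tau$; its fixed points are tails, its two-element orbits are edges. A corolla is a graph with exactly one vertex and no edges. A morphism $h:\tau\to\sigma$ consists of an injection $h^F:F_\sigma\to F_\tau$, a surjection $h_V:V_\tau\to V_\sigma$ and a fixed-point-free involution $j_h$ on the set of tails of $\tau$ in $F_\tau\setminus h^F(F_\sigma)$ (its orbits are called virtual edges), such that: $h^F(F_\sigma)$ is stable under $j_\tau$; $h_V(\partial_\tau h^F(f))=\partial_\sigma f$; the two vertices of an actual or virtual edge with both flags in $F_\tau\setminus h^F(F_\sigma)$ (a contracted edge) have the same image under $h_V$; and $j_\tau h^F(f)=h^F(j_\sigma f)$ whenever $h^F(f)$ is not a tail. Flag and vertex maps of morphisms are composed as maps; the set of contracted (actual and virtual) edges of $g\circ h$ is the union of the set for $h$ and the $h^F$-image of the set for $g$. The resulting category $Gr$ is symmetric monoidal under disjoint union $\coprod$. A morphism is a grafting if $h^F$ and $h_V$ are bijective, and it grafts nothing if $j_\tau h^F=h^Fj_\sigma$.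 **Graph categories.** A graph category is a symmetric monoidal category $(\Gamma,\coprod)$ with a faithful (strong) symmetric monoidal functor $\psi:\Gamma\to Gr$ as follows. A $\Gamma$-corolla is an object $\sigma$ such that $\psi(\sigma)$ is a corolla; a morphism of $\Gamma$ is called a grafting if its image under $\psi$ is one, and similarly for the other notions. 1. Every $\tau$ with $\psi(\tau)$ connected (and non-empty) has a morphism to a $\Gamma$-corolla that is bijective on tails, unique up to unique isomorphism under $\tau$. 2. Every $\tau$ has a total grafting $\circ_\tau:\coprod_{v\in V_\tau}\tau_v\to\tau$, i.e. a grafting from a disjoint union of $\Gamma$-corollas, unique up to a unique isomorphism of families of corollas over $\tau$. 3. Every $h:\tau\to\sigma$ has an atomization over every total grafting $\circ_\sigma:\coprod_v\sigma_v\to\sigma$: morphisms $h_v:\tau_v\to\sigma_v$ and a grafting $k:\coprod_v\tau_v\to\tau$ such that $h\circ k=\circ_\sigma\circ\coprod_v h_v$ and such that the edges of $\tau$ contracted by $h$ are already edges of $\coprod_v\tau_v$; it is unique up to unique isomorphism. 4. For every total grafting $\circ_\sigma$ and all morphisms $h_v:\tau_v\to\sigma_v$ there are $h:\tau\to\sigma$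 grafting nothing and $k$ such that $(h_v)_v$ and $k$ form an atomization of $h$; the triple $(\tau,h,k)$ is unique up to unique isomorphism. **Ground category.** Fix a graph category $\Gamma$ and an abelian category $\mathcal G$ with a symmetric monoidal structure $\otimes$ that is exact in each argument. Assume that inner cohomomorphism objects exist in $\mathcal G$: for all $X,Z$ there is a morphism $c:X\to H\otimes Z$ such that for every $Y$ the map $g\mapsto (g\otimes \mathrm{id}_Z)\circ c$ is a bijection $\mathrm{Hom}(H,Y)\to\mathrm{Hom}(X,Y\otimes Z)$; write $H=\underline{\mathrm{cohom}}(X,Z)$. For a $\Gamma$-corolla $\sigma$ let $\Rightarrow\!\sigma$ be the category of morphisms $\tau\to\sigma$ in $\Gamma$ and isomorphisms over $\sigma$. Assume that colimits of shape $\Rightarrow\!\sigma$ exist in $\mathcal G$ and are preserved by $\otimes$ in each argument, for every $\sigma$. **Operads.** A collection is a functor to $\mathcal G$ from the groupoid of $\Gamma$-corollas and their isomorphisms. An operad is a strong symmetric monoidal functor $\Gamma\to\mathcal G$ that sends graftings to isomorphisms; morphisms of operads are monoidal natural transformations. An operad has an underlying collection, denoted by the same letter. For operads, and for collections, $\bigcirc$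 denotes the objectwise tensor product. For a morphism of collections $i:A_1\to A$ to an operad let $f_A:\mathcal F(A_1)\to A$, where $\mathcal F(A_1)(\sigma)=\mathrm{colim}_{(\tau\to\sigma)\in\,\Rightarrow\sigma}\bigotimes_{v}A_1(\tau_v)$, be the morphism given by $\bigotimes_vA_1(\tau_v)\to\bigotimes_v A(\tau_v)\cong A(\tau)\to A(\sigma)$. If $f_A$ is an epimorphism on each corolla, $\mathcal A=(i_A:A_1\to A)$ is called a presentation of $A$ with generators $A_1$. Let $OP$ be the category of operads with presentation; a morphism $\mathcal A\to\mathcal B$ is a pair of a morphism of collections $A_1\to B_1$ and a morphism of operads $A\to B$ compatible with $i_A,i_B$. For $\mathcal A,\mathcal B\in OP$ let $\mathcal A\Rightarrow\mathcal B$ be the category of triples $(F,u,u_1)$, where $F$ is an operad, $u:A\to F\bigcirc B$ a morphism of operads and $u_1:A_1\to F\bigcirc B_1$ a morphism of collections with $u\circ i_A=(\mathrm{id}_F\bigcirc i_B)\circ u_1$; a morphism $(F,u,u_1)\to(F',u',u'_1)$ is a morphism of operads $v:F\to F'$ with $(v\bigcirc \mathrm{id}_B)\circ u=u'$ and $(v\bigcirc\mathrm{id}_{B_1})\circ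 u_1=u_1'$. **Theorem 2.2.** Let $\mathcal A,\mathcal B\in OP$. There exists $E_1=\underline{\mathrm{cohom}}(A_1,B_1)$ in the category of collections with $\bigcirc$. For any such $E_1$, with coevaluation $c:A_1\to E_1\bigcirc B_1$, there are an operad $E$ with a presentation $\mathcal E=(i_E:E_1\to E)$ and a morphism of operads $\delta:A\to E\bigcirc B$ such that, with $\delta_1=(i_E\bigcirc\mathrm{id}_{B_1})\circ c$: (a) $(E,\delta,\delta_1)$ is an initial object of $\mathcal A\Rightarrow\mathcal B$, and for any other initial object there is exactly one isomorphism from $(E,\delta,\delta_1)$ to it. (b) Let $\mathcal F=(i_F:F_1\to F)\in OP$, let $w:A_1\to F_1\bigcirc B_1$ be a morphism of collections and $u:A\to F\bigcirc B$ a morphism of operads such that $(F,u,(i_F\bigcirc\mathrm{id})\circ w)$ is an object of $\mathcal A\Rightarrow\mathcal B$. Then there is exactly one morphism $g=(g_1,g_0):\mathcal E\to\mathcal F$ of $OP$ with $(g_1\bigcirc\mathrm{id}_{B_1})\circ c=w$, and $g_0:E\to F$ is the canonical morphism from the initial object. (c) For all $\mathcal F,\mathcal G'\in OP$ there is the product $\mathcal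 F\bigodot\mathcal G'\in OP$: the minimal suboperad of $F\bigcirc G'$ containing the image of $i_F\bigcirc i_{G'}$, presented by $F_1\bigcirc G'_1$. The pair $(c,\delta)$ defines a morphism $\mathrm{coev}:\mathcal A\to\mathcal E\bigodot\mathcal B$ in $OP$. For every $\mathcal F\in OP$, every $g:\mathcal E\to\mathcal F$ induces a unique morphism $g\bigodot\mathrm{id}:\mathcal E\bigodot\mathcal B\to\mathcal F\bigodot\mathcal B$, given by $g_1\bigcirc\mathrm{id}_{B_1}$ on generators and by the restriction of $g_0\bigcirc\mathrm{id}_B$ on operads, and $g\mapsto(g\bigodot\mathrm{id})\circ\mathrm{coev}$ is a bijection $\mathrm{Hom}_{OP}(\mathcal E,\mathcal F)\to\mathrm{Hom}_{OP}(\mathcal A,\mathcal F\bigodot\mathcal B)$. That is, $\mathcal E=\underline{\mathrm{cohom}}_{OP}(\mathcal A,\mathcal B)$. -/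

import Mathlib

open CategoryTheory MonoidalCategory Limits

universe v u v' u'

namespace GraphOperad

/-! ### Tensor products of finite families in a symmetric monoidal category -/

/-- A finite family of objects of `C` (with an unordered index set). -/
structure FinFam (C : Type u) where
  /-- the index set -/
  ι : Type
  [fintype : Fintype ι]
  /-- the members of the family -/
  obj : ι → C

attribute [instance] FinFam.fintype

namespace FinFam

/-- A morphism of finite families: a bijection of the index sets together with a morphism between
the corresponding members. -/
@[ext]
structure Hom {C : Type u} [Category.{v} C] (X Y : FinFam C) where
  /-- the bijection of index sets -/
  e : X.ι ≃ Y.ι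
  /-- the components -/
  app : ∀ i, X.obj i ⟶ Y.obj (e i)

instance {C : Type u} [Category.{v} C] : Category (FinFam C) where
  Hom X Y := Hom X Y
  id X := ⟨Equiv.refl _, fun i => 𝟙 (X.obj i)⟩
  comp f g := ⟨f.e.trans g.e, fun i => f.app i ≫ g.app (f.e i)⟩
  id_comp f := by
    refine Hom.ext ?_ ?_
    · rfl
    · apply heq_of_eq; funext i; exact Category.id_comp _
  comp_id f := by
    refine Hom.ext ?_ ?_
    · rfl
    · apply heq_of_eq; funext i; exact Category.comp_id _
  assoc f g h := by
    refine Hom.ext ?_ ?_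
    · rfl
    · apply heq_of_eq; funext i; exact Category.assoc _ _ _

/-- A functor applied to a finite family, member by member. -/
def mapFunctor {C : Type u} [Category.{v} C] {D : Type u'} [Category.{v'} D] (F : C ⥤ D) :
    FinFam C ⥤ FinFam D where
  obj X := ⟨X.ι, fun i => F.obj (X.obj i)⟩
  map f := ⟨f.e, fun i => F.map (f.app i)⟩
  map_id X := by
    refine Hom.ext rfl ?_
    apply heq_of_eq; funext i; exact F.map_id _
  map_comp f g := by
    refine Hom.ext rfl ?_
    apply heq_of_eq; funext i; exact F.map_comp _ _

/-- A morphism of families with the same index set, given by its components. -/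
def homMk {C : Type u} [Category.{v} C] {ι : Type} [Fintype ι] {X Y : ι → C}
    (f : ∀ i, X i ⟶ Y i) : (⟨ι, X⟩ : FinFam C) ⟶ ⟨ι, Y⟩ :=
  ⟨Equiv.refl ι, f⟩

section Tensor

variable {C : Type u} [Category.{v} C] [MonoidalCategory C]

/-- The tensor product of the members of a family along a list of indices. -/
def listTensor {ι : Type} (X : ι → C) : List ι → C
  | [] => 𝟙_ C
  | a :: l => X a ⊗ listTensor X l

/-- Functoriality of `listTensor` in the members of the family. -/
def listMap {ι κ : Type} {X : ι → C} {Y : κ → C} (e : ι → κ) (f : ∀ i, X i ⟶ Y (e i)) :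
    (l : List ι) → (listTensor X l ⟶ listTensor Y (l.map e))
  | [] => 𝟙 _
  | a :: l => f a ⊗ₘ listMap e f l

theorem listMap_id {ι : Type} (X : ι → C) (l : List ι) :
    HEq (listMap (Y := X) _root_.id (fun i => 𝟙 (X i)) l) (𝟙 (listTensor X l)) := by
  induction l with
  | nil => rfl
  | cons a l ih =>
    have : ∀ (l' : List ι) (_ : l' = l) (g : listTensor X l ⟶ listTensor X l')
        (_ : HEq g (𝟙 (listTensor X l))), HEq (𝟙 (X a) ⊗ₘ g) (𝟙 (X a ⊗ listTensor X l)) := by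
      rintro _ rfl g hg
      obtain rfl := eq_of_heq hg
      simp
    exact this _ (by simp) _ ih

theorem listMap_comp {ι κ μ : Type} {X : ι → C} {Y : κ → C} {Z : μ → C} (e : ι → κ) (e' : κ → μ)
    (f : ∀ i, X i ⟶ Y (e i)) (g : ∀ i, Y i ⟶ Z (e' i)) (l : List ι) :
    HEq (listMap (Y := Z) (fun i => e' (e i)) (fun i => f i ≫ g (e i)) l)
      (listMap e f l ≫ listMap e' g (l.map e)) := by
  induction l with
  | nil => exact heq_of_eq (Category.id_comp _).symm
  | cons a l ih =>
    have : ∀ (l' : List μ) (_ : l' = (l.map e).map e') (h : listTensor X l ⟶ listTensor Z l')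
        (_ : HEq h (listMap e f l ≫ listMap e' g (l.map e))),
        HEq ((f a ≫ g (e a)) ⊗ₘ h)
          ((f a ⊗ₘ listMap e f l) ≫ (g (e a) ⊗ₘ listMap e' g (l.map e))) := by
      rintro _ rfl h hh
      obtain rfl := eq_of_heq hh
      simp
    exact this _ (by simp) _ ih

variable [SymmetricCategory C]

/-- The interchange of the first two factors. -/
def swapHom (A B D : C) : A ⊗ (B ⊗ D) ⟶ B ⊗ (A ⊗ D) :=
  (α_ A B D).inv ≫ ((β_ A B).hom ▷ D) ≫ (α_ B A D).hom

/-- `IsReorder X l l' p`: the morphism `p` is obtained by composing interchanges of neighbouring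
factors, hence it is a reordering of the factors. -/
inductive IsReorder {ι : Type} (X : ι → C) :
    (l l' : List ι) → (listTensor X l ⟶ listTensor X l') → Prop
  | nil : IsReorder X [] [] (𝟙 _)
  | cons (a : ι) {l l' : List ι} {p : listTensor X l ⟶ listTensor X l'} :
      IsReorder X l l' p → IsReorder X (a :: l) (a :: l') (X a ◁ p)
  | swap (a b : ι) (l : List ι) :
      IsReorder X (a :: b :: l) (b :: a :: l) (swapHom (X a) (X b) (listTensor X l))
  | trans {l l' l'' : List ι} {p : listTensor X l ⟶ listTensor X l'}
      {q : listTensor X l' ⟶ listTensor X l''} :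
      IsReorder X l l' p → IsReorder X l' l'' q → IsReorder X l l'' (p ≫ q)

theorem exists_isReorder {ι : Type} (X : ι → C) {l l' : List ι} (h : l.Perm l') :
    ∃ p, IsReorder X l l' p := by
  induction h with
  | nil => exact ⟨_, .nil⟩
  | cons a _ ih => obtain ⟨p, hp⟩ := ih; exact ⟨_, .cons a hp⟩
  | swap a b l => exact ⟨_, .swap b a l⟩
  | trans _ _ ih ih' =>
    obtain ⟨p, hp⟩ := ih
    obtain ⟨q, hq⟩ := ih'
    exact ⟨_, .trans hp hq⟩

theorem IsReorder.perm {ι : Type} {X : ι → C} {l l' : List ι}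
    {p : listTensor X l ⟶ listTensor X l'} (h : IsReorder X l l' p) : l.Perm l' := by
  induction h with
  | nil => exact .nil
  | cons a _ ih => exact .cons a ih
  | swap a b l => exact .swap b a l
  | trans _ _ ih ih' => exact ih.trans ih'

/-- `Extract X a l r f`: the list `r` is `l` without one occurrence of `a`, and `f` moves this
factor to the front. -/
inductive Extract {ι : Type} (X : ι → C) (a : ι) :
    (l r : List ι) → (listTensor X l ⟶ X a ⊗ listTensor X r) → Prop
  | head (r : List ι) : Extract X a (a :: r) r (𝟙 _)
  | tail (b : ι) {l r : List ι} {f : listTensor X l ⟶ X a ⊗ listTensor X r} :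
      Extract X a l r f →
        Extract X a (b :: l) (b :: r) (X b ◁ f ≫ swapHom (X b) (X a) (listTensor X r))

theorem Extract.mem {ι : Type} {X : ι → C} {a : ι} {l r : List ι}
    {f : listTensor X l ⟶ X a ⊗ listTensor X r} (h : Extract X a l r f) : a ∈ l := by
  induction h with
  | head r => simp
  | tail b _ ih => simp [ih]

theorem swapHom_swapHom (A B D : C) : swapHom A B D ≫ swapHom B A D = 𝟙 _ := by
  simp [swapHom, ← comp_whiskerRight_assoc]

theorem swapHom_natural {A A' B B' D D' : C} (f : A ⟶ A') (g : B ⟶ B') (h : D ⟶ D') :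
    (f ⊗ₘ (g ⊗ₘ h)) ≫ swapHom A' B' D' = swapHom A B D ≫ (g ⊗ₘ (f ⊗ₘ h)) := by
  simp only [swapHom, Category.assoc]
  rw [← associator_naturality, associator_inv_naturality_assoc]
  simp only [← tensorHom_id, tensorHom_comp_tensorHom_assoc, Category.comp_id, Category.id_comp,
    BraidedCategory.braiding_naturality]

theorem swapHom_natural_right (A B : C) {D D' : C} (h : D ⟶ D') :
    (A ◁ B ◁ h) ≫ swapHom A B D' = swapHom A B D ≫ (B ◁ A ◁ h) := by
  simpa using swapHom_natural (𝟙 A) (𝟙 B) h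

theorem swapHom_yang_baxter (A B D E : C) :
    A ◁ swapHom B D E ≫ swapHom A D (B ⊗ E) ≫ D ◁ swapHom A B E =
      swapHom A B (D ⊗ E) ≫ B ◁ swapHom A D E ≫ swapHom B D (A ⊗ E) := by
  simp only [swapHom]
  calc _ = 𝟙 _ ⊗≫ ((A ◁ (β_ B D).hom ⊗≫ (β_ A D).hom ▷ B ⊗≫ D ◁ (β_ A B).hom) ▷ E) ⊗≫ 𝟙 _ := by
        monoidal
    _ = 𝟙 _ ⊗≫ (((β_ A B).hom ▷ D ⊗≫ B ◁ (β_ A D).hom ⊗≫ (β_ B D).hom ▷ A) ▷ E) ⊗≫ 𝟙 _ := by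
        rw [BraidedCategory.yang_baxter']; monoidal
    _ = _ := by monoidal

theorem extract_aux_cons {A B L L' R R' : C} {f : L ⟶ A ⊗ R} {f' : L' ⟶ A ⊗ R'} {p : L ⟶ L'}
    {q : R ⟶ R'} (h : f ≫ (A ◁ q) = p ≫ f') :
    (B ◁ f ≫ swapHom B A R) ≫ (A ◁ (B ◁ q)) = (B ◁ p) ≫ B ◁ f' ≫ swapHom B A R' := by
  rw [Category.assoc, ← swapHom_natural_right, ← whiskerLeft_comp_assoc, h,
    whiskerLeft_comp_assoc]

theorem extract_aux_swap {A B D L R : C} {f : L ⟶ A ⊗ R} :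
    (B ◁ (D ◁ f ≫ swapHom D A R) ≫ swapHom B A (D ⊗ R)) ≫ A ◁ swapHom B D R =
      swapHom B D L ≫ D ◁ (B ◁ f ≫ swapHom B A R) ≫ swapHom D A (B ⊗ R) := by
  simp only [whiskerLeft_comp, Category.assoc]
  rw [swapHom_yang_baxter, ← Category.assoc, swapHom_natural_right, Category.assoc]

theorem Extract.exists_of_mem {ι : Type} (X : ι → C) {a : ι} {l : List ι} (h : a ∈ l) :
    ∃ r f, Extract X a l r f := by
  induction l with
  | nil => simp at h
  | cons b l ih =>
    by_cases hab : a = b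
    · subst hab; exact ⟨_, _, .head l⟩
    · obtain ⟨r, f, hf⟩ := ih (by simpa [hab] using h)
      exact ⟨_, _, .tail b hf⟩

/-- In a list without repetitions, the head can be extracted in one way only. -/
theorem Extract.eq_of_nodup {ι : Type} {X : ι → C} {a : ι} {l r : List ι}
    {f : listTensor X (a :: l) ⟶ X a ⊗ listTensor X r} (h : Extract X a (a :: l) r f)
    (hl : (a :: l).Nodup) : ∃ e : r = l, f = eqToHom (by rw [e]; rfl) := by
  cases h with
  | head => exact ⟨rfl, rfl⟩
  | tail _ h' => exact absurd h'.mem (List.nodup_cons.1 hl).1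

theorem IsReorder.refl {ι : Type} (X : ι → C) : (l : List ι) → IsReorder X l l (𝟙 _)
  | [] => .nil
  | a :: l => by
    have := (IsReorder.refl X l).cons a
    rwa [whiskerLeft_id] at this

/-- Reorderings are compatible with moving a factor to the front. -/
theorem IsReorder.extract {ι : Type} {X : ι → C} {a : ι} {l l' : List ι}
    {p : listTensor X l ⟶ listTensor X l'} (hp : IsReorder X l l' p) :
    ∀ {r : List ι} {f : listTensor X l ⟶ X a ⊗ listTensor X r}, Extract X a l r f →
    ∃ (r' : List ι) (f' : listTensor X l' ⟶ X a ⊗ listTensor X r')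
      (q : listTensor X r ⟶ listTensor X r'),
      Extract X a l' r' f' ∧ IsReorder X r r' q ∧ f ≫ (X a ◁ q) = p ≫ f' := by
  induction hp with
  | nil => intro r f hf; cases hf
  | @cons b l l' p hp ih =>
    intro r f hf
    cases hf with
    | head => exact ⟨_, _, p, .head _, hp, (Category.id_comp _).trans (Category.comp_id _).symm⟩
    | tail _ hf =>
      obtain ⟨r', f', q, h1, h2, h3⟩ := ih hf
      exact ⟨_, _, _, .tail b h1, .cons b h2, extract_aux_cons h3⟩
  | swap b c l =>
    intro r f hf
    cases hf with
    | head =>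
      refine ⟨_, _, 𝟙 _, .tail c (.head l), .refl _ _, ?_⟩
      have : ∀ A B D : C, 𝟙 _ ≫ A ◁ (𝟙 (B ⊗ D)) =
          swapHom A B D ≫ B ◁ (𝟙 (A ⊗ D)) ≫ swapHom B A D := by
        intro A B D; simp [swapHom_swapHom]
      exact this _ _ _
    | tail _ hf =>
      cases hf with
      | head =>
        refine ⟨_, _, 𝟙 _, .head _, .refl _ _, ?_⟩
        have : ∀ A B D : C, (A ◁ (𝟙 (B ⊗ D)) ≫ swapHom A B D) ≫ B ◁ (𝟙 (A ⊗ D)) =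
            swapHom A B D ≫ 𝟙 _ := by
          intro A B D; simp
        exact this _ _ _
      | tail _ hf => exact ⟨_, _, _, .tail c (.tail b hf), .swap b c _, extract_aux_swap⟩
  | trans _ _ ih ih' =>
    intro r f hf
    obtain ⟨r', f', q, h1, h2, h3⟩ := ih hf
    obtain ⟨r'', f'', q', h1', h2', h3'⟩ := ih' h1
    exact ⟨r'', f'', q ≫ q', h1', h2.trans h2', by
      rw [whiskerLeft_comp, reassoc_of% h3, h3', Category.assoc]⟩

theorem IsReorder.eq_id {ι : Type} {X : ι → C} : {l : List ι} → l.Nodup →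
    {p : listTensor X l ⟶ listTensor X l} → IsReorder X l l p → p = 𝟙 _
  | [], _, p, hp => by
    have key : ∀ {l l' : List ι} {p : listTensor X l ⟶ listTensor X l'}, IsReorder X l l' p →
        ∀ (h : l = []) (h' : l' = []), p = eqToHom (by rw [h, h']) := by
      intro l l' p hp
      induction hp with
      | nil => intros; rfl
      | cons => intro h; simp at h
      | swap => intro h; simp at h
      | trans h1 h2 ih ih' =>
        intro h h'
        have h'' := h ▸ h1.perm
        obtain rfl := List.nil_perm.1 h''
        rw [ih h rfl, ih' rfl h', eqToHom_trans]
    exact key hp rfl rfl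
  | a :: l, hl, p, hp => by
    obtain ⟨r', f', q, h1, h2, h3⟩ := hp.extract (.head l)
    obtain ⟨rfl, rfl⟩ := h1.eq_of_nodup hl
    have h4 := IsReorder.eq_id (List.nodup_cons.1 hl).2 h2
    subst h4
    have h5 : 𝟙 _ ≫ X a ◁ (𝟙 (listTensor X r')) = 𝟙 _ := by simp
    exact ((Category.comp_id _).symm.trans (h3.symm.trans h5))

theorem IsReorder.exists_inv {ι : Type} {X : ι → C} {l l' : List ι}
    {p : listTensor X l ⟶ listTensor X l'} (hp : IsReorder X l l' p) :
    ∃ q, IsReorder X l' l q ∧ p ≫ q = 𝟙 _ ∧ q ≫ p = 𝟙 _ := by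
  induction hp with
  | nil => exact ⟨_, .nil, Category.id_comp _, Category.id_comp _⟩
  | cons a _ ih =>
    obtain ⟨q, h1, h2, h3⟩ := ih
    refine ⟨_, .cons a h1, ?_, ?_⟩
    · exact (whiskerLeft_comp _ _ _).symm.trans (by rw [h2]; exact whiskerLeft_id _ _)
    · exact (whiskerLeft_comp _ _ _).symm.trans (by rw [h3]; exact whiskerLeft_id _ _)
  | swap a b l => exact ⟨_, .swap b a l, swapHom_swapHom _ _ _, swapHom_swapHom _ _ _⟩
  | trans _ _ ih ih' =>
    obtain ⟨q, h1, h2, h3⟩ := ih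
    obtain ⟨q', h1', h2', h3'⟩ := ih'
    refine ⟨q' ≫ q, .trans h1' h1, ?_, ?_⟩
    · rw [Category.assoc, reassoc_of% h2', h2]
    · rw [Category.assoc, reassoc_of% h3, h3']

/-- Coherence: without repetitions of indices, there is only one reordering between two lists. -/
theorem IsReorder.unique {ι : Type} {X : ι → C} {l l' : List ι} (hl : l.Nodup)
    {p q : listTensor X l ⟶ listTensor X l'} (hp : IsReorder X l l' p)
    (hq : IsReorder X l l' q) : p = q := by
  obtain ⟨q', h1, h2, h3⟩ := hq.exists_inv
  have := (hp.trans h1).eq_id hl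
  calc p = (p ≫ q') ≫ q := by rw [Category.assoc, h3, Category.comp_id]
    _ = q := by rw [this, Category.id_comp]

/-- The canonical reordering. -/
noncomputable def reorder {ι : Type} (X : ι → C) {l l' : List ι} (h : l.Perm l') :
    listTensor X l ⟶ listTensor X l' :=
  (exists_isReorder X h).choose

theorem reorder_spec {ι : Type} (X : ι → C) {l l' : List ι} (h : l.Perm l') :
    IsReorder X l l' (reorder X h) :=
  (exists_isReorder X h).choose_spec

theorem IsReorder.map_naturality {ι κ : Type} {X : ι → C} {Y : κ → C} (e : ι → κ)
    (f : ∀ i, X i ⟶ Y (e i)) {l l' : List ι} {p : listTensor X l ⟶ listTensor X l'}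
    (hp : IsReorder X l l' p) :
    ∃ q, IsReorder Y (l.map e) (l'.map e) q ∧ p ≫ listMap e f l' = listMap e f l ≫ q := by
  induction hp with
  | nil => exact ⟨_, .nil, rfl⟩
  | @cons a l l' p _ ih =>
    obtain ⟨q, h1, h2⟩ := ih
    refine ⟨_, .cons _ h1, ?_⟩
    have : ∀ {A B L L' M M' : C} (f : A ⟶ B) {p : L ⟶ L'} {g' : L' ⟶ M'} {g : L ⟶ M} {q : M ⟶ M'},
        p ≫ g' = g ≫ q → (A ◁ p) ≫ (f ⊗ₘ g') = (f ⊗ₘ g) ≫ B ◁ q := by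
      intro A B L L' M M' f p g' g q h
      rw [← id_tensorHom, ← id_tensorHom, tensorHom_comp_tensorHom, tensorHom_comp_tensorHom, h,
        Category.id_comp, Category.comp_id]
    exact this _ h2
  | swap a b l => exact ⟨_, .swap _ _ _, (swapHom_natural _ _ _).symm⟩
  | trans _ _ ih ih' =>
    obtain ⟨q, h1, h2⟩ := ih
    obtain ⟨q', h1', h2'⟩ := ih'
    exact ⟨q ≫ q', h1.trans h1', by rw [Category.assoc, h2', reassoc_of% h2]⟩

theorem perm_toList {ι κ : Type} [Fintype ι] [Fintype κ] (e : ι ≃ κ) :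
    ((Finset.univ : Finset ι).toList.map e).Perm (Finset.univ : Finset κ).toList := by
  rw [List.perm_ext_iff_of_nodup ((Finset.nodup_toList _).map e.injective)
    (Finset.nodup_toList _)]
  intro a
  simpa using e.surjective a

/-- The tensor product of a finite family, as a functor on the category of finite families: a
morphism of families acts by its components, followed by the canonical reordering of factors. -/
noncomputable def tensor : FinFam C ⥤ C where
  obj X := listTensor X.obj Finset.univ.toList
  map {X Y} f := listMap f.e f.app Finset.univ.toList ≫ reorder Y.obj (perm_toList f.e)
  map_id X := by
    have key : ∀ (l : List X.ι) (h : l.Perm (Finset.univ : Finset X.ι).toList) (_ : l = Finset.univ.toList)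
        (g : listTensor X.obj Finset.univ.toList ⟶ listTensor X.obj l)
        (_ : HEq g (𝟙 (listTensor X.obj (Finset.univ : Finset X.ι).toList))),
        g ≫ reorder X.obj h = 𝟙 _ := by
      rintro l h rfl g hg
      obtain rfl := eq_of_heq hg
      rw [(reorder_spec X.obj h).eq_id (Finset.nodup_toList _), Category.comp_id]
    exact key _ _ (List.map_id _) _ (listMap_id _ _)
  map_comp {X Y Z} f g := by
    obtain ⟨q, h1, h2⟩ := (reorder_spec Y.obj (perm_toList f.e)).map_naturality g.e g.app
    rw [Category.assoc, reassoc_of% h2, ← Category.assoc]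
    have key : ∀ (l l' : List Z.ι) (hl : l = l') (hn : l.Nodup)
        (h : l.Perm (Finset.univ : Finset Z.ι).toList)
        (a : listTensor X.obj Finset.univ.toList ⟶ listTensor Z.obj l)
        (a' : listTensor X.obj Finset.univ.toList ⟶ listTensor Z.obj l')
        (r : listTensor Z.obj l' ⟶ listTensor Z.obj (Finset.univ : Finset Z.ι).toList)
        (_ : HEq a a') (_ : IsReorder _ _ _ r),
        a ≫ reorder Z.obj h = a' ≫ r := by
      rintro l _ rfl hn h a a' r ha hr
      obtain rfl := eq_of_heq ha
      rw [IsReorder.unique hn (reorder_spec _ _) hr]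
    exact key _ ((Finset.univ.toList.map f.e).map g.e) (by rw [List.map_map]; rfl) ((Finset.nodup_toList _).map (f ≫ g).e.injective) _ _ _ _
      (listMap_comp f.e g.e f.app g.app _) (h1.trans (reorder_spec _ _))
section MonoidalFunctor

variable {D : Type u'} [Category.{v'} D] [MonoidalCategory D] [SymmetricCategory D]
  (F : C ⥤ D) [F.Braided]

open Functor.LaxMonoidal

/-- The comparison between the tensor product of the values of a monoidal functor and the value on
the tensor product, along a list. -/
def listComparison {ι : Type} (X : ι → C) : (l : List ι) →
    (listTensor (fun i => F.obj (X i)) l ⟶ F.obj (listTensor X l))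
  | [] => ε F
  | a :: l => (F.obj (X a) ◁ listComparison X l) ≫ μ F (X a) (listTensor X l)

theorem listComparison_map {ι κ : Type} {X : ι → C} {Y : κ → C} (e : ι → κ)
    (f : ∀ i, X i ⟶ Y (e i)) : (l : List ι) →
    listMap (X := fun i => F.obj (X i)) (Y := fun i => F.obj (Y i)) e (fun i => F.map (f i)) l ≫
      listComparison F Y (l.map e) = listComparison F X l ≫ F.map (listMap e f l)
  | [] => ((Category.id_comp _).trans (Category.comp_id _).symm).trans
      (congrArg (fun t => ε F ≫ t) (F.map_id (𝟙_ C)).symm)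
  | a :: l => by
    have : ∀ {A B L M : C} {L' M' : D} (f : A ⟶ B) {p : L ⟶ M} {p' : L' ⟶ M'}
        {c : L' ⟶ F.obj L} {d : M' ⟶ F.obj M}, p' ≫ d = c ≫ F.map p →
        (F.map f ⊗ₘ p') ≫ (F.obj B ◁ d) ≫ μ F B M =
          ((F.obj A ◁ c) ≫ μ F A L) ≫ F.map (f ⊗ₘ p) := by
      intro A B L M L' M' f p p' c d h
      rw [Category.assoc, ← μ_natural, ← id_tensorHom, ← id_tensorHom,
        tensorHom_comp_tensorHom_assoc, tensorHom_comp_tensorHom_assoc, h,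
        Category.id_comp, Category.comp_id]
    exact this (f a) (listComparison_map e f l)

theorem swapHom_comparison {A B L : C} {L' : D} (c : L' ⟶ F.obj L) :
    swapHom (F.obj A) (F.obj B) L' ≫
        (F.obj B ◁ ((F.obj A ◁ c) ≫ μ F A L)) ≫ μ F B (A ⊗ L) =
      ((F.obj A ◁ ((F.obj B ◁ c) ≫ μ F B L)) ≫ μ F A (B ⊗ L)) ≫ F.map (swapHom A B L) := by
  have h1 := swapHom_natural_right (F.obj A) (F.obj B) c
  have h2 : swapHom (F.obj A) (F.obj B) (F.obj L) ≫ (F.obj B ◁ μ F A L) ≫ μ F B (A ⊗ L) =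
      (F.obj A ◁ μ F B L) ≫ μ F A (B ⊗ L) ≫ F.map (swapHom A B L) := by
    simp only [swapHom, Functor.map_comp, Category.assoc]
    rw [← associativity, associativity_inv_assoc, ← μ_natural_left_assoc,
      ← comp_whiskerRight_assoc, ← comp_whiskerRight_assoc, Functor.LaxBraided.braided]
  simp only [whiskerLeft_comp, Category.assoc]
  rw [← reassoc_of% h1, h2]

theorem IsReorder.comparison {ι : Type} {X : ι → C} {l l' : List ι}
    {p : listTensor X l ⟶ listTensor X l'} (hp : IsReorder X l l' p) :
    ∃ q, IsReorder (fun i => F.obj (X i)) l l' q ∧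
      q ≫ listComparison F X l' = listComparison F X l ≫ F.map p := by
  induction hp with
  | nil => exact ⟨_, .nil, ((Category.id_comp _).trans (Category.comp_id _).symm).trans
      (congrArg (fun t => ε F ≫ t) (F.map_id (𝟙_ C)).symm)⟩
  | @cons a l l' p _ ih =>
    obtain ⟨q, h1, h2⟩ := ih
    refine ⟨_, .cons _ h1, ?_⟩
    have : ∀ {A L M : C} {L' M' : D} {p : L ⟶ M} {p' : L' ⟶ M'}
        {c : L' ⟶ F.obj L} {d : M' ⟶ F.obj M}, p' ≫ d = c ≫ F.map p →
        (F.obj A ◁ p') ≫ (F.obj A ◁ d) ≫ μ F A M =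
          ((F.obj A ◁ c) ≫ μ F A L) ≫ F.map (A ◁ p) := by
      intro A L M L' M' p p' c d h
      rw [Category.assoc, ← μ_natural_right, ← whiskerLeft_comp_assoc, ← whiskerLeft_comp_assoc, h]
    exact this h2
  | swap a b l => exact ⟨_, .swap _ _ _, swapHom_comparison F _⟩
  | trans _ _ ih ih' =>
    obtain ⟨q, h1, h2⟩ := ih
    obtain ⟨q', h1', h2'⟩ := ih'
    exact ⟨q ≫ q', h1.trans h1', by
      rw [Category.assoc, h2', reassoc_of% h2, Functor.map_comp]⟩

/-- The canonical comparison `⨂ᵢ F(Xᵢ) ⟶ F(⨂ᵢ Xᵢ)` of a symmetric monoidal functor `F`,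
natural in the family. -/
noncomputable def comparison : mapFunctor F ⋙ tensor ⟶ tensor ⋙ F where
  app X := listComparison F X.obj Finset.univ.toList
  naturality X Y f := by
    obtain ⟨q, h1, h2⟩ := (reorder_spec Y.obj (perm_toList f.e)).comparison F
    have h3 := IsReorder.unique ((Finset.nodup_toList _).map f.e.injective)
      (reorder_spec (fun i => F.obj (Y.obj i)) (perm_toList f.e)) h1
    have h4 := listComparison_map F f.e f.app Finset.univ.toList
    change (listMap (X := fun i => F.obj (X.obj i)) (Y := fun i => F.obj (Y.obj i)) f.e
      (fun i => F.map (f.app i)) Finset.univ.toList ≫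
      reorder (fun i => F.obj (Y.obj i)) (perm_toList f.e)) ≫ listComparison F Y.obj _ =
      listComparison F X.obj _ ≫ F.map (_ ≫ _)
    rw [h3, Category.assoc, h2, reassoc_of% h4, Functor.map_comp]

end MonoidalFunctor
end Tensor
end FinFam

/-! ### The category of graphs -/

/-- A (finite, not necessarily connected) graph: flags, vertices, the boundary map and the
involution on flags. -/
structure Graph where
  /-- the flags -/
  Flag : Type
  /-- the vertices -/
  Vertex : Type
  [finite_flag : Finite Flag]
  [finite_vertex : Finite Vertex]
  /-- the boundary vertex of a flag -/
  bd : Flag → Vertex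
  /-- the involution; its fixed points are the tails, its two-element orbits are the edges -/
  inv : Flag → Flag
  inv_inv : ∀ f, inv (inv f) = f

attribute [instance] Graph.finite_flag Graph.finite_vertex

namespace Graph

/-- Flags fixed by the involution. -/
def IsTail (τ : Graph) (f : τ.Flag) : Prop := τ.inv f = f

/-- A corolla: one vertex, no edges. -/
def IsCorolla (τ : Graph) : Prop :=
  Nonempty (Unique τ.Vertex) ∧ ∀ f, τ.IsTail f

/-- A graph is connected if it has a vertex and any two vertices are joined by a path of edges. -/
def IsConnected (τ : Graph) : Prop :=
  Nonempty τ.Vertex ∧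
    ∀ v w, Relation.EqvGen (fun v w => ∃ f, τ.bd f = v ∧ τ.bd (τ.inv f) = w) v w

/-- A morphism of graphs `h : τ ⟶ σ`: an injective contravariant map of flags, a surjective
covariant map of vertices, and a pairing of the flags of `τ` that are not in the image (the
contracted flags). The involution `j_h` on the contracted tails is encoded together with
the contracted edges: `pair` is `j_h` on contracted tails, it is the involution of `τ` on the
halves of contracted edges, and it is the identity on the flags that are not contracted. -/
@[ext]
structure Hom (τ σ : Graph) where
  /-- the map of flags `h^F` -/
  flag : σ.Flag → τ.Flag
  /-- the map of vertices `h_V` -/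
  vertex : τ.Vertex → σ.Vertex
  /-- the pairing of contracted flags into actual and virtual edges -/
  pair : τ.Flag → τ.Flag
  flag_injective : Function.Injective flag
  vertex_surjective : Function.Surjective vertex
  pair_pair : ∀ f, pair (pair f) = f
  /-- exactly the flags that are not contracted are fixed by the pairing -/
  pair_eq_self_iff : ∀ f, pair f = f ↔ f ∈ Set.range flag
  /-- contracted halves of edges are paired with the other half -/
  pair_of_edge : ∀ f, f ∉ Set.range flag → ¬ τ.IsTail f → pair f = τ.inv f
  /-- compatibility with the boundaries of flags that are not contracted -/
  bd_flag : ∀ f, vertex (τ.bd (flag f)) = σ.bd f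
  /-- the two vertices of a contracted (actual or virtual) edge are identified -/
  bd_pair : ∀ f, vertex (τ.bd (pair f)) = vertex (τ.bd f)
  /-- the image of `h^F` is stable under the involution of `τ`, and edges of `τ` in the image
  come from edges of `σ` -/
  inv_flag : ∀ f, ¬ τ.IsTail (flag f) → τ.inv (flag f) = flag (σ.inv f)

theorem Hom.pair_flag {τ σ : Graph} (h : Hom τ σ) (f : σ.Flag) : h.pair (h.flag f) = h.flag f :=
  (h.pair_eq_self_iff _).2 ⟨f, rfl⟩

theorem Hom.pair_not_mem {τ σ : Graph} (h : Hom τ σ) {f : τ.Flag} (hf : f ∉ Set.range h.flag) :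
    h.pair f ∉ Set.range h.flag := by
  intro h'
  have := (h.pair_eq_self_iff _).2 h'
  rw [h.pair_pair] at this
  exact hf ((h.pair_eq_self_iff _).1 this.symm)

open Classical in
/-- The pairing of a composition of morphisms: the union of the pairings. -/
noncomputable def compPair {τ σ ρ : Graph} (h : Hom τ σ) (g : Hom σ ρ) (f : τ.Flag) : τ.Flag :=
  if hf : ∃ f', h.flag f' = f then h.flag (g.pair hf.choose) else h.pair f

theorem compPair_flag {τ σ ρ : Graph} (h : Hom τ σ) (g : Hom σ ρ) (f : σ.Flag) :
    compPair h g (h.flag f) = h.flag (g.pair f) := by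
  have hf : ∃ f', h.flag f' = h.flag f := ⟨f, rfl⟩
  rw [compPair, dif_pos hf, h.flag_injective hf.choose_spec]

theorem compPair_of_not_mem {τ σ ρ : Graph} (h : Hom τ σ) (g : Hom σ ρ) {f : τ.Flag}
    (hf : f ∉ Set.range h.flag) : compPair h g f = h.pair f := dif_neg hf

/-- The identity morphism. -/
def Hom.id (τ : Graph) : Hom τ τ where
  flag := _root_.id
  vertex := _root_.id
  pair := _root_.id
  flag_injective := Function.injective_id
  vertex_surjective := Function.surjective_id
  pair_pair _ := rfl
  pair_eq_self_iff f := by simp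
  pair_of_edge f hf := by simp at hf
  bd_flag _ := rfl
  bd_pair _ := rfl
  inv_flag _ _ := rfl

/-- The composition of morphisms. -/
noncomputable def Hom.comp {τ σ ρ : Graph} (h : Hom τ σ) (g : Hom σ ρ) : Hom τ ρ where
  flag := h.flag ∘ g.flag
  vertex := g.vertex ∘ h.vertex
  pair := compPair h g
  flag_injective := h.flag_injective.comp g.flag_injective
  vertex_surjective := g.vertex_surjective.comp h.vertex_surjective
  pair_pair f := by
    by_cases hf : f ∈ Set.range h.flag
    · obtain ⟨f, rfl⟩ := hf
      rw [compPair_flag, compPair_flag, g.pair_pair]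
    · rw [compPair_of_not_mem _ _ hf, compPair_of_not_mem _ _ (h.pair_not_mem hf), h.pair_pair]
  pair_eq_self_iff f := by
    by_cases hf : f ∈ Set.range h.flag
    · obtain ⟨f, rfl⟩ := hf
      rw [compPair_flag, h.flag_injective.eq_iff, g.pair_eq_self_iff]
      simp [h.flag_injective.eq_iff]
    · rw [compPair_of_not_mem _ _ hf, h.pair_eq_self_iff]
      refine ⟨fun h' => absurd h' hf, ?_⟩
      rintro ⟨x, rfl⟩
      exact ⟨_, rfl⟩
  pair_of_edge f hf ht := by
    by_cases hf' : f ∈ Set.range h.flag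
    · obtain ⟨f, rfl⟩ := hf'
      have h1 := h.inv_flag f ht
      rw [compPair_flag, h1, g.pair_of_edge]
      · rintro ⟨x, rfl⟩
        exact hf ⟨x, rfl⟩
      · intro h2
        rw [IsTail] at h2
        rw [h2] at h1
        exact ht h1
    · rw [compPair_of_not_mem _ _ hf']
      exact h.pair_of_edge f hf' ht
  bd_flag f := by simp [h.bd_flag, g.bd_flag]
  bd_pair f := by
    by_cases hf : f ∈ Set.range h.flag
    · obtain ⟨f, rfl⟩ := hf
      rw [compPair_flag]
      simp [h.bd_flag, g.bd_pair]
    · rw [compPair_of_not_mem _ _ hf]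
      simp [h.bd_pair]
  inv_flag f ht := by
    have h1 := h.inv_flag _ ht
    have h2 : ¬ σ.IsTail (g.flag f) := by
      intro h2
      rw [IsTail] at h2
      rw [h2] at h1
      exact ht h1
    simp only [Function.comp_apply]
    rw [h1, g.inv_flag f h2]

noncomputable instance : Category Graph where
  Hom := Hom
  id := Hom.id
  comp := Hom.comp
  id_comp {τ σ} h := by
    refine Hom.ext rfl rfl ?_
    funext f
    exact compPair_flag (Hom.id τ) h f
  comp_id {τ σ} h := by
    refine Hom.ext rfl rfl ?_
    funext f
    by_cases hf : f ∈ Set.range h.flag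
    · obtain ⟨f, rfl⟩ := hf
      exact (compPair_flag h (Hom.id σ) f).trans (h.pair_flag f).symm
    · exact compPair_of_not_mem _ _ hf
  assoc {τ σ ρ π} h g k := by
    refine Hom.ext rfl rfl ?_
    funext f
    change compPair (Hom.comp h g) k f = compPair h (Hom.comp g k) f
    by_cases hf : f ∈ Set.range h.flag
    · obtain ⟨f, rfl⟩ := hf
      rw [compPair_flag]
      change _ = h.flag (compPair g k f)
      by_cases hf : f ∈ Set.range g.flag
      · obtain ⟨f, rfl⟩ := hf
        rw [compPair_flag]
        exact compPair_flag (Hom.comp h g) k f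
      · rw [compPair_of_not_mem _ _ hf, compPair_of_not_mem]
        · exact compPair_flag h g f
        · rintro ⟨x, hx⟩
          exact hf ⟨x, h.flag_injective hx⟩
    · rw [compPair_of_not_mem _ _ hf, compPair_of_not_mem]
      · exact compPair_of_not_mem h g hf
      · rintro ⟨x, rfl⟩
        exact hf ⟨_, rfl⟩

theorem hom_ext {τ σ : Graph} {h g : τ ⟶ σ} (h1 : ∀ f, h.flag f = g.flag f)
    (h2 : ∀ v, h.vertex v = g.vertex v) (h3 : ∀ f, h.pair f = g.pair f) : h = g :=
  Hom.ext (funext h1) (funext h2) (funext h3)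

theorem hom_ext_of_surjective {τ σ : Graph} {h g : τ ⟶ σ} (hs : Function.Surjective h.flag)
    (h1 : ∀ f, h.flag f = g.flag f) (h2 : ∀ v, h.vertex v = g.vertex v) : h = g := by
  refine hom_ext h1 h2 fun f => ?_
  obtain ⟨f, rfl⟩ := hs f
  rw [h.pair_flag, h1, g.pair_flag]

theorem comp_flag {τ σ ρ : Graph} (h : τ ⟶ σ) (g : σ ⟶ ρ) (f : ρ.Flag) :
    (h ≫ g).flag f = h.flag (g.flag f) := rfl

theorem comp_vertex {τ σ ρ : Graph} (h : τ ⟶ σ) (g : σ ⟶ ρ) (v : τ.Vertex) :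
    (h ≫ g).vertex v = g.vertex (h.vertex v) := rfl

theorem comp_pair {τ σ ρ : Graph} (h : τ ⟶ σ) (g : σ ⟶ ρ) (f : τ.Flag) :
    (h ≫ g).pair f = compPair h g f := rfl

/-- A morphism that contracts no flags and induces an isomorphism of the underlying data. -/
def homOfEquiv {τ σ : Graph} (e : τ.Flag ≃ σ.Flag) (e' : τ.Vertex ≃ σ.Vertex)
    (h : ∀ f, e' (τ.bd f) = σ.bd (e f)) (h' : ∀ f, e (τ.inv f) = σ.inv (e f)) : τ ⟶ σ where
  flag := e.symm
  vertex := e'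
  pair := _root_.id
  flag_injective := e.symm.injective
  vertex_surjective := e'.surjective
  pair_pair _ := rfl
  pair_eq_self_iff f := by simp
  pair_of_edge f hf := absurd (e.symm.surjective f) hf
  bd_flag f := by simp [h]
  bd_pair _ := rfl
  inv_flag f _ := by rw [← e.symm_apply_apply (τ.inv _), h', e.apply_symm_apply]

/-- An isomorphism of graphs given by bijections of flags and vertices. -/
def isoOfEquiv {τ σ : Graph} (e : τ.Flag ≃ σ.Flag) (e' : τ.Vertex ≃ σ.Vertex)
    (h : ∀ f, e' (τ.bd f) = σ.bd (e f)) (h' : ∀ f, e (τ.inv f) = σ.inv (e f)) : τ ≅ σ where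
  hom := homOfEquiv e e' h h'
  inv := homOfEquiv e.symm e'.symm (fun f => by rw [← e'.symm_apply_apply (τ.bd _), h]; simp)
    (fun f => by rw [← e.symm_apply_apply (τ.inv _), h']; simp)
  hom_inv_id := by
    refine hom_ext (fun f => e.symm_apply_apply f) (fun v => e'.symm_apply_apply v) fun f => ?_
    obtain ⟨f, rfl⟩ := e.symm.surjective f
    exact compPair_flag (homOfEquiv e e' h h') _ f
  inv_hom_id := by
    refine hom_ext (fun f => e.apply_symm_apply f) (fun v => e'.apply_symm_apply v) fun f => ?_
    obtain ⟨f, rfl⟩ := e.surjective f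
    exact compPair_flag (homOfEquiv e.symm e'.symm _ _) _ f

/-! #### Disjoint union -/

/-- The disjoint union of two graphs. -/
def sum (τ σ : Graph) : Graph where
  Flag := τ.Flag ⊕ σ.Flag
  Vertex := τ.Vertex ⊕ σ.Vertex
  bd := Sum.map τ.bd σ.bd
  inv := Sum.map τ.inv σ.inv
  inv_inv f := by rcases f with f | f <;> simp [τ.inv_inv, σ.inv_inv]

/-- The empty graph. -/
def empty : Graph where
  Flag := Empty
  Vertex := Empty
  bd := _root_.id
  inv := _root_.id
  inv_inv _ := rfl

theorem inl_mem_range_map {A B A' B' : Type} {f : A → B} {g : A' → B'} {b : B} :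
    Sum.inl b ∈ Set.range (Sum.map f g) ↔ b ∈ Set.range f := by
  constructor
  · rintro ⟨x | x, hx⟩
    · exact ⟨x, Sum.inl_injective hx⟩
    · exact (Sum.inr_ne_inl hx).elim
  · rintro ⟨x, rfl⟩
    exact ⟨Sum.inl x, rfl⟩

theorem inr_mem_range_map {A B A' B' : Type} {f : A → B} {g : A' → B'} {b : B'} :
    Sum.inr b ∈ Set.range (Sum.map f g) ↔ b ∈ Set.range g := by
  constructor
  · rintro ⟨x | x, hx⟩
    · exact (Sum.inl_ne_inr hx).elim
    · exact ⟨x, Sum.inr_injective hx⟩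
  · rintro ⟨x, rfl⟩
    exact ⟨Sum.inr x, rfl⟩

/-- The disjoint union of two morphisms. -/
def sumMap {τ σ τ' σ' : Graph} (h : τ ⟶ σ) (h' : τ' ⟶ σ') : sum τ τ' ⟶ sum σ σ' where
  flag := Sum.map h.flag h'.flag
  vertex := Sum.map h.vertex h'.vertex
  pair := Sum.map h.pair h'.pair
  flag_injective := h.flag_injective.sumMap h'.flag_injective
  vertex_surjective := h.vertex_surjective.sumMap h'.vertex_surjective
  pair_pair f := by
    rcases f with f | f
    · exact congrArg Sum.inl (h.pair_pair f)
    · exact congrArg Sum.inr (h'.pair_pair f)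
  pair_eq_self_iff f := by
    rcases f with f | f
    · exact (Sum.inl_injective.eq_iff.trans (h.pair_eq_self_iff f)).trans inl_mem_range_map.symm
    · exact (Sum.inr_injective.eq_iff.trans (h'.pair_eq_self_iff f)).trans inr_mem_range_map.symm
  pair_of_edge f hf ht := by
    rcases f with f | f
    · exact congrArg Sum.inl (h.pair_of_edge f (fun h1 => hf (inl_mem_range_map.2 h1))
        (fun h1 => ht (congrArg Sum.inl h1)))
    · exact congrArg Sum.inr (h'.pair_of_edge f (fun h1 => hf (inr_mem_range_map.2 h1))
        (fun h1 => ht (congrArg Sum.inr h1)))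
  bd_flag f := by rcases f with f | f <;> simp [sum, h.bd_flag, h'.bd_flag]
  bd_pair f := by rcases f with f | f <;> simp [sum, h.bd_pair, h'.bd_pair]
  inv_flag f := by
    rcases f with f | f
    · simpa [sum, IsTail] using h.inv_flag f
    · simpa [sum, IsTail] using h'.inv_flag f

theorem homOfEquiv_comp_pair {τ σ ρ : Graph} (e : τ.Flag ≃ σ.Flag) (e' : τ.Vertex ≃ σ.Vertex)
    (h : ∀ f, e' (τ.bd f) = σ.bd (e f)) (h' : ∀ f, e (τ.inv f) = σ.inv (e f)) (g : σ ⟶ ρ)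
    (f : τ.Flag) : (homOfEquiv e e' h h' ≫ g).pair f = e.symm (g.pair (e f)) := by
  obtain ⟨f, rfl⟩ := e.symm.surjective f
  rw [e.apply_symm_apply]
  exact compPair_flag (homOfEquiv e e' h h') g f

theorem comp_homOfEquiv_pair {τ σ ρ : Graph} (e : σ.Flag ≃ ρ.Flag) (e' : σ.Vertex ≃ ρ.Vertex)
    (h : ∀ f, e' (σ.bd f) = ρ.bd (e f)) (h' : ∀ f, e (σ.inv f) = ρ.inv (e f)) (g : τ ⟶ σ)
    (f : τ.Flag) : (g ≫ homOfEquiv e e' h h').pair f = g.pair f := by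
  by_cases hf : f ∈ Set.range g.flag
  · obtain ⟨f, rfl⟩ := hf
    exact (compPair_flag g _ f).trans (g.pair_flag f).symm
  · exact compPair_of_not_mem _ _ hf

theorem sumMap_comp {τ σ ρ τ' σ' ρ' : Graph} (h : τ ⟶ σ) (g : σ ⟶ ρ) (h' : τ' ⟶ σ')
    (g' : σ' ⟶ ρ') : sumMap h h' ≫ sumMap g g' = sumMap (h ≫ g) (h' ≫ g') := by
  refine hom_ext ?_ ?_ ?_
  · rintro (f | f) <;> rfl
  · rintro (f | f) <;> rfl
  · rintro (f | f)
    · change compPair (sumMap h h') (sumMap g g') (Sum.inl f) = Sum.inl (compPair h g f)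
      by_cases hf : f ∈ Set.range h.flag
      · obtain ⟨f, rfl⟩ := hf
        rw [compPair_flag]
        exact compPair_flag (sumMap h h') (sumMap g g') (Sum.inl f)
      · rw [compPair_of_not_mem _ _ hf]
        exact compPair_of_not_mem (sumMap h h') (sumMap g g')
          fun h1 => hf (inl_mem_range_map.1 h1)
    · change compPair (sumMap h h') (sumMap g g') (Sum.inr f) = Sum.inr (compPair h' g' f)
      by_cases hf : f ∈ Set.range h'.flag
      · obtain ⟨f, rfl⟩ := hf
        rw [compPair_flag]
        exact compPair_flag (sumMap h h') (sumMap g g') (Sum.inr f)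
      · rw [compPair_of_not_mem _ _ hf]
        exact compPair_of_not_mem (sumMap h h') (sumMap g g')
          fun h1 => hf (inr_mem_range_map.1 h1)

theorem sumAssoc_bd (τ σ ρ : Graph) (f : (sum (sum τ σ) ρ).Flag) :
    Equiv.sumAssoc _ _ _ ((sum (sum τ σ) ρ).bd f) =
      (sum τ (sum σ ρ)).bd (Equiv.sumAssoc _ _ _ f) := by
  rcases f with (f | f) | f <;> rfl

theorem sumAssoc_inv (τ σ ρ : Graph) (f : (sum (sum τ σ) ρ).Flag) :
    Equiv.sumAssoc _ _ _ ((sum (sum τ σ) ρ).inv f) =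
      (sum τ (sum σ ρ)).inv (Equiv.sumAssoc _ _ _ f) := by
  rcases f with (f | f) | f <;> rfl

theorem emptySum_bd (τ : Graph) (f : (sum empty τ).Flag) :
    Equiv.emptySum Empty _ ((sum empty τ).bd f) = τ.bd (Equiv.emptySum Empty _ f) := by
  rcases f with f | f
  exacts [f.elim, rfl]

theorem emptySum_inv (τ : Graph) (f : (sum empty τ).Flag) :
    Equiv.emptySum Empty _ ((sum empty τ).inv f) = τ.inv (Equiv.emptySum Empty _ f) := by
  rcases f with f | f
  exacts [f.elim, rfl]

theorem sumEmpty_bd (τ : Graph) (f : (sum τ empty).Flag) :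
    Equiv.sumEmpty _ Empty ((sum τ empty).bd f) = τ.bd (Equiv.sumEmpty _ Empty f) := by
  rcases f with f | f
  exacts [rfl, f.elim]

theorem sumEmpty_inv (τ : Graph) (f : (sum τ empty).Flag) :
    Equiv.sumEmpty _ Empty ((sum τ empty).inv f) = τ.inv (Equiv.sumEmpty _ Empty f) := by
  rcases f with f | f
  exacts [rfl, f.elim]

theorem sumComm_bd (τ σ : Graph) (f : (sum τ σ).Flag) :
    Equiv.sumComm _ _ ((sum τ σ).bd f) = (sum σ τ).bd (Equiv.sumComm _ _ f) := by
  rcases f with f | f <;> rfl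

theorem sumComm_inv (τ σ : Graph) (f : (sum τ σ).Flag) :
    Equiv.sumComm _ _ ((sum τ σ).inv f) = (sum σ τ).inv (Equiv.sumComm _ _ f) := by
  rcases f with f | f <;> rfl

noncomputable instance : MonoidalCategoryStruct Graph where
  tensorObj := sum
  tensorHom := sumMap
  whiskerLeft τ _ _ h := sumMap (𝟙 τ) h
  whiskerRight h τ := sumMap h (𝟙 τ)
  tensorUnit := empty
  associator τ σ ρ := isoOfEquiv (Equiv.sumAssoc _ _ _) (Equiv.sumAssoc _ _ _)
    (sumAssoc_bd τ σ ρ) (sumAssoc_inv τ σ ρ)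
  leftUnitor τ := isoOfEquiv (Equiv.emptySum Empty _) (Equiv.emptySum Empty _)
    (emptySum_bd τ) (emptySum_inv τ)
  rightUnitor τ := isoOfEquiv (Equiv.sumEmpty _ Empty) (Equiv.sumEmpty _ Empty)
    (sumEmpty_bd τ) (sumEmpty_inv τ)

noncomputable instance : MonoidalCategory Graph :=
  MonoidalCategory.ofTensorHom
    (id_tensorHom_id := by
      intro τ σ
      refine hom_ext ?_ ?_ ?_ <;> rintro (f | f) <;> rfl)
    (id_tensorHom := fun _ _ _ _ => rfl)
    (tensorHom_id := fun _ _ => rfl)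
    (tensorHom_comp_tensorHom := fun h h' g g' => sumMap_comp h g h' g')
    (associator_naturality := by
      intro τ₁ τ₂ τ₃ σ₁ σ₂ σ₃ h₁ h₂ h₃
      refine hom_ext ?_ ?_ ?_
      · rintro (f | f | f) <;> rfl
      · rintro ((f | f) | f) <;> rfl
      · intro f
        refine (comp_homOfEquiv_pair _ _ (sumAssoc_bd _ _ _) (sumAssoc_inv _ _ _) _ _).trans
          (Eq.trans ?_ (homOfEquiv_comp_pair _ _ (sumAssoc_bd _ _ _) (sumAssoc_inv _ _ _) _ _).symm)
        rcases f with (f | f) | f <;> rfl)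
    (leftUnitor_naturality := by
      intro τ σ h
      refine hom_ext ?_ ?_ ?_
      · intro f; rfl
      · rintro (f | f); exacts [f.elim, rfl]
      · intro f
        refine (comp_homOfEquiv_pair _ _ (emptySum_bd _) (emptySum_inv _) _ _).trans
          (Eq.trans ?_ (homOfEquiv_comp_pair _ _ (emptySum_bd _) (emptySum_inv _) _ _).symm)
        rcases f with f | f; exacts [f.elim, rfl])
    (rightUnitor_naturality := by
      intro τ σ h
      refine hom_ext ?_ ?_ ?_
      · intro f; rfl
      · rintro (f | f); exacts [rfl, f.elim]
      · intro f
        refine (comp_homOfEquiv_pair _ _ (sumEmpty_bd _) (sumEmpty_inv _) _ _).trans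
          (Eq.trans ?_ (homOfEquiv_comp_pair _ _ (sumEmpty_bd _) (sumEmpty_inv _) _ _).symm)
        rcases f with f | f; exacts [rfl, f.elim])
    (pentagon := by
      intro τ₁ τ₂ τ₃ τ₄
      refine (hom_ext_of_surjective ?_ ?_ ?_).symm
      · rintro (((f | f) | f) | f)
        exacts [⟨Sum.inl f, rfl⟩, ⟨Sum.inr (Sum.inl f), rfl⟩,
          ⟨Sum.inr (Sum.inr (Sum.inl f)), rfl⟩, ⟨Sum.inr (Sum.inr (Sum.inr f)), rfl⟩]
      · rintro (f | f | f | f) <;> rfl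
      · rintro (((f | f) | f) | f) <;> rfl)
    (triangle := by
      intro τ₁ τ₂
      refine (hom_ext_of_surjective ?_ ?_ ?_).symm
      · rintro ((f | f) | f)
        exacts [⟨Sum.inl f, rfl⟩, f.elim, ⟨Sum.inr f, rfl⟩]
      · rintro (f | f) <;> rfl
      · rintro ((f | f) | f)
        exacts [rfl, f.elim, rfl])

noncomputable instance : SymmetricCategory Graph where
  braiding τ σ := isoOfEquiv (Equiv.sumComm _ _) (Equiv.sumComm _ _)
    (sumComm_bd τ σ) (sumComm_inv τ σ)
  braiding_naturality_right := by
    intro τ σ ρ h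
    refine hom_ext ?_ ?_ ?_
    · rintro (f | f) <;> rfl
    · rintro (f | f) <;> rfl
    · intro f
      refine (comp_homOfEquiv_pair _ _ (sumComm_bd _ _) (sumComm_inv _ _) _ _).trans
        (Eq.trans ?_ (homOfEquiv_comp_pair _ _ (sumComm_bd _ _) (sumComm_inv _ _) _ _).symm)
      rcases f with f | f <;> rfl
  braiding_naturality_left := by
    intro τ σ h ρ
    refine hom_ext ?_ ?_ ?_
    · rintro (f | f) <;> rfl
    · rintro (f | f) <;> rfl
    · intro f
      refine (comp_homOfEquiv_pair _ _ (sumComm_bd _ _) (sumComm_inv _ _) _ _).trans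
        (Eq.trans ?_ (homOfEquiv_comp_pair _ _ (sumComm_bd _ _) (sumComm_inv _ _) _ _).symm)
      rcases f with f | f <;> rfl
  hexagon_forward τ σ ρ := by
    refine hom_ext_of_surjective ?_ ?_ ?_
    · rintro ((f | f) | f)
      exacts [⟨Sum.inr (Sum.inr f), rfl⟩, ⟨Sum.inl f, rfl⟩, ⟨Sum.inr (Sum.inl f), rfl⟩]
    · rintro (f | f | f) <;> rfl
    · rintro ((f | f) | f) <;> rfl
  hexagon_reverse τ σ ρ := by
    refine hom_ext_of_surjective ?_ ?_ ?_
    · rintro (f | f | f)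
      exacts [⟨Sum.inl (Sum.inr f), rfl⟩, ⟨Sum.inr f, rfl⟩, ⟨Sum.inl (Sum.inl f), rfl⟩]
    · rintro ((f | f) | f) <;> rfl
    · rintro (f | f | f) <;> rfl
  symmetry τ σ := by
    refine hom_ext_of_surjective ?_ ?_ ?_
    · rintro (f | f)
      exacts [⟨Sum.inl f, rfl⟩, ⟨Sum.inr f, rfl⟩]
    · rintro (f | f) <;> rfl
    · rintro (f | f) <;> rfl

end Graph
/-! ### Categories of labelled graphs -/

section GraphCategories

variable {Γ : Type u} [Category.{v} Γ] (ψ : Γ ⥤ Graph)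

/-- The groupoid of `Γ`-corollas and isomorphisms between them. -/
abbrev Cor : Type u :=
  Core (ObjectProperty.FullSubcategory fun τ : Γ => (ψ.obj τ).IsCorolla)

/-- The inclusion of the groupoid of `Γ`-corollas. -/
abbrev corInclusion : Cor ψ ⥤ Γ :=
  Core.inclusion _ ⋙ ObjectProperty.ι _

/-- Graftings: bijective on flags and on vertices. -/
def IsGrafting {τ σ : Γ} (h : τ ⟶ σ) : Prop :=
  Function.Bijective (ψ.map h).flag ∧ Function.Bijective (ψ.map h).vertex

/-- The morphism `h` grafts no pair of tails into an edge: it is compatible with the involutions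
on the flags that are not contracted. -/
def GraftsNothing {τ σ : Γ} (h : τ ⟶ σ) : Prop :=
  ∀ f, (ψ.obj τ).inv ((ψ.map h).flag f) = (ψ.map h).flag ((ψ.obj σ).inv f)

/-- The morphism `h` contracts the whole graph `τ` to a corolla, bijectively on tails. -/
def IsContractionToCorolla {τ σ : Γ} (h : τ ⟶ σ) : Prop :=
  (ψ.obj σ).IsCorolla ∧ Set.range (ψ.map h).flag = {f | (ψ.obj τ).IsTail f}

variable [MonoidalCategory Γ] [SymmetricCategory Γ]

/-- The disjoint union of a finite family of objects. -/
noncomputable abbrev disjUnion {ι : Type} [Fintype ι] (X : ι → Γ) : Γ :=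
  FinFam.tensor.obj ⟨ι, X⟩

/-- The disjoint union of a finite family of morphisms. -/
noncomputable abbrev disjUnionMap {ι : Type} [Fintype ι] {X Y : ι → Γ} (f : ∀ i, X i ⟶ Y i) :
    disjUnion X ⟶ disjUnion Y :=
  FinFam.tensor.map (FinFam.homMk f)

/-- The disjoint union of a finite family of `Γ`-corollas. -/
noncomputable def corUnion : FinFam (Cor ψ) ⥤ Γ :=
  FinFam.mapFunctor (corInclusion ψ) ⋙ FinFam.tensor

/-- A total grafting with target `τ`: a grafting whose source is a disjoint union of
`Γ`-corollas. Its index set is identified with the set of vertices of `τ`. -/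
structure TotalGrafting (τ : Γ) where
  /-- the corollas `τ_v` -/
  cor : FinFam (Cor ψ)
  /-- the morphism `∐ τ_v ⟶ τ` -/
  map : (corUnion ψ).obj cor ⟶ τ
  isGrafting : IsGrafting ψ map

/-- An atomization of `h : τ ⟶ σ`, relative to a total grafting `∐ σ_v ⟶ σ`: objects `τ_v`,
morphisms `h_v : τ_v ⟶ σ_v` and a grafting `k : ∐ τ_v ⟶ τ` with `k ≫ h = (∐ h_v) ≫ ∘_σ`, such that
the edges of `τ` contracted by `h` are not cut in `∐ τ_v`. -/
structure IsAtomization {τ σ : Γ} (h : τ ⟶ σ) (d : TotalGrafting ψ σ) (X : d.cor.ι → Γ)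
    (hX : ∀ i, X i ⟶ (corInclusion ψ).obj (d.cor.obj i)) (k : disjUnion X ⟶ τ) : Prop where
  isGrafting : IsGrafting ψ k
  comm : k ≫ h = disjUnionMap hX ≫ d.map
  inv_contracted : ∀ f, f ∉ Set.range (ψ.map h).flag →
    (ψ.map k).flag ((ψ.obj τ).inv f) = (ψ.obj (disjUnion X)).inv ((ψ.map k).flag f)

/-- An abstract category of labelled graphs: a symmetric monoidal category `Γ` with a faithful
symmetric monoidal functor `ψ` to the category of graphs with disjoint union, such that
contractions of connected objects to corollas, total graftings, and atomizations exist
uniquely up to unique isomorphism, and such that `Γ` is hereditary. -/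
class GraphCategory [ψ.Braided] : Prop where
  faithful : ψ.Faithful
  exists_contraction : ∀ τ : Γ, (ψ.obj τ).IsConnected →
    ∃ (σ : Γ) (h : τ ⟶ σ), IsContractionToCorolla ψ h
  contraction_unique : ∀ {τ σ σ' : Γ} (h : τ ⟶ σ) (h' : τ ⟶ σ'), (ψ.obj τ).IsConnected →
    IsContractionToCorolla ψ h → IsContractionToCorolla ψ h' → ∃! e : σ ≅ σ', h ≫ e.hom = h'
  exists_totalGrafting : ∀ τ : Γ, Nonempty (TotalGrafting ψ τ)
  totalGrafting_unique : ∀ {τ : Γ} (d d' : TotalGrafting ψ τ),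
    ∃! e : d.cor ⟶ d'.cor, (corUnion ψ).map e ≫ d'.map = d.map
  exists_atomization : ∀ {τ σ : Γ} (h : τ ⟶ σ) (d : TotalGrafting ψ σ),
    ∃ X hX k, IsAtomization ψ h d X hX k
  atomization_unique : ∀ {τ σ : Γ} (h : τ ⟶ σ) (d : TotalGrafting ψ σ) {X X' hX hX' k k'},
    IsAtomization ψ h d X hX k → IsAtomization ψ h d X' hX' k' →
      ∃! e : ∀ i, X i ≅ X' i,
        (∀ i, (e i).hom ≫ hX' i = hX i) ∧ disjUnionMap (fun i => (e i).hom) ≫ k' = k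
  exists_heredity : ∀ {σ : Γ} (d : TotalGrafting ψ σ) (X : d.cor.ι → Γ)
    (hX : ∀ i, X i ⟶ (corInclusion ψ).obj (d.cor.obj i)),
    ∃ (τ : Γ) (h : τ ⟶ σ) (k : disjUnion X ⟶ τ), IsAtomization ψ h d X hX k ∧ GraftsNothing ψ h
  heredity_unique : ∀ {σ : Γ} (d : TotalGrafting ψ σ) (X : d.cor.ι → Γ)
    (hX : ∀ i, X i ⟶ (corInclusion ψ).obj (d.cor.obj i)) {τ τ' : Γ} {h : τ ⟶ σ} {h' : τ' ⟶ σ}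
    {k : disjUnion X ⟶ τ} {k' : disjUnion X ⟶ τ'},
    IsAtomization ψ h d X hX k → GraftsNothing ψ h →
    IsAtomization ψ h' d X hX k' → GraftsNothing ψ h' →
      ∃! e : τ ≅ τ', e.hom ≫ h' = h ∧ k ≫ e.hom = k'

section Dec

variable [ψ.Braided] [GraphCategory ψ]

/-- A choice of a total grafting `∐ τ_v ⟶ τ` for every `τ`. -/
noncomputable def totalGrafting (τ : Γ) : TotalGrafting ψ τ :=
  (GraphCategory.exists_totalGrafting τ).some

/-- The total grafting of `τ`, transported along an isomorphism. -/
noncomputable def TotalGrafting.transport {τ σ : Γ} (d : TotalGrafting ψ τ) (a : τ ≅ σ) :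
    TotalGrafting ψ σ where
  cor := d.cor
  map := d.map ≫ a.hom
  isGrafting := by
    have h1 : IsIso (ψ.map a.hom) := inferInstance
    have key : ∀ {x y : Graph} (b : x ≅ y), Function.Bijective b.hom.flag ∧
        Function.Bijective b.hom.vertex := by
      intro x y b
      refine ⟨⟨b.hom.flag_injective, fun f => ⟨b.inv.flag f, ?_⟩⟩, ⟨?_, b.hom.vertex_surjective⟩⟩
      · rw [← Graph.comp_flag, b.hom_inv_id]; rfl
      · refine Function.LeftInverse.injective (g := b.inv.vertex) fun w => ?_
        rw [← Graph.comp_vertex, b.hom_inv_id]; rfl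
    obtain ⟨h2, h3⟩ := key (ψ.mapIso a)
    obtain ⟨h4, h5⟩ := d.isGrafting
    rw [IsGrafting, ψ.map_comp]
    exact ⟨h4.comp h2, h3.comp h5⟩

theorem exists_corFamilyMap {τ σ : Γ} (a : τ ≅ σ) :
    ∃! e : (totalGrafting ψ τ).cor ⟶ (totalGrafting ψ σ).cor,
      (corUnion ψ).map e ≫ (totalGrafting ψ σ).map = (totalGrafting ψ τ).map ≫ a.hom :=
  GraphCategory.totalGrafting_unique ((totalGrafting ψ τ).transport ψ a) (totalGrafting ψ σ)

/-- The isomorphism of families of corollas induced by an isomorphism `τ ≅ σ`. -/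
noncomputable def corFamilyMap {τ σ : Γ} (a : τ ≅ σ) :
    (totalGrafting ψ τ).cor ⟶ (totalGrafting ψ σ).cor :=
  (exists_corFamilyMap ψ a).choose

theorem corFamilyMap_spec {τ σ : Γ} (a : τ ≅ σ) :
    (corUnion ψ).map (corFamilyMap ψ a) ≫ (totalGrafting ψ σ).map =
      (totalGrafting ψ τ).map ≫ a.hom :=
  (exists_corFamilyMap ψ a).choose_spec.1

theorem corFamilyMap_unique {τ σ : Γ} (a : τ ≅ σ)
    {e : (totalGrafting ψ τ).cor ⟶ (totalGrafting ψ σ).cor}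
    (he : (corUnion ψ).map e ≫ (totalGrafting ψ σ).map = (totalGrafting ψ τ).map ≫ a.hom) :
    e = corFamilyMap ψ a :=
  (exists_corFamilyMap ψ a).choose_spec.2 _ he

/-- The family `(τ_v)` of the corollas of the vertices of `τ`, functorially in isomorphisms. -/
noncomputable def corFamily : Core Γ ⥤ FinFam (Cor ψ) where
  obj τ := (totalGrafting ψ τ.of).cor
  map a := corFamilyMap ψ a.iso
  map_id τ := (corFamilyMap_unique ψ _ (by simp)).symm
  map_comp a b := (corFamilyMap_unique ψ _ (by
    simp only [Functor.map_comp, Category.assoc, coreCategory_comp_iso, Iso.trans_hom]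
    rw [corFamilyMap_spec, reassoc_of% (corFamilyMap_spec ψ a.iso)])).symm

end Dec

end GraphCategories
/-! ### Collections and operads -/

section Paste

variable {G : Type u'} [Category.{v'} G]

theorem paste_two {X₁ X₂ X₃ Y₁ Y₂ Y₃ : G} {a₁ : X₁ ⟶ X₂} {a₂ : X₂ ⟶ X₃} {b₁ : Y₁ ⟶ Y₂}
    {b₂ : Y₂ ⟶ Y₃} {u₁ : X₁ ⟶ Y₁} {u₂ : X₂ ⟶ Y₂} {u₃ : X₃ ⟶ Y₃} (h₁ : u₁ ≫ b₁ = a₁ ≫ u₂)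
    (h₂ : u₂ ≫ b₂ = a₂ ≫ u₃) : u₁ ≫ b₁ ≫ b₂ = (a₁ ≫ a₂) ≫ u₃ := by
  rw [reassoc_of% h₁, h₂, Category.assoc]

theorem paste_three {X₁ X₂ X₃ X₄ Y₁ Y₂ Y₃ Y₄ : G} {a₁ : X₁ ⟶ X₂} {a₂ : X₂ ⟶ X₃} {a₃ : X₃ ⟶ X₄}
    {b₁ : Y₁ ⟶ Y₂} {b₂ : Y₂ ⟶ Y₃} {b₃ : Y₃ ⟶ Y₄} {u₁ : X₁ ⟶ Y₁} {u₂ : X₂ ⟶ Y₂} {u₃ : X₃ ⟶ Y₃}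
    {u₄ : X₄ ⟶ Y₄} (h₁ : u₁ ≫ b₁ = a₁ ≫ u₂) (h₂ : u₂ ≫ b₂ = a₂ ≫ u₃)
    (h₃ : u₃ ≫ b₃ = a₃ ≫ u₄) : u₁ ≫ b₁ ≫ b₂ ≫ b₃ = (a₁ ≫ a₂ ≫ a₃) ≫ u₄ :=
  paste_two h₁ (paste_two h₂ h₃)

end Paste

section Operads

variable {Γ : Type u} [Category.{v} Γ] [MonoidalCategory Γ] [SymmetricCategory Γ]
  (ψ : Γ ⥤ Graph) (G : Type u') [Category.{v'} G] [MonoidalCategory G] [SymmetricCategory G]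

/-- Collections: functors on the groupoid of `Γ`-corollas. The monoidal structure of this category
is the pointwise one (the white product of collections). -/
abbrev Collection : Type _ := Cor ψ ⥤ G

/-- An operad: a tensor functor on `Γ` (strong monoidal and compatible with the
symmetries) that sends graftings to isomorphisms. -/
structure Operad where
  /-- the underlying functor -/
  functor : Γ ⥤ G
  /-- the structure of a tensor functor -/
  [braided : functor.Braided]
  isIso_map : ∀ {τ σ : Γ} (h : τ ⟶ σ), IsGrafting ψ h → IsIso (functor.map h)

attribute [instance] Operad.braided

namespace Operad

variable {ψ G}

/-- A morphism of operads: a monoidal natural transformation. -/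
@[ext]
structure Hom (A B : Operad ψ G) where
  /-- the natural transformation -/
  natTrans : A.functor ⟶ B.functor
  isMonoidal : NatTrans.IsMonoidal natTrans

instance : Category (Operad ψ G) where
  Hom := Hom
  id A := ⟨𝟙 A.functor, inferInstance⟩
  comp f g := ⟨f.natTrans ≫ g.natTrans, by
    have := f.isMonoidal
    have := g.isMonoidal
    infer_instance⟩

theorem hom_ext {A B : Operad ψ G} {f g : A ⟶ B} (h : f.natTrans = g.natTrans) : f = g :=
  Hom.ext h

variable (ψ G) in
/-- The underlying collection of an operad. -/
def coll : Operad ψ G ⥤ Collection ψ G where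
  obj A := corInclusion ψ ⋙ A.functor
  map f := Functor.whiskerLeft (corInclusion ψ) f.natTrans

/-- The tensor functor structure on the pointwise tensor product of two tensor functors. -/
instance tensorFunctorMonoidal (A B : Operad ψ G) : (A.functor ⊗ B.functor).Monoidal :=
  inferInstanceAs (A.functor.prod' B.functor ⋙ MonoidalCategory.tensor G).Monoidal

theorem tensorFunctor_μ (A B : Operad ψ G) (X Y : Γ) :
    Functor.LaxMonoidal.μ (A.functor ⊗ B.functor) X Y =
      tensorμ (A.functor.obj X) (B.functor.obj X) (A.functor.obj Y) (B.functor.obj Y) ≫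
        (Functor.LaxMonoidal.μ A.functor X Y ⊗ₘ Functor.LaxMonoidal.μ B.functor X Y) := by
  refine (Functor.LaxMonoidal.comp_μ (A.functor.prod' B.functor) (MonoidalCategory.tensor G)
    X Y).trans ?_
  simp

theorem tensorFunctor_ε (A B : Operad ψ G) :
    Functor.LaxMonoidal.ε (A.functor ⊗ B.functor) =
      (λ_ (𝟙_ G)).inv ≫ (Functor.LaxMonoidal.ε A.functor ⊗ₘ Functor.LaxMonoidal.ε B.functor) := by
  refine (Functor.LaxMonoidal.comp_ε (A.functor.prod' B.functor)
    (MonoidalCategory.tensor G)).trans ?_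
  simp

theorem tensorμ_braiding (X₁ X₂ Y₁ Y₂ : G) :
    tensorμ X₁ X₂ Y₁ Y₂ ≫ ((β_ X₁ Y₁).hom ⊗ₘ (β_ X₂ Y₂).hom) =
      (β_ (X₁ ⊗ X₂) (Y₁ ⊗ Y₂)).hom ≫ tensorμ Y₁ Y₂ X₁ X₂ := by
  simp only [tensorμ, BraidedCategory.braiding_tensor_left_hom,
    BraidedCategory.braiding_tensor_right_hom, MonoidalCategory.tensorHom_def]
  have h : (β_ X₁ Y₂).hom ▷ X₂ ≫ (β_ Y₂ X₁).hom ▷ X₂ = 𝟙 _ := by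
    rw [← comp_whiskerRight, SymmetricCategory.symmetry, id_whiskerRight]
  calc _ = 𝟙 _ ⊗≫ X₁ ◁ (β_ X₂ Y₁).hom ▷ Y₂ ⊗≫ (((β_ X₁ Y₁).hom ▷ (X₂ ⊗ Y₂)) ≫
            ((Y₁ ⊗ X₁) ◁ (β_ X₂ Y₂).hom)) ⊗≫ Y₁ ◁ 𝟙 ((X₁ ⊗ Y₂) ⊗ X₂) ⊗≫ 𝟙 _ := by
        monoidal
    _ = 𝟙 _ ⊗≫ X₁ ◁ (β_ X₂ Y₁).hom ▷ Y₂ ⊗≫ (((β_ X₁ Y₁).hom ▷ (X₂ ⊗ Y₂)) ≫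
            ((Y₁ ⊗ X₁) ◁ (β_ X₂ Y₂).hom)) ⊗≫ Y₁ ◁ ((β_ X₁ Y₂).hom ▷ X₂ ≫ (β_ Y₂ X₁).hom ▷ X₂) ⊗≫ 𝟙 _ := by
        rw [h]
    _ = _ := by monoidal

instance tensorFunctorBraided (A B : Operad ψ G) : (A.functor ⊗ B.functor).Braided where
  braided X Y := by
    rw [tensorFunctor_μ, tensorFunctor_μ]
    have h := tensorμ_braiding (A.functor.obj X) (B.functor.obj X) (A.functor.obj Y)
      (B.functor.obj Y)
    change (_ ≫ _) ≫ (A.functor.map (β_ X Y).hom ⊗ₘ B.functor.map (β_ X Y).hom) =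
      (β_ (A.functor.obj X ⊗ B.functor.obj X) (A.functor.obj Y ⊗ B.functor.obj Y)).hom ≫ _
    rw [← reassoc_of% h, Category.assoc, tensorHom_comp_tensorHom, tensorHom_comp_tensorHom,
      Functor.LaxBraided.braided, Functor.LaxBraided.braided]

theorem whiskerRight_isMonoidal {A A' : Operad ψ G} (f : A ⟶ A') (B : Operad ψ G) :
    NatTrans.IsMonoidal (f.natTrans ▷ B.functor) := by
  have := f.isMonoidal
  refine ⟨?_, fun X Y => ?_⟩
  · rw [tensorFunctor_ε, tensorFunctor_ε]
    change (_ ≫ _) ≫ (f.natTrans.app _ ▷ B.functor.obj _) = _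
    rw [Category.assoc, ← tensorHom_id, tensorHom_comp_tensorHom, Category.comp_id,
      NatTrans.IsMonoidal.unit]
  · rw [tensorFunctor_μ, tensorFunctor_μ]
    change (_ ≫ _) ≫ (f.natTrans.app _ ▷ B.functor.obj _) =
      ((f.natTrans.app X ▷ B.functor.obj X) ⊗ₘ (f.natTrans.app Y ▷ B.functor.obj Y)) ≫ _
    rw [Category.assoc, ← tensorHom_id, tensorHom_comp_tensorHom, Category.comp_id,
      NatTrans.IsMonoidal.tensor, ← tensorHom_id, ← tensorHom_id, tensorμ_natural_assoc,
      tensorHom_comp_tensorHom]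
    simp

/-- The white product of operads: the pointwise tensor product. -/
def white (A B : Operad ψ G) : Operad ψ G where
  functor := A.functor ⊗ B.functor
  isIso_map h hh := by
    have := A.isIso_map h hh
    have := B.isIso_map h hh
    exact inferInstanceAs (IsIso (A.functor.map h ⊗ₘ B.functor.map h))

/-- The white product of a morphism of operads with an identity morphism. -/
def whiteMap {A A' : Operad ψ G} (f : A ⟶ A') (B : Operad ψ G) : white A B ⟶ white A' B where
  natTrans := f.natTrans ▷ B.functor
  isMonoidal := whiskerRight_isMonoidal f B

theorem whiteMap_id (A B : Operad ψ G) : whiteMap (𝟙 A) B = 𝟙 (white A B) :=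
  hom_ext (id_whiskerRight A.functor B.functor)

theorem whiteMap_comp {A A' A'' : Operad ψ G} (f : A ⟶ A') (g : A' ⟶ A'')
    (B : Operad ψ G) : whiteMap (f ≫ g) B = whiteMap f B ≫ whiteMap g B :=
  hom_ext (comp_whiskerRight f.natTrans g.natTrans B.functor)

/-- The collection underlying a white product of operads is the white product of the underlying
collections. -/
def collWhite (A B : Operad ψ G) :
    (coll ψ G).obj (white A B) ≅ (coll ψ G).obj A ⊗ (coll ψ G).obj B :=
  Iso.refl _

end Operad

/-! ### The collection `𝓕(A₁)` and presentations of operads -/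

/-- For every `Γ`-corolla `σ`, colimits over the category `⇒σ` of objects over `σ` and their
isomorphisms exist in `G`, and the tensor product is distributive with respect to them. -/
class HasGraphColimits : Prop where
  hasColimits : ∀ σ : Cor ψ, HasColimitsOfShape (Core (Over ((corInclusion ψ).obj σ))) G
  preserves_left : ∀ (σ : Cor ψ) (X : G),
    PreservesColimitsOfShape (Core (Over ((corInclusion ψ).obj σ))) (tensorLeft X)
  preserves_right : ∀ (σ : Cor ψ) (X : G),
    PreservesColimitsOfShape (Core (Over ((corInclusion ψ).obj σ))) (tensorRight X)

attribute [instance] HasGraphColimits.hasColimits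

variable {ψ G}
variable [ψ.Braided] [GraphCategory ψ]

/-- The functor `τ ↦ ⨂_v A₁(τ_v)` on objects of `Γ` and isomorphisms, where `v` runs over the
vertices of `τ`. -/
noncomputable def vertexTensor (A₁ : Collection ψ G) : Core Γ ⥤ G :=
  corFamily ψ ⋙ FinFam.mapFunctor A₁ ⋙ FinFam.tensor

/-- The diagram `(τ ⟶ σ) ↦ ⨂_v A₁(τ_v)` on the category `⇒σ`. -/
noncomputable abbrev overDiagram (A₁ : Collection ψ G) (σ : Γ) : Core (Over σ) ⥤ G :=
  (Over.forget σ).core ⋙ vertexTensor A₁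

/-- The functor `⇒σ ⥤ ⇒σ'` of composition with a morphism `σ ⟶ σ'`. -/
noncomputable abbrev overMap {σ σ' : Γ} (f : σ ⟶ σ') : Core (Over σ) ⥤ Core (Over σ') :=
  (Over.map f).core

section Free

variable [HasGraphColimits ψ G]

/-- The morphism `⨂_v A₁(τ_v) ⟶ 𝓕(A₁)(σ)` corresponding to `h : τ ⟶ σ`. -/
noncomputable def overDiagramι (A₁ : Collection ψ G) (σ : Cor ψ) {τ : Γ}
    (h : τ ⟶ (corInclusion ψ).obj σ) :
    (vertexTensor A₁).obj ⟨τ⟩ ⟶ colimit (overDiagram A₁ ((corInclusion ψ).obj σ)) :=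
  colimit.ι (overDiagram A₁ ((corInclusion ψ).obj σ)) ⟨Over.mk h⟩

/-- The cocone defining the action of a morphism `σ ⟶ σ'` on `𝓕(A₁)`. -/
noncomputable def freeCocone (A₁ : Collection ψ G) {σ σ' : Cor ψ} (f : σ ⟶ σ') :
    Cocone (overDiagram A₁ ((corInclusion ψ).obj σ)) where
  pt := colimit (overDiagram A₁ ((corInclusion ψ).obj σ'))
  ι :=
    { app := fun X => overDiagramι A₁ σ' (X.of.hom ≫ (corInclusion ψ).map f)
      naturality := fun _ _ g =>
        (colimit.w (overDiagram A₁ ((corInclusion ψ).obj σ'))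
          ((overMap ((corInclusion ψ).map f)).map g)).trans (Category.comp_id _).symm }

theorem overDiagramι_freeCocone_desc (A₁ : Collection ψ G) {σ σ' : Cor ψ} (f : σ ⟶ σ') {τ : Γ}
    (h : τ ⟶ (corInclusion ψ).obj σ) :
    overDiagramι A₁ σ h ≫ colimit.desc _ (freeCocone A₁ f) =
      overDiagramι A₁ σ' (h ≫ (corInclusion ψ).map f) :=
  colimit.ι_desc (freeCocone A₁ f) ⟨Over.mk h⟩

/-- The collection `𝓕(A₁)(σ) = colim_{τ ⟶ σ} ⨂_v A₁(τ_v)`. -/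
noncomputable def freeCollection (A₁ : Collection ψ G) : Collection ψ G where
  obj σ := colimit (overDiagram A₁ ((corInclusion ψ).obj σ))
  map f := colimit.desc _ (freeCocone A₁ f)
  map_id σ := by
    refine colimit.hom_ext fun X => ?_
    refine (overDiagramι_freeCocone_desc A₁ (𝟙 σ) X.of.hom).trans ?_
    rw [CategoryTheory.Functor.map_id]
    exact (congrArg (overDiagramι A₁ σ) (Category.comp_id _)).trans (Category.comp_id _).symm
  map_comp {σ σ' σ''} f g := by
    refine colimit.hom_ext fun X => ?_
    refine (overDiagramι_freeCocone_desc A₁ (f ≫ g) X.of.hom).trans ?_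
    refine Eq.trans ?_ (Category.assoc _ _ _)
    refine Eq.trans ?_ (congrArg (· ≫ colimit.desc _ (freeCocone A₁ g))
      (overDiagramι_freeCocone_desc A₁ f X.of.hom).symm)
    refine Eq.trans ?_ (overDiagramι_freeCocone_desc A₁ g _).symm
    rw [CategoryTheory.Functor.map_comp, Category.assoc]

/-- For an operad `A` and a morphism of collections `i : A₁ ⟶ A`, the morphisms
`⨂_v A₁(τ_v) ⟶ ⨂_v A(τ_v) ⟶ A(∐_v τ_v) ⟶ A(τ)`. -/
noncomputable def vertexTensorHom {A₁ : Collection ψ G} {A : Operad ψ G}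
    (i : A₁ ⟶ (Operad.coll ψ G).obj A) : vertexTensor A₁ ⟶ Core.inclusion Γ ⋙ A.functor where
  app τ := FinFam.tensor.map (FinFam.homMk fun v => i.app ((totalGrafting ψ τ.of).cor.obj v)) ≫
    (FinFam.comparison A.functor).app
      ((FinFam.mapFunctor (corInclusion ψ)).obj (totalGrafting ψ τ.of).cor) ≫
    A.functor.map (totalGrafting ψ τ.of).map
  naturality τ σ a := by
    have h1 : FinFam.tensor.map ((FinFam.mapFunctor A₁).map (corFamilyMap ψ a.iso)) ≫
        FinFam.tensor.map
          (FinFam.homMk fun v => i.app ((totalGrafting ψ σ.of).cor.obj v)) =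
        FinFam.tensor.map (FinFam.homMk fun v => i.app ((totalGrafting ψ τ.of).cor.obj v)) ≫
        FinFam.tensor.map ((FinFam.mapFunctor A.functor).map
          ((FinFam.mapFunctor (corInclusion ψ)).map (corFamilyMap ψ a.iso))) := by
      refine (FinFam.tensor.map_comp _ _).symm.trans (Eq.trans (congrArg FinFam.tensor.map ?_)
        (FinFam.tensor.map_comp _ _))
      refine FinFam.Hom.ext rfl (heq_of_eq (funext fun v => ?_))
      exact i.naturality ((corFamilyMap ψ a.iso).app v)
    have h2 := (FinFam.comparison A.functor).naturality
      ((FinFam.mapFunctor (corInclusion ψ)).map (corFamilyMap ψ a.iso))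
    have h3 := congrArg A.functor.map (corFamilyMap_spec ψ a.iso)
    rw [CategoryTheory.Functor.map_comp, CategoryTheory.Functor.map_comp] at h3
    exact paste_three h1 h2 h3

/-- The cocone defining the morphism `f_A`. -/
noncomputable def freeDescCocone {A₁ : Collection ψ G} {A : Operad ψ G}
    (i : A₁ ⟶ (Operad.coll ψ G).obj A) (σ : Cor ψ) :
    Cocone (overDiagram A₁ ((corInclusion ψ).obj σ)) where
  pt := A.functor.obj ((corInclusion ψ).obj σ)
  ι :=
    { app := fun X => (vertexTensorHom i).app ⟨X.of.left⟩ ≫ A.functor.map X.of.hom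
      naturality := fun X Y g => by
        have h1 := (vertexTensorHom i).naturality ((Over.forget _).core.map g)
        have h2 : g.iso.hom.left ≫ Y.of.hom = X.of.hom := Over.w g.iso.hom
        have h3 : A.functor.map g.iso.hom.left ≫ A.functor.map Y.of.hom =
          A.functor.map X.of.hom ≫ 𝟙 _ := by
          rw [← h2, CategoryTheory.Functor.map_comp, Category.comp_id]
        exact paste_two h1 h3 }

theorem overDiagramι_freeDescCocone_desc {A₁ : Collection ψ G} {A : Operad ψ G}
    (i : A₁ ⟶ (Operad.coll ψ G).obj A) (σ : Cor ψ) {τ : Γ} (h : τ ⟶ (corInclusion ψ).obj σ) :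
    overDiagramι A₁ σ h ≫ colimit.desc _ (freeDescCocone i σ) =
      (vertexTensorHom i).app ⟨τ⟩ ≫ A.functor.map h :=
  colimit.ι_desc (freeDescCocone i σ) ⟨Over.mk h⟩

/-- The morphism `f_A : 𝓕(A₁) ⟶ A` extending a morphism of collections `i : A₁ ⟶ A`. -/
noncomputable def freeCollectionDesc {A₁ : Collection ψ G} {A : Operad ψ G}
    (i : A₁ ⟶ (Operad.coll ψ G).obj A) : freeCollection A₁ ⟶ (Operad.coll ψ G).obj A where
  app σ := colimit.desc _ (freeDescCocone i σ)
  naturality σ σ' f := by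
    refine colimit.hom_ext fun X => ?_
    refine (Category.assoc _ _ _).symm.trans ?_
    refine (congrArg (· ≫ colimit.desc _ (freeDescCocone i σ'))
      (overDiagramι_freeCocone_desc A₁ f X.of.hom)).trans ?_
    refine (overDiagramι_freeDescCocone_desc i σ' _).trans ?_
    refine Eq.trans ?_ (Category.assoc _ _ _)
    refine Eq.trans ?_ (congrArg (· ≫ A.functor.map ((corInclusion ψ).map f))
      (overDiagramι_freeDescCocone_desc i σ X.of.hom).symm)
    exact (congrArg ((vertexTensorHom i).app ⟨X.of.left⟩ ≫ ·)
      (A.functor.map_comp X.of.hom ((corInclusion ψ).map f))).trans (Category.assoc _ _ _).symm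

/-- A morphism of collections `i : A₁ ⟶ A` is a presentation of the operad `A` if the
morphism `f_A : 𝓕(A₁) ⟶ A` is surjective. -/
def IsPresentation {A₁ : Collection ψ G} {A : Operad ψ G} (i : A₁ ⟶ (Operad.coll ψ G).obj A) :
    Prop :=
  ∀ σ, Epi ((freeCollectionDesc i).app σ)

variable (ψ G) in
/-- An operad together with a presentation. -/
structure OP where
  /-- the operad -/
  operad : Operad ψ G
  /-- the collection of generators -/
  gen : Collection ψ G
  /-- the morphism from the generators to the operad -/
  i : gen ⟶ (Operad.coll ψ G).obj operad
  isPresentation : IsPresentation i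

namespace OP

/-- A morphism of operads with presentation. -/
@[ext]
structure Hom (𝒜 ℬ : OP ψ G) where
  /-- the morphism of generators -/
  genHom : 𝒜.gen ⟶ ℬ.gen
  /-- the morphism of operads -/
  operadHom : 𝒜.operad ⟶ ℬ.operad
  comm : 𝒜.i ≫ (Operad.coll ψ G).map operadHom = genHom ≫ ℬ.i

instance : Category (OP ψ G) where
  Hom := Hom
  id 𝒜 := ⟨𝟙 _, 𝟙 _, by
    rw [CategoryTheory.Functor.map_id, Category.comp_id, Category.id_comp]⟩
  comp f g := ⟨f.genHom ≫ g.genHom, f.operadHom ≫ g.operadHom, by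
    rw [CategoryTheory.Functor.map_comp, reassoc_of% f.comm, g.comm, Category.assoc]⟩
  id_comp f := Hom.ext (Category.id_comp _) (Category.id_comp _)
  comp_id f := Hom.ext (Category.comp_id _) (Category.comp_id _)
  assoc f g h := Hom.ext (Category.assoc _ _ _) (Category.assoc _ _ _)

end OP

/-! ### The category `𝒜 ⇒ ℬ` -/

/-- An object `(F, u, u₁)` of the category `𝒜 ⇒ ℬ`. -/
structure Diag (𝒜 ℬ : OP ψ G) where
  /-- the operad `F` -/
  F : Operad ψ G
  /-- the morphism of operads -/
  u : 𝒜.operad ⟶ Operad.white F ℬ.operad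
  /-- the morphism of collections -/
  u₁ : 𝒜.gen ⟶ (Operad.coll ψ G).obj F ⊗ ℬ.gen
  comm : 𝒜.i ≫ (Operad.coll ψ G).map u ≫ (Operad.collWhite F ℬ.operad).hom =
    u₁ ≫ ((Operad.coll ψ G).obj F ◁ ℬ.i)

namespace Diag

variable {𝒜 ℬ : OP ψ G}

/-- A morphism of `𝒜 ⇒ ℬ`: a morphism of operads `F ⟶ F'` inducing a morphism of diagrams. -/
@[ext]
structure Hom (X Y : Diag 𝒜 ℬ) where
  /-- the morphism of operads -/
  v : X.F ⟶ Y.F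
  comm : X.u ≫ Operad.whiteMap v ℬ.operad = Y.u
  comm₁ : X.u₁ ≫ ((Operad.coll ψ G).map v ▷ ℬ.gen) = Y.u₁

instance : Category (Diag 𝒜 ℬ) where
  Hom := Hom
  id X := ⟨𝟙 _, by rw [Operad.whiteMap_id, Category.comp_id], by
    rw [CategoryTheory.Functor.map_id, id_whiskerRight, Category.comp_id]⟩
  comp f g := ⟨f.v ≫ g.v, by
    rw [Operad.whiteMap_comp, reassoc_of% f.comm, g.comm], by
    rw [CategoryTheory.Functor.map_comp, comp_whiskerRight, reassoc_of% f.comm₁, g.comm₁]⟩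
  id_comp f := Hom.ext (Category.id_comp _)
  comp_id f := Hom.ext (Category.comp_id _)
  assoc f g h := Hom.ext (Category.assoc _ _ _)

end Diag

/-! ### The product `⊙` of operads with presentation -/

/-- The product `𝓕 ⊙ ℬ`: the smallest suboperad of `F ○ B` containing the image of
`i_F ○ i_B : F₁ ○ B₁ ⟶ F ○ B`, presented by the generators `F₁ ○ B₁`. -/
structure BlackProduct (𝓕 ℬ : OP ψ G) where
  /-- the suboperad `C` -/
  operad : Operad ψ G
  /-- the inclusion of `C` into `F ○ B` -/
  incl : operad ⟶ Operad.white 𝓕.operad ℬ.operad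
  mono : ∀ τ : Γ, Mono (incl.natTrans.app τ)
  /-- the corestriction of `i_F ○ i_B` to `C` -/
  i : 𝓕.gen ⊗ ℬ.gen ⟶ (Operad.coll ψ G).obj operad
  fac : i ≫ (Operad.coll ψ G).map incl ≫ (Operad.collWhite 𝓕.operad ℬ.operad).hom = 𝓕.i ⊗ₘ ℬ.i
  minimal : ∀ (D : Operad ψ G) (m : D ⟶ Operad.white 𝓕.operad ℬ.operad)
    (j : 𝓕.gen ⊗ ℬ.gen ⟶ (Operad.coll ψ G).obj D), (∀ τ : Γ, Mono (m.natTrans.app τ)) →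
    j ≫ (Operad.coll ψ G).map m ≫ (Operad.collWhite 𝓕.operad ℬ.operad).hom = 𝓕.i ⊗ₘ ℬ.i →
      ∃ n : operad ⟶ D, n ≫ m = incl
  isPresentation : IsPresentation i

namespace BlackProduct

/-- The product as an operad with presentation. -/
def toOP {𝓕 ℬ : OP ψ G} (P : BlackProduct 𝓕 ℬ) : OP ψ G where
  operad := P.operad
  gen := 𝓕.gen ⊗ ℬ.gen
  i := P.i
  isPresentation := P.isPresentation

/-- The morphism `k : 𝓕 ⊙ ℬ ⟶ 𝓕' ⊙ ℬ` is the product of `g : 𝓕 ⟶ 𝓕'` with the identity. -/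
def IsMap {𝓕 𝓕' ℬ : OP ψ G} (P : BlackProduct 𝓕 ℬ) (P' : BlackProduct 𝓕' ℬ) (g : 𝓕 ⟶ 𝓕')
    (k : P.toOP ⟶ P'.toOP) : Prop :=
  k.genHom = g.genHom ▷ ℬ.gen ∧ k.operadHom ≫ P'.incl = P.incl ≫ Operad.whiteMap g.operadHom ℬ.operad

end BlackProduct

/-- The morphism `coev : 𝒜 ⟶ 𝓔 ⊙ ℬ` makes `𝓔` an inner cohomomorphism object of `𝒜` and `ℬ` in
the category of operads with presentation: `- ⊙ ℬ` is functorial, and composition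
`g ↦ coev ≫ (g ⊙ ℬ)` is a bijection from the morphisms `𝓔 ⟶ 𝓕` to the morphisms `𝒜 ⟶ 𝓕 ⊙ ℬ`. -/
def IsCohomOP {𝒜 ℬ 𝓔 : OP ψ G} (P : BlackProduct 𝓔 ℬ) (coev : 𝒜 ⟶ P.toOP) : Prop :=
  ∀ (𝓕 : OP ψ G) (Q : BlackProduct 𝓕 ℬ),
    (∀ g : 𝓔 ⟶ 𝓕, ∃! k : P.toOP ⟶ Q.toOP, P.IsMap Q g k) ∧
    (∀ h : 𝒜 ⟶ Q.toOP, ∃! g : 𝓔 ⟶ 𝓕, ∃ k : P.toOP ⟶ Q.toOP, P.IsMap Q g k ∧ coev ≫ k = h)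

end Free

end Operads

/-! ### Inner cohomomorphism objects and exactness -/

section Ground

variable {C : Type u} [Category.{v} C] [MonoidalCategory C]

/-- The morphism `c : X ⟶ H ⊗ Z` makes `H` the inner cohomomorphism object of `X` and `Z`, with
coevaluation `c`. -/
def IsCohom {X Z H : C} (c : X ⟶ H ⊗ Z) : Prop :=
  ∀ (Y : C) (f : X ⟶ Y ⊗ Z), ∃! g : H ⟶ Y, c ≫ g ▷ Z = f

variable (C) in
/-- The tensor product is exact in each argument. -/
class ExactTensor : Prop where
  preservesFiniteLimits_left : ∀ X : C, PreservesFiniteLimits (tensorLeft X)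
  preservesFiniteColimits_left : ∀ X : C, PreservesFiniteColimits (tensorLeft X)
  preservesFiniteLimits_right : ∀ X : C, PreservesFiniteLimits (tensorRight X)
  preservesFiniteColimits_right : ∀ X : C, PreservesFiniteColimits (tensorRight X)

end Ground

end GraphOperad

open GraphOperad

/-!
The proof reduces everything to free operads. The collection `𝓕(A₁)`, a colimit over objects with a
morphism to a corolla, is not an operad by itself. The free operad generated by a collection `A₁` is
`P(τ) = colim ⨂ᵢ A₁(Xᵢ)`, the colimit over all morphisms `∐ Xᵢ ⟶ τ` from finite families of corollas
to an arbitrary object `τ` (`freeOperad`). These colimits exist and are preserved by the tensor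
product (`distributiveShape`): over a corolla, the category of families is a retract of the groupoid
of objects over it (`corOverRetract`), and over a disjoint union it is a product of such categories
(`corOverPair`), because a morphism from a union of corollas to `τ ⊔ σ` splits (`exists_corPair`, a
consequence of the existence of atomizations). The same splitting makes the multiplication of `P`
invertible (`isIso_freeMul`), and lifting along graftings makes `P` send them to isomorphisms
(`isIso_freeFunctor_map`). The coherence of tensor products of finite families, on which these
constructions rest, is settled by `FinFam.Tr1.unique` and its variants: a morphism that permutes
factors is determined by its map of indices and its components, if no factor is repeated.

A morphism from the free operad to an operad is a morphism from the generators (`freeExt`,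
`freeι_freeExt`), and `A₁ ⟶ A` is a presentation only if `P ⟶ A` is epi (`IsPresentation.epi_freeExt`).
Since the tensor product is exact, images, pushouts of epimorphisms and descent along epimorphisms of
operads can be formed objectwise (`Operad.exists_image`, `Operad.exists_pushout`,
`Operad.exists_desc_of_corollas`). In particular, a quotient of the underlying collection of an operad
generates a universal quotient operad (`Operad.exists_quotient_coll`), and a morphism from a presented
operad lifts to a suboperad if it does so on generators (`IsPresentation.exists_lift`).

Inner cohomomorphism objects of collections are formed objectwise, since corollas and their
isomorphisms form a groupoid (`exists_isCohom_functor`). For `E₁ = cohom(A₁, B₁)`, morphisms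
`Free(E₁) ⟶ F` correspond to morphisms `A₁ ⟶ F ○ B₁`, hence give morphisms `Free(A₁) ⟶ F ○ B`. If `N`
is the kernel of `Free(A₁) ⟶ A` on collections, then such a morphism descends to `A` if and only if it
vanishes on `N`, which by adjunction is a condition on the restriction of `Free(E₁) ⟶ F` along a
morphism `cohom(N, B) ⟶ Free(E₁)`. Therefore the quotient operad `E` of `Free(E₁)` by the image of this
morphism is initial (`exists_initial`). The product `𝓕 ⊙ 𝓖` is the image of `Free(F₁ ⊗ G₁)` in `F ○ G`
(`exists_blackProduct`), and its universal property follows from that of `E` by lifting morphisms to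
suboperads.
-/

set_option linter.unusedSectionVars false

namespace GraphOperad

/-! ### Concatenation of lists of factors -/

namespace FinFam

section ListAppend

variable {C : Type u} [Category.{v} C] [MonoidalCategory C]

/-- The multiplication `X_l ⊗ X_l' ⟶ X_{l ++ l'}` of tensor products along lists. -/
def listAppend {ι : Type} (X : ι → C) : (l l' : List ι) →
    (listTensor X l ⊗ listTensor X l' ⟶ listTensor X (l ++ l'))
  | [], l' => (λ_ (listTensor X l')).hom
  | a :: l, l' => (α_ (X a) (listTensor X l) (listTensor X l')).hom ≫ X a ◁ listAppend X l l'

theorem isIso_listAppend {ι : Type} (X : ι → C) (l l' : List ι) : IsIso (listAppend X l l') := by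
  induction l with
  | nil => exact inferInstanceAs (IsIso (λ_ (listTensor X l')).hom)
  | cons a l ih =>
    exact inferInstanceAs (IsIso ((α_ (X a) (listTensor X l) (listTensor X l')).hom ≫
      X a ◁ listAppend X l l'))

theorem isIso_listMap {ι κ : Type} {X : ι → C} {Y : κ → C} (e : ι → κ)
    (f : ∀ i, X i ⟶ Y (e i)) (l : List ι) (hf : ∀ i, IsIso (f i)) : IsIso (listMap e f l) := by
  induction l with
  | nil => exact inferInstanceAs (IsIso (𝟙 (𝟙_ C)))
  | cons a l ih => exact inferInstanceAs (IsIso (f a ⊗ₘ listMap e f l))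

theorem whiskerRight_append_aux {A L L' M N N' : C} {p : L ⟶ L'} {a : L ⊗ M ⟶ N}
    {a' : L' ⊗ M ⟶ N'} {q : N ⟶ N'} (h : (p ▷ M) ≫ a' = a ≫ q) :
    ((A ◁ p) ▷ M) ≫ (α_ A L' M).hom ≫ A ◁ a' = ((α_ A L M).hom ≫ A ◁ a) ≫ A ◁ q := by
  rw [Category.assoc, ← whiskerLeft_comp, ← h, whiskerLeft_comp]
  simp

variable [SymmetricCategory C]

theorem IsReorder.isIso {ι : Type} {X : ι → C} {l l' : List ι}
    {p : listTensor X l ⟶ listTensor X l'} (hp : IsReorder X l l' p) : IsIso p := by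
  obtain ⟨q, -, h1, h2⟩ := hp.exists_inv
  exact ⟨q, h1, h2⟩

/-- `swapHom A B L` swaps the first two of the factors `A ⊗ (B ⊗ L)`; this is its compatibility
with a further factor on the right. -/
theorem swapHom_assoc (A B L M : C) :
    (swapHom A B L ▷ M) ≫ (α_ B (A ⊗ L) M).hom ≫ B ◁ (α_ A L M).hom =
      (α_ A (B ⊗ L) M).hom ≫ A ◁ (α_ B L M).hom ≫ swapHom A B (L ⊗ M) := by
  simp only [swapHom]
  monoidal

/-- Reordering the first of two concatenated lists is a reordering of the concatenation. As for all
statements on reorderings here, the reordering on the other side of the square is only asserted to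
exist: for lists without repetitions it is determined by its source and target. -/
theorem IsReorder.append_right {ι : Type} {X : ι → C} {l₁ l₂ : List ι}
    {p : listTensor X l₁ ⟶ listTensor X l₂} (hp : IsReorder X l₁ l₂ p) (l' : List ι) :
    ∃ q, IsReorder X (l₁ ++ l') (l₂ ++ l') q ∧
      (p ▷ listTensor X l') ≫ listAppend X l₂ l' = listAppend X l₁ l' ≫ q := by
  induction hp with
  | nil =>
    refine ⟨𝟙 _, .refl _ _, ?_⟩
    have : ∀ L : C, (𝟙 (𝟙_ C) ▷ L) ≫ (λ_ L).hom = (λ_ L).hom ≫ 𝟙 _ := by simp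
    exact this _
  | @cons a l l' p hp ih =>
    obtain ⟨q, h1, h2⟩ := ih
    exact ⟨_, .cons a h1, whiskerRight_append_aux h2⟩
  | swap a b l =>
    refine ⟨_, .swap a b _, ?_⟩
    have : ∀ {A B L M N : C} (f : L ⊗ M ⟶ N), (swapHom A B L ▷ M) ≫ (α_ B (A ⊗ L) M).hom ≫
        B ◁ ((α_ A L M).hom ≫ A ◁ f) =
        ((α_ A (B ⊗ L) M).hom ≫ A ◁ ((α_ B L M).hom ≫ B ◁ f)) ≫ swapHom A B N := by
      intro A B L M N f
      simp only [whiskerLeft_comp, Category.assoc, swapHom_natural_right]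
      have h := swapHom_assoc A B L M
      simp only [← Category.assoc] at h ⊢
      rw [h]
    exact this _
  | trans _ _ ih ih' =>
    obtain ⟨q, h1, h2⟩ := ih
    obtain ⟨q', h1', h2'⟩ := ih'
    exact ⟨_, h1.trans h1', by rw [comp_whiskerRight, Category.assoc, h2', reassoc_of% h2]⟩

theorem IsReorder.append_left {ι : Type} {X : ι → C} {l₁ l₂ : List ι}
    {p : listTensor X l₁ ⟶ listTensor X l₂} (hp : IsReorder X l₁ l₂ p) (l : List ι) :
    ∃ q, IsReorder X (l ++ l₁) (l ++ l₂) q ∧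
      (listTensor X l ◁ p) ≫ listAppend X l l₂ = listAppend X l l₁ ≫ q := by
  induction l with
  | nil => exact ⟨p, hp, leftUnitor_naturality p⟩
  | cons a l ih =>
    obtain ⟨q, h1, h2⟩ := ih
    refine ⟨_, .cons a h1, ?_⟩
    have : ∀ {A L M M' N N' : C} {p : M ⟶ M'} {f : L ⊗ M ⟶ N} {f' : L ⊗ M' ⟶ N'} {q : N ⟶ N'},
        (L ◁ p) ≫ f' = f ≫ q → ((A ⊗ L) ◁ p) ≫ (α_ A L M').hom ≫ A ◁ f' =
          ((α_ A L M).hom ≫ A ◁ f) ≫ A ◁ q := by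
      intro A L M M' N N' p f f' q h
      rw [Category.assoc, ← whiskerLeft_comp, ← h]
      simp
    exact this h2

theorem IsReorder.append {ι : Type} {X : ι → C} {l₁ l₂ m₁ m₂ : List ι}
    {p : listTensor X l₁ ⟶ listTensor X l₂} (hp : IsReorder X l₁ l₂ p)
    {p' : listTensor X m₁ ⟶ listTensor X m₂} (hp' : IsReorder X m₁ m₂ p') :
    ∃ q, IsReorder X (l₁ ++ m₁) (l₂ ++ m₂) q ∧
      (p ⊗ₘ p') ≫ listAppend X l₂ m₂ = listAppend X l₁ m₁ ≫ q := by
  obtain ⟨q, h1, h2⟩ := hp.append_right m₁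
  obtain ⟨q', h1', h2'⟩ := hp'.append_left l₂
  exact ⟨_, h1.trans h1', by
    rw [MonoidalCategory.tensorHom_def, Category.assoc, h2', reassoc_of% h2]⟩

/-- Concatenation is associative up to a reordering. The two bracketings are the same list, so the
reordering stands for a transport along an equality of lists. -/
theorem listAppend_assoc {ι : Type} (X : ι → C) (l l' l'' : List ι) :
    ∃ q, IsReorder X ((l ++ l') ++ l'') (l ++ (l' ++ l'')) q ∧
      (listAppend X l l' ▷ listTensor X l'') ≫ listAppend X (l ++ l') l'' ≫ q =
        (α_ _ _ _).hom ≫ (listTensor X l ◁ listAppend X l' l'') ≫ listAppend X l (l' ++ l'') := by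
  induction l with
  | nil =>
    refine ⟨𝟙 _, .refl _ _, ?_⟩
    have : ∀ {L M N : C} (f : L ⊗ M ⟶ N), ((λ_ L).hom ▷ M) ≫ f ≫ 𝟙 _ =
        (α_ _ _ _).hom ≫ ((𝟙_ C) ◁ f) ≫ (λ_ N).hom := by
      intro L M N f; simp
    exact this _
  | cons a l ih =>
    obtain ⟨q, h1, h2⟩ := ih
    refine ⟨_, .cons a h1, ?_⟩
    have : ∀ {A L M N LM LMN LMN' MN : C} {f : L ⊗ M ⟶ LM} {g : LM ⊗ N ⟶ LMN} {q : LMN ⟶ LMN'}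
        {f' : M ⊗ N ⟶ MN} {g' : L ⊗ MN ⟶ LMN'},
        (f ▷ N) ≫ g ≫ q = (α_ L M N).hom ≫ (L ◁ f') ≫ g' →
        (((α_ A L M).hom ≫ A ◁ f) ▷ N) ≫ ((α_ A LM N).hom ≫ A ◁ g) ≫ A ◁ q =
        (α_ (A ⊗ L) M N).hom ≫ ((A ⊗ L) ◁ f') ≫ (α_ A L MN).hom ≫ A ◁ g' := by
      intro A L M N LM LMN LMN' MN f g q f' g' h
      have h' := congrArg (A ◁ ·) h
      simp only [whiskerLeft_comp] at h'
      simp only [comp_whiskerRight, Category.assoc]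
      simp [h']
    exact this h2

/-- The empty list is a right unit for concatenation, again up to a transport along an equality of
lists. -/
theorem listAppend_nil {ι : Type} (X : ι → C) (l : List ι) :
    ∃ q, IsReorder X (l ++ []) l q ∧ listAppend X l [] ≫ q = (ρ_ (listTensor X l)).hom := by
  induction l with
  | nil =>
    refine ⟨𝟙 _, .refl _ _, ?_⟩
    have : (λ_ (𝟙_ C)).hom ≫ 𝟙 _ = (ρ_ (𝟙_ C)).hom := by simp [unitors_equal]
    exact this
  | cons a l ih =>
    obtain ⟨q, h1, h2⟩ := ih
    refine ⟨_, .cons a h1, ?_⟩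
    have : ∀ {A L N : C} {f : L ⊗ 𝟙_ C ⟶ N} {q : N ⟶ L}, f ≫ q = (ρ_ L).hom →
        ((α_ A L (𝟙_ C)).hom ≫ A ◁ f) ≫ A ◁ q = (ρ_ (A ⊗ L)).hom := by
      intro A L N f q h
      rw [Category.assoc, ← whiskerLeft_comp, h]
      simp
    exact this h2

/-- The hexagon identity: swapping `A` past `B` and then past `L` is swapping it past `B ⊗ L`. -/
theorem swapHom_comp_append (A B L M : C) :
    A ◁ (α_ B L M).hom ≫ swapHom A B (L ⊗ M) ≫ B ◁ swapHom A L M =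
      swapHom A (B ⊗ L) M ≫ (α_ B L (A ⊗ M)).hom := by
  simp only [swapHom, BraidedCategory.braiding_tensor_right_hom]
  monoidal

/-- Moving the first factor behind the factors of a list `l'` is a reordering; this is the inductive
step in `listAppend_braid`. -/
theorem exists_reorder_move {ι : Type} (X : ι → C) (a : ι) (l' l : List ι) :
    ∃ q, IsReorder X (a :: (l' ++ l)) (l' ++ a :: l) q ∧
      (X a ◁ listAppend X l' l) ≫ q =
        swapHom (X a) (listTensor X l') (listTensor X l) ≫ listAppend X l' (a :: l) := by
  induction l' with
  | nil =>
    refine ⟨𝟙 _, .refl _ _, ?_⟩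
    have : ∀ {A L : C}, A ◁ (λ_ L).hom ≫ 𝟙 _ = swapHom A (𝟙_ C) L ≫ (λ_ (A ⊗ L)).hom := by
      intro A L
      simp only [swapHom, Category.comp_id, Category.assoc]
      rw [braiding_tensorUnit_right]
      simp
    exact this
  | cons b l' ih =>
    obtain ⟨q, h1, h2⟩ := ih
    refine ⟨_, (IsReorder.swap a b _).trans (.cons b h1), ?_⟩
    have : ∀ {A B L' L N N' : C} {f : L' ⊗ L ⟶ N} {q : A ⊗ N ⟶ N'} {f' : L' ⊗ (A ⊗ L) ⟶ N'},
        (A ◁ f) ≫ q = swapHom A L' L ≫ f' →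
        (A ◁ ((α_ B L' L).hom ≫ B ◁ f)) ≫ swapHom A B N ≫ B ◁ q =
        swapHom A (B ⊗ L') L ≫ (α_ B L' (A ⊗ L)).hom ≫ B ◁ f' := by
      intro A B L' L N N' f q f' h
      rw [whiskerLeft_comp, Category.assoc, reassoc_of% (swapHom_natural_right A B f),
        ← whiskerLeft_comp, h, whiskerLeft_comp, reassoc_of% (swapHom_comp_append A B L' L)]
    exact this h2

/-- Under concatenation the braiding becomes a reordering. -/
theorem listAppend_braid {ι : Type} (X : ι → C) (l l' : List ι) :
    ∃ q, IsReorder X (l ++ l') (l' ++ l) q ∧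
      listAppend X l l' ≫ q = (β_ _ _).hom ≫ listAppend X l' l := by
  induction l with
  | nil =>
    obtain ⟨q, h1, h2⟩ := listAppend_nil X l'
    obtain ⟨q', h3, h4, h5⟩ := h1.exists_inv
    refine ⟨q', h3, ?_⟩
    have : ∀ {L N : C} {f : L ⊗ 𝟙_ C ⟶ N} {q : N ⟶ L} {q' : L ⟶ N}, f ≫ q = (ρ_ L).hom →
        q ≫ q' = 𝟙 _ → (λ_ L).hom ≫ q' = (β_ (𝟙_ C) L).hom ≫ f := by
      intro L N f q q' h h'
      have : f = (ρ_ L).hom ≫ q' := by rw [← h, Category.assoc, h', Category.comp_id]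
      rw [this]; simp
    exact this h2 h4
  | cons a l ih =>
    obtain ⟨q, h1, h2⟩ := ih
    obtain ⟨q', h1', h2'⟩ := exists_reorder_move X a l' l
    refine ⟨_, (IsReorder.cons a h1).trans h1', ?_⟩
    have : ∀ {A L M N N' N'' : C} {f : L ⊗ M ⟶ N} {f' : M ⊗ L ⟶ N'} {q : N ⟶ N'}
        {f'' : M ⊗ (A ⊗ L) ⟶ N''} {q' : A ⊗ N' ⟶ N''},
        f ≫ q = (β_ L M).hom ≫ f' → (A ◁ f') ≫ q' = swapHom A M L ≫ f'' →
        ((α_ A L M).hom ≫ A ◁ f) ≫ (A ◁ q ≫ q') = (β_ (A ⊗ L) M).hom ≫ f'' := by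
      intro A L M N N' N'' f f' q f'' q' h h'
      rw [Category.assoc, ← whiskerLeft_comp_assoc, h, whiskerLeft_comp_assoc, h',
        BraidedCategory.braiding_tensor_left_hom]
      simp [swapHom]
    exact this h2 h2'

end ListAppend

/-! ### Maps of families and transport of tensor products -/

/-- A map of families: a map of index sets, with a morphism from each member to the member with
the image index. -/
structure FamMap {C : Type u} [Category.{v} C] {ι κ : Type} (X : ι → C) (Y : κ → C) where
  /-- the map of index sets -/
  e : ι → κ
  /-- the components -/
  app : ∀ i, X i ⟶ Y (e i)

namespace FamMap

variable {C : Type u} [Category.{v} C] {ι κ μ : Type} {X : ι → C} {Y : κ → C} {Z : μ → C}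

/-- Maps of families agree if their components do, up to the identification of the targets forced by
the equality of the maps of index sets. -/
theorem ext_of_app {f g : FamMap X Y}
    (h : ∀ i, ∃ h : f.e i = g.e i, f.app i ≫ eqToHom (congrArg Y h) = g.app i) : f = g := by
  obtain ⟨e, f⟩ := f
  obtain ⟨e', g⟩ := g
  obtain rfl : e = e' := funext fun i => (h i).1
  congr 1
  funext i
  simpa using (h i).2

/-- The composition of maps of families. -/
def comp (f : FamMap X Y) (g : FamMap Y Z) : FamMap X Z :=
  ⟨g.e ∘ f.e, fun i => f.app i ≫ g.app (f.e i)⟩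

/-- The identity map of a family. -/
def id (X : ι → C) : FamMap X X := ⟨_root_.id, fun i => 𝟙 (X i)⟩

/-- The inclusion of a subfamily, given by a map of index sets. -/
def incl (Y : κ → C) (e : ι → κ) : FamMap (fun i => Y (e i)) Y := ⟨e, fun i => 𝟙 (Y (e i))⟩

end FamMap

/-- The map of families underlying a morphism in `FinFam C`. -/
def Hom.toFamMap {C : Type u} [Category.{v} C] {X Y : FinFam C} (f : X ⟶ Y) :
    FamMap X.obj Y.obj := ⟨Hom.e f, Hom.app f⟩

theorem hom_ext_famMap {C : Type u} [Category.{v} C] {X Y : FinFam C} {f g : X ⟶ Y}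
    (h : Hom.toFamMap f = Hom.toFamMap g) : f = g := by
  obtain ⟨e, f⟩ := f
  obtain ⟨e', g⟩ := g
  simp only [Hom.toFamMap, FamMap.mk.injEq, DFunLike.coe_fn_eq] at h
  obtain ⟨rfl, h⟩ := h
  obtain rfl := eq_of_heq h
  rfl

section Transport

variable {C : Type u} [Category.{v} C] [MonoidalCategory C] [SymmetricCategory C]
variable {ι κ μ ι' κ' ξ ξ' : Type} {X : ι → C} {Y : κ → C} {Z : μ → C} {X' : ι' → C} {Y' : κ' → C}
  {W : ξ → C} {W' : ξ' → C}

/-- The action of a map of families on tensor products along lists. -/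
abbrev FamMap.list (f : FamMap X Y) (l : List ι) : listTensor X l ⟶ listTensor Y (l.map f.e) :=
  listMap f.e f.app l

/-- A morphism of tensor products along lists that is given by a map of families, up to a
reordering of factors. Only the map of families matters for equality (`Tr1.unique`), so that
diagrams of such morphisms commute as soon as the diagrams of index sets and components do. -/
def Tr1 (f : FamMap X Y) {l : List ι} {n : List κ} (φ : listTensor X l ⟶ listTensor Y n) : Prop :=
  ∃ q, IsReorder Y (l.map f.e) n q ∧ φ = f.list l ≫ q

/-- The analogue of `Tr1` for morphisms whose source has two factors. -/
def Tr2 (f : FamMap X Y) (g : FamMap X' Y) {l : List ι} {l' : List ι'} {n : List κ}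
    (φ : listTensor X l ⊗ listTensor X' l' ⟶ listTensor Y n) : Prop :=
  ∃ q, IsReorder Y (l.map f.e ++ l'.map g.e) n q ∧
    φ = (f.list l ⊗ₘ g.list l') ≫ listAppend Y _ _ ≫ q

/-- The analogue of `Tr1` for morphisms whose source has three factors. -/
def Tr3 (f : FamMap X Z) (g : FamMap Y Z) (h : FamMap W Z) {l : List ι} {l' : List κ}
    {l'' : List ξ} {n : List μ}
    (φ : (listTensor X l ⊗ listTensor Y l') ⊗ listTensor W l'' ⟶ listTensor Z n) : Prop :=
  ∃ q, IsReorder Z ((l.map f.e ++ l'.map g.e) ++ l''.map h.e) n q ∧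
    φ = (((f.list l ⊗ₘ g.list l') ≫ listAppend Z _ _) ⊗ₘ h.list l'') ≫ listAppend Z _ _ ≫ q

/-- Coherence: if the target has no repeated factor, then a morphism given by a map of families up
to a reordering is determined by the map of families. -/
theorem Tr1.unique {f : FamMap X Y} {l : List ι} {n : List κ} (hn : n.Nodup)
    {φ ψ : listTensor X l ⟶ listTensor Y n} (h : Tr1 f φ) (h' : Tr1 f ψ) : φ = ψ := by
  obtain ⟨q, h1, rfl⟩ := h
  obtain ⟨q', h1', rfl⟩ := h'
  rw [h1.unique (h1.perm.nodup_iff.2 hn) h1']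

/-- Coherence, for two factors in the source. -/
theorem Tr2.unique {f : FamMap X Y} {g : FamMap X' Y} {l : List ι} {l' : List ι'} {n : List κ}
    (hn : n.Nodup) {φ ψ : listTensor X l ⊗ listTensor X' l' ⟶ listTensor Y n}
    (h : Tr2 f g φ) (h' : Tr2 f g ψ) : φ = ψ := by
  obtain ⟨q, h1, rfl⟩ := h
  obtain ⟨q', h1', rfl⟩ := h'
  rw [h1.unique (h1.perm.nodup_iff.2 hn) h1']

/-- Coherence, for three factors in the source. -/
theorem Tr3.unique {f : FamMap X Z} {g : FamMap Y Z} {h : FamMap W Z} {l : List ι} {l' : List κ}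
    {l'' : List ξ} {n : List μ} (hn : n.Nodup)
    {φ ψ : (listTensor X l ⊗ listTensor Y l') ⊗ listTensor W l'' ⟶ listTensor Z n}
    (h₁ : Tr3 f g h φ) (h₂ : Tr3 f g h ψ) : φ = ψ := by
  obtain ⟨q, h1, rfl⟩ := h₁
  obtain ⟨q', h1', rfl⟩ := h₂
  rw [h1.unique (h1.perm.nodup_iff.2 hn) h1']

/-- The action of maps of families is functorial, up to the equality of the lists `l.map f` mapped
by `g` and `l.map (g ∘ f)`, which is expressed as a reordering. -/
theorem list_comp (f : FamMap X Y) (g : FamMap Y Z) (l : List ι) :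
    ∃ q, IsReorder Z ((l.map f.e).map g.e) (l.map (f.comp g).e) q ∧
      f.list l ≫ g.list (l.map f.e) ≫ q = (f.comp g).list l := by
  induction l with
  | nil =>
    refine ⟨𝟙 _, .refl _ _, ?_⟩
    exact (congrArg (𝟙 (𝟙_ C) ≫ ·) (Category.id_comp _)).trans (Category.id_comp _)
  | cons a l ih =>
    obtain ⟨q, h1, h2⟩ := ih
    refine ⟨_, .cons _ h1, ?_⟩
    have : ∀ {A B D L M N N' : C} {f : A ⟶ B} {g : B ⟶ D} {f' : L ⟶ M} {g' : M ⟶ N} {q : N ⟶ N'}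
        {r : L ⟶ N'}, f' ≫ g' ≫ q = r →
        (f ⊗ₘ f') ≫ (g ⊗ₘ g') ≫ D ◁ q = (f ≫ g) ⊗ₘ r := by
      rintro A B D L M N N' f g f' g' q r rfl
      rw [← id_tensorHom, tensorHom_comp_tensorHom, tensorHom_comp_tensorHom, Category.comp_id]
    exact this h2

theorem listMap_append (f : FamMap X Y) (l l' : List ι) :
    ∃ q, IsReorder Y ((l ++ l').map f.e) (l.map f.e ++ l'.map f.e) q ∧
      listAppend X l l' ≫ f.list (l ++ l') ≫ q =
        (f.list l ⊗ₘ f.list l') ≫ listAppend Y _ _ := by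
  induction l with
  | nil =>
    refine ⟨𝟙 _, .refl _ _, ?_⟩
    have : ∀ {L M : C} (f : L ⟶ M), (λ_ L).hom ≫ f ≫ 𝟙 _ = (𝟙 (𝟙_ C) ⊗ₘ f) ≫ (λ_ M).hom := by
      intro L M f; simp
    exact this _
  | cons a l ih =>
    obtain ⟨q, h1, h2⟩ := ih
    refine ⟨_, .cons _ h1, ?_⟩
    have : ∀ {A B L L' M M' N N' N'' : C} {f : A ⟶ B} {p : L ⟶ L'} {p' : M ⟶ M'} {a : L ⊗ M ⟶ N}
        {r : N ⟶ N'} {q : N' ⟶ N''} {a' : L' ⊗ M' ⟶ N''}, a ≫ r ≫ q = (p ⊗ₘ p') ≫ a' →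
        ((α_ A L M).hom ≫ A ◁ a) ≫ (f ⊗ₘ r) ≫ B ◁ q =
        ((f ⊗ₘ p) ⊗ₘ p') ≫ (α_ B L' M').hom ≫ B ◁ a' := by
      intro A B L L' M M' N N' N'' f p p' a r q a' h
      rw [associator_naturality_assoc, ← id_tensorHom, ← id_tensorHom, ← id_tensorHom,
        tensorHom_comp_tensorHom, tensorHom_comp_tensorHom, Category.assoc,
        tensorHom_comp_tensorHom, h]
      simp
    exact this h2

theorem FamMap.reorder_list (f : FamMap X Y) {l l' : List ι}
    {p : listTensor X l ⟶ listTensor X l'} (hp : IsReorder X l l' p) :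
    ∃ q, IsReorder Y (l.map f.e) (l'.map f.e) q ∧ p ≫ f.list l' = f.list l ≫ q :=
  hp.map_naturality f.e f.app

theorem Tr1.comp {f : FamMap X Y} {g : FamMap Y Z} {l : List ι} {n : List κ} {m : List μ}
    {φ : listTensor X l ⟶ listTensor Y n} {ψ : listTensor Y n ⟶ listTensor Z m}
    (h : Tr1 f φ) (h' : Tr1 g ψ) : Tr1 (f.comp g) (φ ≫ ψ) := by
  obtain ⟨q, h1, rfl⟩ := h
  obtain ⟨q', h1', rfl⟩ := h'
  obtain ⟨r, h2, h3⟩ := g.reorder_list h1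
  obtain ⟨s, h4, h5⟩ := list_comp f g l
  obtain ⟨s', h6, h7, h8⟩ := h4.exists_inv
  refine ⟨_, h6.trans (h2.trans h1'), ?_⟩
  rw [← h5]
  simp only [Category.assoc]
  rw [reassoc_of% h7, reassoc_of% h3]

theorem Tr2.comp {f : FamMap X Y} {f' : FamMap X' Y} {g : FamMap Y Z} {l : List ι} {l' : List ι'}
    {n : List κ} {m : List μ} {φ : listTensor X l ⊗ listTensor X' l' ⟶ listTensor Y n}
    {ψ : listTensor Y n ⟶ listTensor Z m}
    (h : Tr2 f f' φ) (h' : Tr1 g ψ) : Tr2 (f.comp g) (f'.comp g) (φ ≫ ψ) := by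
  obtain ⟨q, h1, rfl⟩ := h
  obtain ⟨q', h1', rfl⟩ := h'
  obtain ⟨r, h2, h3⟩ := g.reorder_list h1
  obtain ⟨a, ha1, ha2⟩ := listMap_append g (l.map f.e) (l'.map f'.e)
  obtain ⟨a', ha3, ha4, ha5⟩ := ha1.exists_inv
  obtain ⟨s, hs1, hs2⟩ := list_comp f g l
  obtain ⟨s', hs1', hs2'⟩ := list_comp f' g l'
  obtain ⟨t, ht1, ht2⟩ := hs1.append hs1'
  obtain ⟨t', ht3, ht4, ht5⟩ := ht1.exists_inv
  refine ⟨_, ht3.trans (ha3.trans (h2.trans h1')), ?_⟩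
  rw [← hs2, ← hs2', ← Category.assoc, ← Category.assoc, ← tensorHom_comp_tensorHom,
    ← tensorHom_comp_tensorHom]
  simp only [Category.assoc]
  rw [reassoc_of% ht2, reassoc_of% ht4, ← reassoc_of% ha2, reassoc_of% ha4, reassoc_of% h3]

theorem Tr2.precomp {f : FamMap X Y} {f' : FamMap X' Y'} {g : FamMap Y Z} {g' : FamMap Y' Z}
    {l : List ι} {l' : List ι'} {n : List κ} {n' : List κ'} {m : List μ}
    {φ : listTensor X l ⟶ listTensor Y n} {φ' : listTensor X' l' ⟶ listTensor Y' n'}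
    {ψ : listTensor Y n ⊗ listTensor Y' n' ⟶ listTensor Z m}
    (h : Tr1 f φ) (h' : Tr1 f' φ') (h'' : Tr2 g g' ψ) :
    Tr2 (f.comp g) (f'.comp g') ((φ ⊗ₘ φ') ≫ ψ) := by
  obtain ⟨q, h1, rfl⟩ := h
  obtain ⟨q', h1', rfl⟩ := h'
  obtain ⟨r, h2, rfl⟩ := h''
  obtain ⟨a, ha1, ha2⟩ := g.reorder_list h1
  obtain ⟨a', ha1', ha2'⟩ := g'.reorder_list h1'
  obtain ⟨s, hs1, hs2⟩ := list_comp f g l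
  obtain ⟨s', hs1', hs2'⟩ := list_comp f' g' l'
  obtain ⟨t, ht1, ht2⟩ := hs1.append hs1'
  obtain ⟨t', ht3, ht4, ht5⟩ := ht1.exists_inv
  obtain ⟨b, hb1, hb2⟩ := ha1.append ha1'
  refine ⟨_, ht3.trans (hb1.trans h2), ?_⟩
  rw [← hs2, ← hs2']
  simp only [← tensorHom_comp_tensorHom, Category.assoc]
  have key : (q ⊗ₘ q') ≫ (g.list n ⊗ₘ g'.list n') =
      (g.list (l.map f.e) ⊗ₘ g'.list (l'.map f'.e)) ≫ (a ⊗ₘ a') := by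
    rw [tensorHom_comp_tensorHom, ha2, ha2', tensorHom_comp_tensorHom]
  rw [reassoc_of% ht2, reassoc_of% ht4, ← reassoc_of% hb2, reassoc_of% key]

theorem Tr2.braid {f : FamMap X Y} {f' : FamMap X' Y} {l : List ι} {l' : List ι'}
    {n : List κ} {φ : listTensor X l ⊗ listTensor X' l' ⟶ listTensor Y n} (h : Tr2 f f' φ) :
    Tr2 f' f ((β_ (listTensor X' l') (listTensor X l)).hom ≫ φ) := by
  obtain ⟨q, h1, rfl⟩ := h
  obtain ⟨a, ha1, ha2⟩ := listAppend_braid Y (l'.map f'.e) (l.map f.e)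
  refine ⟨_, ha1.trans h1, ?_⟩
  rw [reassoc_of% ha2, BraidedCategory.braiding_naturality_assoc]

theorem Tr3.of_left {f : FamMap X Y} {f' : FamMap X' Y} {g : FamMap Y Z} {h : FamMap W Z}
    {l : List ι} {l' : List ι'} {l'' : List ξ} {n : List κ} {m : List μ}
    {φ : listTensor X l ⊗ listTensor X' l' ⟶ listTensor Y n}
    {ψ : listTensor Y n ⊗ listTensor W l'' ⟶ listTensor Z m} (h₁ : Tr2 f f' φ) (h₂ : Tr2 g h ψ) :
    Tr3 (f.comp g) (f'.comp g) h ((φ ▷ _) ≫ ψ) := by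
  obtain ⟨q, h1, rfl⟩ := h₂
  have h3 : Tr2 (f.comp g) (f'.comp g) (φ ≫ g.list n) :=
    h₁.comp ⟨𝟙 _, .refl _ _, (Category.comp_id _).symm⟩
  obtain ⟨r, h4, h5⟩ := h3
  obtain ⟨s, hs1, hs2⟩ := h4.append (IsReorder.refl Z (l''.map h.e))
  refine ⟨_, hs1.trans h1, ?_⟩
  rw [← reassoc_of% hs2, ← tensorHom_id, tensorHom_comp_tensorHom_assoc, h5,
    tensorHom_comp_tensorHom_assoc]
  simp only [Category.assoc, Category.id_comp, Category.comp_id]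

theorem Tr3.of_right {f : FamMap X Z} {g : FamMap Y Z} {h : FamMap X' Y} {h' : FamMap W Y}
    {l : List ι} {l' : List ι'} {l'' : List ξ} {n : List κ} {m : List μ}
    {φ : listTensor X' l' ⊗ listTensor W l'' ⟶ listTensor Y n}
    {ψ : listTensor X l ⊗ listTensor Y n ⟶ listTensor Z m} (h₁ : Tr2 h h' φ) (h₂ : Tr2 f g ψ) :
    Tr3 f (h.comp g) (h'.comp g) ((α_ _ _ _).hom ≫ (_ ◁ φ) ≫ ψ) := by
  obtain ⟨q, h1, rfl⟩ := h₂
  have h3 : Tr2 (h.comp g) (h'.comp g) (φ ≫ g.list n) :=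
    h₁.comp ⟨𝟙 _, .refl _ _, (Category.comp_id _).symm⟩
  obtain ⟨r, h4, h5⟩ := h3
  obtain ⟨s, hs1, hs2⟩ := (IsReorder.refl Z (l.map f.e)).append h4
  obtain ⟨t, ht1, ht2⟩ := listAppend_assoc Z (l.map f.e) (l'.map (h.comp g).e)
    (l''.map (h'.comp g).e)
  refine ⟨_, ht1.trans (hs1.trans h1), ?_⟩
  calc _ = (α_ _ _ _).hom ≫ (f.list l ⊗ₘ ((h.comp g).list l' ⊗ₘ (h'.comp g).list l'')) ≫
        (_ ◁ listAppend Z _ _) ≫ listAppend Z _ _ ≫ s ≫ q := by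
        rw [← reassoc_of% hs2, ← id_tensorHom, ← id_tensorHom, tensorHom_comp_tensorHom_assoc, h5,
          tensorHom_comp_tensorHom_assoc, tensorHom_comp_tensorHom_assoc]
        simp only [Category.assoc, Category.id_comp, Category.comp_id]
    _ = _ := by
        rw [← associator_naturality_assoc]
        rw [← reassoc_of% ht2, ← tensorHom_id, tensorHom_comp_tensorHom_assoc, Category.comp_id]

end Transport

end FinFam

theorem comp_assoc_of_eq {C : Type u} [Category.{v} C] {X Y Y' Z W : C} {f : X ⟶ Y} {g : Y ⟶ Z}
    {f' : X ⟶ Y'} {g' : Y' ⟶ Z} (h : f ≫ g = f' ≫ g') (k : Z ⟶ W) :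
    f ≫ g ≫ k = f' ≫ g' ≫ k := by
  rw [← Category.assoc, h, Category.assoc]

theorem comp_comp_of_eq {C : Type u} [Category.{v} C] {X Y Z W : C} {f : X ⟶ Y} {g : Y ⟶ Z}
    {h : X ⟶ Z} (e : f ≫ g = h) (k : Z ⟶ W) : f ≫ g ≫ k = h ≫ k := by
  rw [← e, Category.assoc]

/-! ### Disjoint unions of families -/

namespace FinFam

section FamilySums

variable {C : Type u} [Category.{v} C]

/-- The disjoint union of two families. -/
abbrev sum (X Y : FinFam C) : FinFam C := ⟨X.ι ⊕ Y.ι, Sum.elim X.obj Y.obj⟩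

/-- The empty family. -/
abbrev empty (C : Type u) : FinFam C := ⟨Empty, Empty.elim⟩

/-- The family with one member. -/
abbrev single (a : C) : FinFam C := ⟨Unit, fun _ => a⟩

/-- The disjoint union of two morphisms of families. -/
def sumMap {X Y X' Y' : FinFam C} (f : X ⟶ X') (g : Y ⟶ Y') : sum X Y ⟶ sum X' Y' where
  e := Equiv.sumCongr (Hom.e f) (Hom.e g)
  app
    | Sum.inl i => Hom.app f i
    | Sum.inr j => Hom.app g j

/-- The associativity of disjoint unions of families. -/
def sumAssoc (X Y Z : FinFam C) : sum (sum X Y) Z ⟶ sum X (sum Y Z) where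
  e := Equiv.sumAssoc _ _ _
  app
    | Sum.inl (Sum.inl i) => 𝟙 (X.obj i)
    | Sum.inl (Sum.inr i) => 𝟙 (Y.obj i)
    | Sum.inr i => 𝟙 (Z.obj i)

/-- The symmetry of disjoint unions of families. -/
def sumComm (X Y : FinFam C) : sum X Y ⟶ sum Y X where
  e := Equiv.sumComm _ _
  app
    | Sum.inl i => 𝟙 (X.obj i)
    | Sum.inr i => 𝟙 (Y.obj i)

/-- The empty family is a left unit. -/
def emptySum (X : FinFam C) : sum (empty C) X ⟶ X where
  e := Equiv.emptySum Empty X.ι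
  app
    | Sum.inl i => i.elim
    | Sum.inr i => 𝟙 (X.obj i)

/-- A morphism of families with one member. -/
def singleMap {a b : C} (f : a ⟶ b) : single a ⟶ single b := homMk fun _ => f

theorem isIso_of_isIso_app {X Y : FinFam C} (f : X ⟶ Y) (hf : ∀ i, IsIso (Hom.app f i)) :
    IsIso f := by
  obtain ⟨κ, Y⟩ := Y
  obtain ⟨e, f⟩ := f
  replace hf : ∀ i, IsIso (f i) := hf
  refine ⟨⟨e.symm, fun j => eqToHom (congrArg Y (e.apply_symm_apply j)).symm ≫ inv (f (e.symm j))⟩,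
    ?_, ?_⟩
  · refine hom_ext_famMap (FamMap.ext_of_app fun i => ⟨e.symm_apply_apply i, ?_⟩)
    change (f i ≫ eqToHom _ ≫ inv (f (e.symm (e i)))) ≫ eqToHom _ = 𝟙 _
    have : ∀ i' (h : i' = i), (f i ≫ eqToHom (congrArg (fun i => Y (e i)) h.symm) ≫ inv (f i')) ≫
        eqToHom (congrArg X.obj h) = 𝟙 _ := by
      rintro _ rfl; simp
    exact this _ (e.symm_apply_apply i)
  · refine hom_ext_famMap (FamMap.ext_of_app fun j => ⟨e.apply_symm_apply j, ?_⟩)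
    change ((eqToHom _ ≫ inv (f (e.symm j))) ≫ f (e.symm j)) ≫ eqToHom _ = 𝟙 _
    have : ∀ i j (h : e i = j), ((eqToHom (congrArg Y h).symm ≫ inv (f i)) ≫ f i) ≫
        eqToHom (congrArg Y h) = 𝟙 (Y j) := by
      rintro i _ rfl; simp
    exact this _ _ (e.apply_symm_apply j)

/-- Induction on the number of members of a family: it suffices to treat the empty family and the
addition of one member, for properties that are invariant under isomorphism. -/
theorem induction {motive : FinFam C → Prop}
    (of_isIso : ∀ {X Y : FinFam C} (f : X ⟶ Y) [IsIso f], motive X → motive Y)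
    (empty : motive (empty C)) (cons : ∀ (a : C) (X : FinFam C), motive X →
      motive (sum (single a) X)) (X : FinFam C) : motive X := by
  have key : ∀ (n : ℕ) (X : FinFam C), Fintype.card X.ι = n → motive X := by
    intro n
    induction n with
    | zero =>
      intro X hX
      have := Fintype.card_eq_zero_iff.1 hX
      let f : FinFam.empty C ⟶ X := ⟨Equiv.equivOfIsEmpty Empty _, fun i => i.elim⟩
      have : IsIso f := isIso_of_isIso_app f (fun i => i.elim)
      exact of_isIso f empty
    | succ n ih =>
      rintro ⟨ι, X⟩ hX
      let e : Fin (n + 1) ≃ ι := (Fintype.equivFinOfCardEq hX).symm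
      let Y : FinFam C := ⟨Fin n, fun i => X (e i.succ)⟩
      let e'' : Unit ⊕ Fin n ≃ Fin (n + 1) :=
        ⟨Sum.elim (fun _ => 0) Fin.succ, Fin.cases (Sum.inl ()) Sum.inr,
          by rintro (i | i) <;> rfl, by intro i; cases i using Fin.cases <;> rfl⟩
      let e' : Unit ⊕ Fin n ≃ ι := e''.trans e
      let f : sum (single (X (e 0))) Y ⟶ ⟨ι, X⟩ :=
        ⟨e', fun
          | Sum.inl i => 𝟙 (X (e 0))
          | Sum.inr i => 𝟙 (X (e i.succ))⟩
      have : IsIso f := isIso_of_isIso_app f (by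
        rintro (i | i)
        · exact inferInstanceAs (IsIso (𝟙 (X (e 0))))
        · exact inferInstanceAs (IsIso (𝟙 (X (e (Fin.succ i))))))
      exact of_isIso f (cons _ Y (ih Y (Fintype.card_fin n)))
  exact key _ X rfl

end FamilySums

/-! ### Tensor products over disjoint unions of families -/

section Tensor

variable {C : Type u} [Category.{v} C] [MonoidalCategory C] [SymmetricCategory C]

theorem tensor_map_spec {X Y : FinFam C} (f : X ⟶ Y) :
    Tr1 (Hom.toFamMap f) (l := Finset.univ.toList) (n := Finset.univ.toList)
      (FinFam.tensor.map f) :=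
  ⟨_, reorder_spec _ _, rfl⟩

theorem perm_toList_sum {ι κ : Type} [Fintype ι] [Fintype κ] :
    ((Finset.univ : Finset ι).toList.map Sum.inl ++
      (Finset.univ : Finset κ).toList.map Sum.inr).Perm
      (Finset.univ : Finset (ι ⊕ κ)).toList := by
  rw [List.perm_ext_iff_of_nodup _ (Finset.nodup_toList _)]
  · rintro (a | a) <;> simp
  · refine List.Nodup.append ((Finset.nodup_toList _).map Sum.inl_injective)
      ((Finset.nodup_toList _).map Sum.inr_injective) ?_
    intro x hx hx'
    simp only [List.mem_map] at hx hx'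
    obtain ⟨a, -, rfl⟩ := hx
    obtain ⟨b, -, hb⟩ := hx'
    exact Sum.inr_ne_inl hb

/-- The comparison between the product of the tensor products of two families and the tensor
product of their disjoint union. -/
noncomputable def tensorSum {ι κ : Type} [Fintype ι] [Fintype κ] (Z : ι ⊕ κ → C) :
    tensor.obj ⟨ι, fun i => Z (Sum.inl i)⟩ ⊗ tensor.obj ⟨κ, fun i => Z (Sum.inr i)⟩ ⟶
      tensor.obj ⟨ι ⊕ κ, Z⟩ :=
  ((FamMap.incl Z Sum.inl).list _ ⊗ₘ (FamMap.incl Z Sum.inr).list _) ≫ listAppend Z _ _ ≫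
    reorder Z perm_toList_sum

theorem tensorSum_spec {ι κ : Type} [Fintype ι] [Fintype κ] (Z : ι ⊕ κ → C) :
    Tr2 (FamMap.incl Z Sum.inl) (FamMap.incl Z Sum.inr) (l := Finset.univ.toList)
      (l' := Finset.univ.toList) (n := Finset.univ.toList) (tensorSum Z) :=
  ⟨_, reorder_spec _ _, rfl⟩

instance isIso_tensorSum {ι κ : Type} [Fintype ι] [Fintype κ] (Z : ι ⊕ κ → C) :
    IsIso (tensorSum Z) := by
  have h1 := isIso_listMap _ (FamMap.incl Z Sum.inl).app Finset.univ.toList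
    fun i => inferInstanceAs (IsIso (𝟙 _))
  have h2 := isIso_listMap _ (FamMap.incl Z Sum.inr).app Finset.univ.toList
    fun i => inferInstanceAs (IsIso (𝟙 _))
  have h3 := isIso_listAppend Z (Finset.univ.toList.map Sum.inl)
    (Finset.univ.toList.map Sum.inr)
  have h4 := (reorder_spec Z perm_toList_sum).isIso
  exact @IsIso.comp_isIso _ _ _ _ _ _ _ (@tensor_isIso _ _ _ _ _ _ _ _ h1 _ h2)
    (@IsIso.comp_isIso _ _ _ _ _ _ _ h3 h4)

/-- Naturality of `tensorSum`. A morphism `h` of families over `ι ⊕ κ` is not assumed to be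
syntactically a disjoint union; it only has to restrict to `f` and `g`. -/
theorem tensorSum_natural {ι κ ι' κ' : Type} [Fintype ι] [Fintype κ] [Fintype ι'] [Fintype κ']
    {Z : ι ⊕ κ → C} {Z' : ι' ⊕ κ' → C}
    (f : (⟨ι, fun i => Z (Sum.inl i)⟩ : FinFam C) ⟶ ⟨ι', fun i => Z' (Sum.inl i)⟩)
    (g : (⟨κ, fun i => Z (Sum.inr i)⟩ : FinFam C) ⟶ ⟨κ', fun i => Z' (Sum.inr i)⟩)
    (h : (⟨ι ⊕ κ, Z⟩ : FinFam C) ⟶ ⟨ι' ⊕ κ', Z'⟩)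
    (hl : (FamMap.incl Z Sum.inl).comp (Hom.toFamMap h) =
      (Hom.toFamMap f).comp (FamMap.incl Z' Sum.inl))
    (hr : (FamMap.incl Z Sum.inr).comp (Hom.toFamMap h) =
      (Hom.toFamMap g).comp (FamMap.incl Z' Sum.inr)) :
    (tensor.map f ⊗ₘ tensor.map g) ≫ tensorSum Z' = tensorSum Z ≫ tensor.map h := by
  refine Tr2.unique (Finset.nodup_toList _)
    (Tr2.precomp (tensor_map_spec f) (tensor_map_spec g) (tensorSum_spec Z')) ?_
  have := Tr2.comp (tensorSum_spec Z) (tensor_map_spec h)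
  rwa [hl, hr] at this

end Tensor

section FamTensor

variable {C : Type u} [Category.{v} C] {D : Type u'} [Category.{v'} D] [MonoidalCategory D]
  [SymmetricCategory D] (A A' : C ⥤ D)

/-- The functor `X ↦ ⨂ᵢ A(Xᵢ)` on finite families. -/
noncomputable abbrev famTensor : FinFam C ⥤ D := mapFunctor A ⋙ tensor

/-- The comparison `⨂ᵢ A(Xᵢ) ⊗ ⨂ⱼ A(Yⱼ) ⟶ ⨂ₖ A((X ⊔ Y)ₖ)`. -/
noncomputable def famμ (X Y : FinFam C) :
    (famTensor A).obj X ⊗ (famTensor A).obj Y ⟶ (famTensor A).obj (sum X Y) :=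
  tensorSum (fun i => A.obj ((sum X Y).obj i))

instance (X Y : FinFam C) : IsIso (famμ A X Y) := isIso_tensorSum _

theorem famμ_spec (X Y : FinFam C) :
    Tr2 (FamMap.incl (fun i => A.obj ((sum X Y).obj i)) Sum.inl)
      (FamMap.incl (fun i => A.obj ((sum X Y).obj i)) Sum.inr) (l := Finset.univ.toList)
      (l' := Finset.univ.toList) (n := Finset.univ.toList) (famμ A X Y) :=
  tensorSum_spec _

theorem famμ_natural {X Y X' Y' : FinFam C} (f : X ⟶ X') (g : Y ⟶ Y') :
    ((famTensor A).map f ⊗ₘ (famTensor A).map g) ≫ famμ A X' Y' =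
      famμ A X Y ≫ (famTensor A).map (sumMap f g) := by
  refine tensorSum_natural (Z := fun i => A.obj ((sum X Y).obj i))
    (Z' := fun i => A.obj ((sum X' Y').obj i)) ((mapFunctor A).map f) ((mapFunctor A).map g)
    ((mapFunctor A).map (sumMap f g)) ?_ ?_
  · exact FamMap.ext_of_app fun i => ⟨rfl, (Category.comp_id _).trans
      ((Category.id_comp (A.map (f.app i))).trans (Category.comp_id (A.map (f.app i))).symm)⟩
  · exact FamMap.ext_of_app fun i => ⟨rfl, (Category.comp_id _).trans
      ((Category.id_comp (A.map (g.app i))).trans (Category.comp_id (A.map (g.app i))).symm)⟩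

variable {A A'} in
/-- Morphisms `A(Xᵢ) ⟶ A'(Xᵢ)`, not necessarily natural, induce a morphism of tensor products. -/
noncomputable abbrev famApp (t : ∀ a, A.obj a ⟶ A'.obj a) (X : FinFam C) :
    (famTensor A).obj X ⟶ (famTensor A').obj X :=
  tensor.map (homMk fun i => t (X.obj i))

variable {A A'} in
theorem famApp_comp {A'' : C ⥤ D} (t : ∀ a, A.obj a ⟶ A'.obj a)
    (t' : ∀ a, A'.obj a ⟶ A''.obj a) (X : FinFam C) :
    famApp t X ≫ famApp t' X = famApp (A := A) (A' := A'') (fun a => t a ≫ t' a) X :=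
  (tensor.map_comp _ _).symm.trans rfl

variable {A A'} in
theorem famμ_app (t : ∀ a, A.obj a ⟶ A'.obj a) (X Y : FinFam C) :
    (famApp t X ⊗ₘ famApp t Y) ≫ famμ A' X Y = famμ A X Y ≫ famApp t (sum X Y) := by
  refine tensorSum_natural (Z := fun i => A.obj ((sum X Y).obj i))
    (Z' := fun i => A'.obj ((sum X Y).obj i)) (homMk fun i => t (X.obj i))
    (homMk fun i => t (Y.obj i)) (homMk fun i => t ((sum X Y).obj i)) ?_ ?_
  · exact FamMap.ext_of_app fun i => ⟨rfl, (Category.comp_id _).trans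
      ((Category.id_comp (t (X.obj i))).trans (Category.comp_id (t (X.obj i))).symm)⟩
  · exact FamMap.ext_of_app fun i => ⟨rfl, (Category.comp_id _).trans
      ((Category.id_comp (t (Y.obj i))).trans (Category.comp_id (t (Y.obj i))).symm)⟩

variable {A A'} in
theorem famApp_natural (t : A ⟶ A') {X Y : FinFam C} (f : X ⟶ Y) :
    (famTensor A).map f ≫ famApp t.app Y = famApp t.app X ≫ (famTensor A').map f := by
  refine (tensor.map_comp _ _).symm.trans (Eq.trans (congrArg tensor.map ?_) (tensor.map_comp _ _))
  exact FinFam.Hom.ext rfl (heq_of_eq (funext fun i => t.naturality (f.app i)))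

theorem Tr2.congr {ι ι' κ : Type} {X : ι → D} {X' : ι' → D} {Y : κ → D} {f f' : FamMap X Y}
    {g g' : FamMap X' Y} (hf : f = f') (hg : g = g') {l : List ι} {l' : List ι'} {n : List κ}
    {φ : listTensor X l ⊗ listTensor X' l' ⟶ listTensor Y n} (h : Tr2 f g φ) : Tr2 f' g' φ := by
  rwa [← hf, ← hg]

theorem Tr3.congr {ι κ ξ μ : Type} {X : ι → D} {Y : κ → D} {W : ξ → D} {Z : μ → D}
    {f f' : FamMap X Z} {g g' : FamMap Y Z} {h h' : FamMap W Z} (hf : f = f') (hg : g = g')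
    (hh : h = h') {l : List ι} {l' : List κ} {l'' : List ξ} {n : List μ}
    {φ : (listTensor X l ⊗ listTensor Y l') ⊗ listTensor W l'' ⟶ listTensor Z n}
    (h₁ : Tr3 f g h φ) : Tr3 f' g' h' φ := by
  rwa [← hf, ← hg, ← hh]

theorem id_comp_map_id (X : C) : 𝟙 (A.obj X) ≫ A.map (𝟙 X) = 𝟙 _ := by simp

theorem id_comp_id_comp_map_id (X : C) : 𝟙 (A.obj X) ≫ 𝟙 (A.obj X) ≫ A.map (𝟙 X) = 𝟙 _ := by
  simp

theorem famμ_braid (X Y : FinFam C) :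
    (β_ _ _).hom ≫ famμ A Y X = famμ A X Y ≫ (famTensor A).map (sumComm X Y) := by
  refine Tr2.unique (Finset.nodup_toList _) (famμ_spec A Y X).braid ?_
  refine Tr2.congr ?_ ?_
    (Tr2.comp (famμ_spec A X Y) (tensor_map_spec ((mapFunctor A).map (sumComm X Y))))
  · refine FamMap.ext_of_app fun i => ⟨rfl, ?_⟩
    exact (Category.comp_id _).trans (id_comp_map_id A (X.obj i))
  · refine FamMap.ext_of_app fun i => ⟨rfl, ?_⟩
    exact (Category.comp_id _).trans (id_comp_map_id A (Y.obj i))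

theorem famμ_assoc (X Y Z : FinFam C) :
    (famμ A X Y ▷ (famTensor A).obj Z) ≫ famμ A (sum X Y) Z ≫ (famTensor A).map (sumAssoc X Y Z) =
      (α_ _ _ _).hom ≫ ((famTensor A).obj X ◁ famμ A Y Z) ≫ famμ A X (sum Y Z) := by
  refine Tr3.unique (Finset.nodup_toList _) ?_
    (Tr3.of_right (famμ_spec A Y Z) (famμ_spec A X (sum Y Z)))
  have h1 := Tr2.comp (famμ_spec A (sum X Y) Z)
    (tensor_map_spec ((mapFunctor A).map (sumAssoc X Y Z)))
  refine Tr3.congr ?_ ?_ ?_ (Tr3.of_left (famμ_spec A X Y) h1)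
  · refine FamMap.ext_of_app fun i => ⟨rfl, ?_⟩
    exact (Category.comp_id _).trans (id_comp_id_comp_map_id A (X.obj i))
  · refine FamMap.ext_of_app fun i => ⟨rfl, ?_⟩
    exact (Category.comp_id _).trans
      ((id_comp_id_comp_map_id A (Y.obj i)).trans (Category.comp_id _).symm)
  · refine FamMap.ext_of_app fun i => ⟨rfl, ?_⟩
    exact (Category.comp_id _).trans ((id_comp_map_id A (Z.obj i)).trans (Category.comp_id _).symm)

theorem perm_toList_empty : List.Perm ([] : List (empty C).ι) Finset.univ.toList := by
  rw [List.perm_ext_iff_of_nodup List.nodup_nil (Finset.nodup_toList _)]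
  exact fun i => (i : Empty).elim

/-- The comparison between the unit object and the tensor product of the empty family. -/
noncomputable def famε : 𝟙_ D ⟶ (famTensor A).obj (empty C) :=
  reorder (fun i => A.obj ((empty C).obj i)) (perm_toList_empty (C := C))

instance : IsIso (famε A) := (reorder_spec _ _).isIso

/-- A reordering is given by the identity map of families. -/
theorem Tr1.refl {ι : Type} {X : ι → D} {l l' : List ι} {q : listTensor X l ⟶ listTensor X l'}
    (hq : IsReorder X l l' q) : Tr1 (FamMap.id X) q := by
  have h := listMap_id X l
  have : ∀ (n : List ι) (_ : n = l) (f : listTensor X l ⟶ listTensor X n)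
      (_ : HEq f (𝟙 (listTensor X l))), ∃ q', IsReorder X n l' q' ∧ q = f ≫ q' := by
    rintro _ rfl f hf
    obtain rfl := eq_of_heq hf
    exact ⟨q, hq, (Category.id_comp _).symm⟩
  exact this _ (List.map_id l) _ h

theorem famε_spec : Tr1 (FamMap.id (fun i => A.obj ((empty C).obj i))) (l := [])
    (n := Finset.univ.toList) (famε A) :=
  Tr1.refl (reorder_spec _ _)

theorem id_comp_famMap {ι κ : Type} {X : ι → D} {Y : κ → D} (f : FamMap X Y) :
    (FamMap.id X).comp f = f :=
  FamMap.ext_of_app fun _ => ⟨rfl, (Category.comp_id _).trans (Category.id_comp _)⟩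

theorem famμ_empty_left (X : FinFam C) :
    (famε A ▷ (famTensor A).obj X) ≫ famμ A (empty C) X ≫ (famTensor A).map (emptySum X) =
      (λ_ _).hom := by
  have h1 := Tr2.comp (famμ_spec A (empty C) X) (tensor_map_spec ((mapFunctor A).map (emptySum X)))
  have h2 := Tr2.precomp (famε_spec A) (Tr1.refl (.refl (fun i => A.obj (X.obj i)) _)) h1
  refine Tr2.unique (Finset.nodup_toList _) (X := fun i => A.obj ((empty C).obj i))
    (X' := fun i => A.obj (X.obj i)) (Y := fun i => A.obj (X.obj i))
    (l := ([] : List Empty)) (n := Finset.univ.toList)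
    (l' := Finset.univ.toList) (f := ⟨Empty.elim, fun i => i.elim⟩)
    (g := FamMap.id (fun i => A.obj (X.obj i))) ?_ ?_
  · rw [← tensorHom_id]
    refine Tr2.congr ?_ ?_ h2
    · exact FamMap.ext_of_app fun i => (i : Empty).elim
    · refine FamMap.ext_of_app fun i => ⟨rfl, ?_⟩
      exact (Category.comp_id _).trans (id_comp_id_comp_map_id A (X.obj i))
  · obtain ⟨q, hq1, hq2⟩ := Tr1.refl
      (.refl (fun i => A.obj (X.obj i)) (Finset.univ : Finset X.ι).toList)
    refine ⟨q, hq1, ?_⟩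
    have : ∀ {L M : D} (f : L ⟶ M) (q : M ⟶ L), 𝟙 _ = f ≫ q →
        (λ_ L).hom = (𝟙 (𝟙_ D) ⊗ₘ f) ≫ (λ_ M).hom ≫ q := by
      intro L M f q h
      rw [id_tensorHom, leftUnitor_naturality_assoc, ← h, Category.comp_id]
    exact this _ _ hq2

theorem perm_toList_unit : List.Perm [()] (Finset.univ : Finset Unit).toList := by
  rw [List.perm_ext_iff_of_nodup (List.nodup_singleton _) (Finset.nodup_toList _)]
  simp

/-- The comparison between an object and the tensor product of the family with this member. -/
noncomputable def tensorOne (X : Unit → D) : X () ⟶ tensor.obj ⟨Unit, X⟩ :=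
  (ρ_ (X ())).inv ≫ reorder X perm_toList_unit

instance isIso_tensorOne (X : Unit → D) : IsIso (tensorOne X) := by
  have := (reorder_spec X perm_toList_unit).isIso
  exact IsIso.comp_isIso' inferInstance this

theorem tensorOne_natural {X Y : Unit → D} (f : ∀ i, X i ⟶ Y i) :
    tensorOne X ≫ tensor.map (homMk f) = f () ≫ tensorOne Y := by
  have h1 := Tr1.comp (Tr1.refl (reorder_spec X perm_toList_unit)) (tensor_map_spec (homMk f))
  have h2 : Tr1 (Hom.toFamMap (homMk f)) (l := [()]) (n := Finset.univ.toList)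
      ((f () ▷ 𝟙_ D) ≫ reorder Y perm_toList_unit) :=
    ⟨_, reorder_spec _ _, congrArg (· ≫ _) (tensorHom_id _ _).symm⟩
  have h3 := Tr1.unique (Finset.nodup_toList _) ((id_comp_famMap (Hom.toFamMap (homMk f))) ▸ h1) h2
  have h4 := rightUnitor_inv_naturality (f ())
  calc _ = (ρ_ (X ())).inv ≫ (f () ▷ 𝟙_ D) ≫ reorder Y perm_toList_unit :=
        (Category.assoc _ _ _).trans (congrArg (_ ≫ ·) h3)
    _ = _ := (Category.assoc _ _ _).symm.trans ((congrArg (· ≫ _) h4.symm).trans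
        (Category.assoc _ _ _))

/-- The comparison between `A(a)` and the tensor product of the family with this member. -/
noncomputable abbrev famOne (a : C) : A.obj a ⟶ (famTensor A).obj (single a) :=
  tensorOne (fun _ => A.obj a)

variable {A A'} in
theorem famOne_app (t : ∀ a, A.obj a ⟶ A'.obj a) (a : C) :
    famOne A a ≫ famApp t (single a) = t a ≫ famOne A' a :=
  tensorOne_natural _

theorem famOne_natural {a b : C} (f : a ⟶ b) :
    famOne A a ≫ (famTensor A).map (singleMap f) = A.map f ≫ famOne A b :=
  tensorOne_natural _

end FamTensor

/-! ### Compatibility with strong monoidal functors -/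

section Comparison

open Functor.LaxMonoidal

variable {C : Type u} [Category.{v} C] [MonoidalCategory C] [SymmetricCategory C]
  {D : Type u'} [Category.{v'} D] [MonoidalCategory D] [SymmetricCategory D] (F : C ⥤ D)
  [F.Braided]

theorem isIso_listComparison {ι : Type} (X : ι → C) (l : List ι) :
    IsIso (listComparison F X l) := by
  induction l with
  | nil => exact inferInstanceAs (IsIso (ε F))
  | cons a l ih =>
    exact inferInstanceAs
      (IsIso ((F.obj (X a) ◁ listComparison F X l) ≫ μ F (X a) (listTensor X l)))

instance (X : FinFam C) : IsIso ((comparison F).app X) := isIso_listComparison F _ _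

/-- The comparison of a strong monoidal functor with tensor products along lists is compatible with
concatenation. -/
theorem listComparison_append {ι : Type} (X : ι → C) (l l' : List ι) :
    (listComparison F X l ⊗ₘ listComparison F X l') ≫ μ F _ _ ≫ F.map (listAppend X l l') =
      listAppend (fun i => F.obj (X i)) l l' ≫ listComparison F X (l ++ l') := by
  induction l with
  | nil =>
    have : ∀ {L : C} {M : D} (f : M ⟶ F.obj L), (ε F ⊗ₘ f) ≫ μ F (𝟙_ C) L ≫ F.map (λ_ L).hom =
        (λ_ M).hom ≫ f := by
      intro L M f
      rw [MonoidalCategory.tensorHom_def', Category.assoc, ← left_unitality, leftUnitor_naturality]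
    exact this _
  | cons a l ih =>
    have : ∀ {A L L' M : C} {N N' K : D} {f : N ⟶ F.obj L} {f' : N' ⟶ F.obj L'} {g : L ⊗ L' ⟶ M}
        {a : N ⊗ N' ⟶ K} {h : K ⟶ F.obj M},
        (f ⊗ₘ f') ≫ μ F L L' ≫ F.map g = a ≫ h →
        (((F.obj A ◁ f) ≫ μ F A L) ⊗ₘ f') ≫ μ F (A ⊗ L) L' ≫
          F.map ((α_ A L L').hom ≫ A ◁ g) = ((α_ (F.obj A) N N').hom ≫ F.obj A ◁ a) ≫
            (F.obj A ◁ h) ≫ μ F A M := by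
      intro A L L' M N N' K f f' g a h hh
      rw [Category.assoc, ← whiskerLeft_comp_assoc, ← hh, F.map_comp]
      have h1 : (((F.obj A ◁ f) ≫ μ F A L) ⊗ₘ f') =
          ((F.obj A ◁ f) ⊗ₘ f') ≫ (μ F A L ▷ F.obj L') := by
        rw [← tensorHom_id, tensorHom_comp_tensorHom, Category.comp_id]
      rw [h1, Category.assoc, associativity_assoc]
      simp only [whiskerLeft_comp, Category.assoc, μ_natural_right]
      have h2 : ((F.obj A ◁ f) ⊗ₘ f') ≫ (α_ _ _ _).hom =
          (α_ _ _ _).hom ≫ F.obj A ◁ (f ⊗ₘ f') := by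
        rw [← id_tensorHom, ← id_tensorHom, associator_naturality]
      rw [reassoc_of% h2]
    exact this ih

theorem tensorSum_comparison {ι κ : Type} [Fintype ι] [Fintype κ] (Z : ι ⊕ κ → C) :
    ((comparison F).app ⟨ι, fun i => Z (Sum.inl i)⟩ ⊗ₘ
        (comparison F).app ⟨κ, fun i => Z (Sum.inr i)⟩) ≫ μ F _ _ ≫ F.map (tensorSum Z) =
      tensorSum (fun i => F.obj (Z i)) ≫ (comparison F).app ⟨ι ⊕ κ, Z⟩ := by
  have h1 := listComparison_map F Sum.inl (fun i => 𝟙 (Z (Sum.inl i)))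
    (Finset.univ : Finset ι).toList
  have h2 := listComparison_map F Sum.inr (fun i => 𝟙 (Z (Sum.inr i)))
    (Finset.univ : Finset κ).toList
  obtain ⟨q, hq1, hq2⟩ := (reorder_spec Z (perm_toList_sum (ι := ι) (κ := κ))).comparison F
  have h3 : IsReorder (fun i => F.obj (Z i)) _ _ _ :=
    reorder_spec (fun i => F.obj (Z i)) (perm_toList_sum (ι := ι) (κ := κ))
  rw [hq1.unique ((perm_toList_sum (ι := ι) (κ := κ)).nodup_iff.2 (Finset.nodup_toList _))
    h3] at hq2
  have h4 := listComparison_append F Z ((Finset.univ : Finset ι).toList.map Sum.inl)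
    ((Finset.univ : Finset κ).toList.map Sum.inr)
  have h5 : ∀ i, F.map (𝟙 (Z (Sum.inl i))) = 𝟙 _ := fun i => F.map_id _
  have h6 : ∀ i, F.map (𝟙 (Z (Sum.inr i))) = 𝟙 _ := fun i => F.map_id _
  simp only [h5] at h1
  simp only [h6] at h2
  calc _ = ((listComparison F _ _ ⊗ₘ listComparison F _ _) ≫
        (F.map (listMap Sum.inl (fun i => 𝟙 (Z (Sum.inl i))) (Finset.univ : Finset ι).toList) ⊗ₘ
        F.map (listMap Sum.inr (fun i => 𝟙 (Z (Sum.inr i))) (Finset.univ : Finset κ).toList))) ≫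
        μ F _ _ ≫ F.map (listAppend Z _ _) ≫ F.map (reorder Z perm_toList_sum) := by
        rw [Category.assoc, μ_natural_assoc, ← F.map_comp, ← F.map_comp]
        rfl
    _ = _ := by
        rw [tensorHom_comp_tensorHom, ← h1, ← h2, ← tensorHom_comp_tensorHom, Category.assoc,
          reassoc_of% h4, ← hq2]
        refine Eq.trans ?_ (Category.assoc _ _ _).symm
        refine congrArg (_ ≫ ·) ?_
        exact (Category.assoc _ _ _).symm

variable {B : Type*} [Category* B] (A : B ⥤ C)

theorem famμ_comparison (X Y : FinFam B) :
    ((comparison F).app ((mapFunctor A).obj X) ⊗ₘ (comparison F).app ((mapFunctor A).obj Y)) ≫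
        μ F _ _ ≫ F.map (famμ A X Y) =
      famμ (A ⋙ F) X Y ≫ (comparison F).app ((mapFunctor A).obj (sum X Y)) :=
  tensorSum_comparison F (fun i => A.obj ((sum X Y).obj i))

theorem famε_comparison :
    famε (A ⋙ F) ≫ (comparison F).app ((mapFunctor A).obj (empty B)) =
      ε F ≫ F.map (famε A) := by
  obtain ⟨q, hq1, hq2⟩ := (reorder_spec (fun i => A.obj ((empty B).obj i))
    (perm_toList_empty (C := B))).comparison F
  rw [hq1.unique List.nodup_nil (reorder_spec _ _)] at hq2
  exact hq2

theorem tensorOne_comparison (X : Unit → C) :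
    tensorOne (fun i => F.obj (X i)) ≫ (comparison F).app ⟨Unit, X⟩ = F.map (tensorOne X) := by
  obtain ⟨q, hq1, hq2⟩ := (reorder_spec X perm_toList_unit).comparison F
  rw [hq1.unique (List.nodup_singleton _) (reorder_spec _ perm_toList_unit)] at hq2
  have h : (ρ_ (F.obj (X ()))).inv ≫ (F.obj (X ()) ◁ ε F) ≫ μ F (X ()) (𝟙_ C) =
      F.map (ρ_ (X ())).inv := by
    rw [← cancel_mono (F.map (ρ_ (X ())).hom), ← F.map_comp]
    simp
  calc _ = (ρ_ (F.obj (X ()))).inv ≫ ((F.obj (X ()) ◁ ε F) ≫ μ F (X ()) (𝟙_ C)) ≫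
        F.map (reorder X perm_toList_unit) :=
        (Category.assoc _ _ _).trans (congrArg (_ ≫ ·) hq2)
    _ = F.map (ρ_ (X ())).inv ≫ F.map (reorder X perm_toList_unit) := by
        rw [← Category.assoc, h]
    _ = _ := (F.map_comp _ _).symm

theorem famOne_comparison (a : B) :
    famOne (A ⋙ F) a ≫ (comparison F).app ((mapFunctor A).obj (single a)) =
      F.map (famOne A a) :=
  tensorOne_comparison F _

end Comparison

end FinFam

/-! ### Components of disjoint unions of graphs -/

namespace Graph

open FinFam

/-- The index of the member of a family of graphs to which a vertex of the disjoint union along a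
list belongs. -/
def listIndex {ι : Type} (X : ι → Graph) : (l : List ι) → (listTensor X l).Vertex → ι
  | [] => Empty.elim
  | a :: l => Sum.elim (fun _ => a) (listIndex X l)

/-- Reordering the factors does not change the index of a vertex. -/
theorem listIndex_reorder {ι : Type} {X : ι → Graph} {l l' : List ι}
    {p : listTensor X l ⟶ listTensor X l'} (hp : IsReorder X l l' p) (v : (listTensor X l).Vertex) :
    listIndex X l' (p.vertex v) = listIndex X l v := by
  induction hp with
  | nil => exact Empty.elim v
  | cons a _ ih =>
    rcases v with v | v
    · rfl
    · exact ih v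
  | swap a b l => rcases v with v | v | v <;> rfl
  | trans _ _ ih ih' => exact (ih' _).trans (ih _)

theorem listIndex_listMap {ι κ : Type} {X : ι → Graph} {Y : κ → Graph} (e : ι → κ)
    (f : ∀ i, X i ⟶ Y (e i)) (l : List ι) (v : (listTensor X l).Vertex) :
    listIndex Y (l.map e) ((listMap e f l).vertex v) = e (listIndex X l v) := by
  induction l with
  | nil => exact Empty.elim v
  | cons a l ih =>
    rcases v with v | v
    · rfl
    · exact ih v

theorem listIndex_append_inl {ι : Type} (X : ι → Graph) (l l' : List ι)
    (v : (listTensor X l).Vertex) :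
    listIndex X (l ++ l') ((listAppend X l l').vertex (Sum.inl v)) = listIndex X l v := by
  induction l with
  | nil => exact Empty.elim v
  | cons a l ih =>
    rcases v with v | v
    · rfl
    · exact ih v

theorem listIndex_append_inr {ι : Type} (X : ι → Graph) (l l' : List ι)
    (v : (listTensor X l').Vertex) :
    listIndex X (l ++ l') ((listAppend X l l').vertex (Sum.inr v)) = listIndex X l' v := by
  induction l with
  | nil => rfl
  | cons a l ih => exact ih

theorem exists_listIndex {ι : Type} (X : ι → Graph) (h : ∀ i, Nonempty (X i).Vertex) (l : List ι)
    {i : ι} (hi : i ∈ l) : ∃ v, listIndex X l v = i := by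
  induction l with
  | nil => simp at hi
  | cons a l ih =>
    rcases List.mem_cons.1 hi with rfl | hi
    · obtain ⟨v⟩ := h i
      exact ⟨Sum.inl v, rfl⟩
    · obtain ⟨v, hv⟩ := ih hi
      exact ⟨Sum.inr v, hv⟩

/-- The index of the member of a family of graphs to which a vertex of the disjoint union
belongs. -/
noncomputable def index (X : FinFam Graph) : (FinFam.tensor.obj X).Vertex → X.ι :=
  listIndex X.obj Finset.univ.toList

theorem index_map {X Y : FinFam Graph} (f : X ⟶ Y) (v : (FinFam.tensor.obj X).Vertex) :
    index Y ((FinFam.tensor.map f).vertex v) = FinFam.Hom.e f (index X v) :=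
  (listIndex_reorder (reorder_spec _ _) _).trans (listIndex_listMap _ _ _ _)

theorem index_tensorSum_inl {ι κ : Type} [Fintype ι] [Fintype κ] (Z : ι ⊕ κ → Graph)
    (v : (FinFam.tensor.obj ⟨ι, fun i => Z (Sum.inl i)⟩).Vertex) :
    index ⟨ι ⊕ κ, Z⟩ ((tensorSum Z).vertex (Sum.inl v)) =
      Sum.inl (index ⟨ι, fun i => Z (Sum.inl i)⟩ v) :=
  (listIndex_reorder (reorder_spec _ _) _).trans ((listIndex_append_inl Z _ _ _).trans
    (listIndex_listMap _ _ _ _))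

theorem index_tensorSum_inr {ι κ : Type} [Fintype ι] [Fintype κ] (Z : ι ⊕ κ → Graph)
    (v : (FinFam.tensor.obj ⟨κ, fun i => Z (Sum.inr i)⟩).Vertex) :
    index ⟨ι ⊕ κ, Z⟩ ((tensorSum Z).vertex (Sum.inr v)) =
      Sum.inr (index ⟨κ, fun i => Z (Sum.inr i)⟩ v) :=
  (listIndex_reorder (reorder_spec _ _) _).trans ((listIndex_append_inr Z _ _ _).trans
    (listIndex_listMap _ _ _ _))

theorem exists_index (X : FinFam Graph) (h : ∀ i, Nonempty (X.obj i).Vertex) (i : X.ι) :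
    ∃ v, index X v = i :=
  exists_listIndex X.obj h _ (by simp)

theorem iso_bijective {x y : Graph} (b : x ⟶ y) [IsIso b] :
    Function.Bijective b.flag ∧ Function.Bijective b.vertex := by
  refine ⟨⟨b.flag_injective, fun f => ⟨(CategoryTheory.inv b).flag f, ?_⟩⟩,
    ⟨?_, b.vertex_surjective⟩⟩
  · rw [← Graph.comp_flag, IsIso.hom_inv_id]; rfl
  · refine Function.LeftInverse.injective (g := (CategoryTheory.inv b).vertex) fun w => ?_
    rw [← Graph.comp_vertex, IsIso.hom_inv_id]; rfl

/-- Morphisms of graphs can be recovered from their disjoint union. -/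
theorem sumMap_injective {τ σ τ' σ' : Graph} {h g : τ ⟶ σ} {h' g' : τ' ⟶ σ'}
    (e : (h ⊗ₘ h' : τ ⊗ τ' ⟶ σ ⊗ σ') = g ⊗ₘ g') : h = g ∧ h' = g' := by
  have h1 : ∀ f : σ.Flag ⊕ σ'.Flag, Sum.map h.flag h'.flag f = Sum.map g.flag g'.flag f :=
    congrFun (congrArg Hom.flag e)
  have h2 : ∀ f : τ.Vertex ⊕ τ'.Vertex, Sum.map h.vertex h'.vertex f =
      Sum.map g.vertex g'.vertex f := congrFun (congrArg Hom.vertex e)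
  have h3 : ∀ f : τ.Flag ⊕ τ'.Flag, Sum.map h.pair h'.pair f = Sum.map g.pair g'.pair f :=
    congrFun (congrArg Hom.pair e)
  exact ⟨hom_ext (fun f => Sum.inl_injective (h1 (Sum.inl f)))
    (fun f => Sum.inl_injective (h2 (Sum.inl f))) (fun f => Sum.inl_injective (h3 (Sum.inl f))),
    hom_ext (fun f => Sum.inr_injective (h1 (Sum.inr f)))
    (fun f => Sum.inr_injective (h2 (Sum.inr f))) (fun f => Sum.inr_injective (h3 (Sum.inr f)))⟩

/-- A morphism of graphs with bijective flag and vertex maps is a monomorphism: it contracts nothing,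
so that the virtual edges of a composite with it are those of the first factor. -/
theorem cancel_of_bijective {τ σ ρ : Graph} {r r' : τ ⟶ σ} {g : σ ⟶ ρ}
    (hf : Function.Bijective g.flag) (hv : Function.Bijective g.vertex) (h : r ≫ g = r' ≫ g) :
    r = r' := by
  have h1 : ∀ f, r.flag f = r'.flag f := fun f => by
    obtain ⟨f, rfl⟩ := hf.2 f
    exact congrFun (congrArg Hom.flag h) f
  have hp : ∀ (s : τ ⟶ σ) f, (s ≫ g).pair f = s.pair f := by
    intro s f
    by_cases hs : f ∈ Set.range s.flag
    · obtain ⟨f, rfl⟩ := hs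
      obtain ⟨f, rfl⟩ := hf.2 f
      exact (compPair_flag s g _).trans ((congrArg s.flag (g.pair_flag f)).trans
        (s.pair_flag _).symm)
    · exact compPair_of_not_mem _ _ hs
  refine hom_ext h1 (fun v => hv.1 (congrFun (congrArg Hom.vertex h) v)) fun f => ?_
  rw [← hp r, ← hp r', h]

end Graph

/-! ### Disjoint unions of corollas in a graph category -/

section GraphCat

open FinFam Functor.LaxMonoidal Functor.OplaxMonoidal Functor.Monoidal

variable {Γ : Type u} [Category.{v} Γ] (ψ : Γ ⥤ Graph)

theorem IsGrafting.of_isIso {τ σ : Γ} (h : τ ⟶ σ) [IsIso h] : IsGrafting ψ h :=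
  Graph.iso_bijective (ψ.map h)

variable {ψ} in
theorem IsGrafting.comp {τ σ ρ : Γ} {h : τ ⟶ σ} {g : σ ⟶ ρ} (hh : IsGrafting ψ h)
    (hg : IsGrafting ψ g) : IsGrafting ψ (h ≫ g) := by
  rw [IsGrafting, ψ.map_comp]
  exact ⟨hh.1.comp hg.1, hg.2.comp hh.2⟩

variable [MonoidalCategory Γ] [SymmetricCategory Γ] [ψ.Braided]

variable {ψ} in
theorem IsGrafting.tensor {τ σ τ' σ' : Γ} {h : τ ⟶ σ} {h' : τ' ⟶ σ'} (hh : IsGrafting ψ h)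
    (hh' : IsGrafting ψ h') : IsGrafting ψ (h ⊗ₘ h') := by
  have h1 : ψ.map (h ⊗ₘ h') = δ ψ τ τ' ≫ (ψ.map h ⊗ₘ ψ.map h') ≫ μ ψ σ σ' := by
    rw [μ_natural, δ_μ_assoc]
  obtain ⟨h2, h3⟩ := Graph.iso_bijective (δ ψ τ τ')
  obtain ⟨h4, h5⟩ := Graph.iso_bijective (μ ψ σ σ')
  rw [IsGrafting, h1]
  have h6 : Function.Bijective (ψ.map h ⊗ₘ ψ.map h').flag :=
    Function.Bijective.sumMap hh.1 hh'.1
  have h7 : Function.Bijective (ψ.map h ⊗ₘ ψ.map h').vertex :=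
    Function.Bijective.sumMap hh.2 hh'.2
  exact ⟨h2.comp (h6.comp h4), (h5.comp h7).comp h3⟩

/-- In a graph category, too, morphisms can be recovered from their disjoint union. -/
theorem tensor_injective [ψ.Faithful] {τ σ τ' σ' : Γ} {h g : τ ⟶ σ} {h' g' : τ' ⟶ σ'}
    (e : h ⊗ₘ h' = g ⊗ₘ g') : h = g ∧ h' = g' := by
  have h1 : ψ.map h ⊗ₘ ψ.map h' = ψ.map g ⊗ₘ ψ.map g' := by
    rw [← cancel_mono (μ ψ σ σ'), μ_natural, μ_natural, e]
  obtain ⟨h2, h3⟩ := Graph.sumMap_injective h1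
  exact ⟨ψ.map_injective h2, ψ.map_injective h3⟩

/-- The isomorphism `∐ X ⊔ ∐ Y ≅ ∐ (X ⊔ Y)` for families of corollas. -/
noncomputable def corμ (X Y : FinFam (Cor ψ)) :
    (corUnion ψ).obj X ⊗ (corUnion ψ).obj Y ⟶ (corUnion ψ).obj (sum X Y) :=
  famμ (corInclusion ψ) X Y

instance (X Y : FinFam (Cor ψ)) : IsIso (corμ ψ X Y) :=
  inferInstanceAs (IsIso (famμ (corInclusion ψ) X Y))

/-- The isomorphism between the unit object and the empty union. -/
noncomputable def corε : 𝟙_ Γ ⟶ (corUnion ψ).obj (empty (Cor ψ)) :=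
  famε (corInclusion ψ)

instance : IsIso (corε ψ) := inferInstanceAs (IsIso (famε (corInclusion ψ)))

theorem corμ_natural {X Y X' Y' : FinFam (Cor ψ)} (f : X ⟶ X') (g : Y ⟶ Y') :
    ((corUnion ψ).map f ⊗ₘ (corUnion ψ).map g) ≫ corμ ψ X' Y' =
      corμ ψ X Y ≫ (corUnion ψ).map (sumMap f g) :=
  famμ_natural _ f g

/-- The index of the corolla of a family to which a vertex of the disjoint union belongs. -/
noncomputable def corIndex (X : FinFam (Cor ψ)) (v : (ψ.obj ((corUnion ψ).obj X)).Vertex) : X.ι :=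
  Graph.index ((mapFunctor (corInclusion ψ) ⋙ mapFunctor ψ).obj X)
    ((inv ((comparison ψ).app ((mapFunctor (corInclusion ψ)).obj X))).vertex v)

theorem corIndex_comparison (X : FinFam (Cor ψ))
    (v : (FinFam.tensor.obj ((mapFunctor (corInclusion ψ) ⋙ mapFunctor ψ).obj X)).Vertex) :
    corIndex ψ X (((comparison ψ).app ((mapFunctor (corInclusion ψ)).obj X)).vertex v) =
      Graph.index ((mapFunctor (corInclusion ψ) ⋙ mapFunctor ψ).obj X) v := by
  refine congrArg (Graph.index _) ?_
  exact congrFun (congrArg Graph.Hom.vertex (IsIso.hom_inv_id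
    ((comparison ψ).app ((mapFunctor (corInclusion ψ)).obj X)))) v

theorem exists_comparison_vertex (X : FinFam (Cor ψ)) (v : (ψ.obj ((corUnion ψ).obj X)).Vertex) :
    ∃ w : (FinFam.tensor.obj ((mapFunctor (corInclusion ψ) ⋙ mapFunctor ψ).obj X)).Vertex,
      ((comparison ψ).app ((mapFunctor (corInclusion ψ)).obj X)).vertex w = v :=
  ((comparison ψ).app ((mapFunctor (corInclusion ψ)).obj X)).vertex_surjective v

theorem corIndex_map {X Y : FinFam (Cor ψ)} (f : X ⟶ Y)
    (v : (ψ.obj ((corUnion ψ).obj X)).Vertex) :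
    corIndex ψ Y ((ψ.map ((corUnion ψ).map f)).vertex v) = FinFam.Hom.e f (corIndex ψ X v) := by
  obtain ⟨w, rfl⟩ := exists_comparison_vertex ψ X v
  have h := (comparison ψ).naturality ((mapFunctor (corInclusion ψ)).map f)
  have h' := congrFun (congrArg Graph.Hom.vertex h) w
  rw [corIndex_comparison]
  refine (congrArg (corIndex ψ Y) h'.symm).trans ?_
  refine (corIndex_comparison ψ Y _).trans ?_
  exact Graph.index_map _ _

/-- Every index occurs, because a corolla has a vertex. -/
theorem exists_corIndex (X : FinFam (Cor ψ)) (i : X.ι) : ∃ v, corIndex ψ X v = i := by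
  obtain ⟨v, hv⟩ := Graph.exists_index ((mapFunctor (corInclusion ψ) ⋙ mapFunctor ψ).obj X)
    (fun i => ⟨((X.obj i).of.property.1.some).default⟩) i
  exact ⟨_, (corIndex_comparison ψ X v).trans hv⟩

theorem corIndex_inl (X Y : FinFam (Cor ψ)) (v : (ψ.obj ((corUnion ψ).obj X)).Vertex) :
    corIndex ψ (sum X Y) ((ψ.map (corμ ψ X Y)).vertex
      ((μ ψ ((corUnion ψ).obj X) ((corUnion ψ).obj Y)).vertex (Sum.inl v))) =
      Sum.inl (corIndex ψ X v) := by
  obtain ⟨w, rfl⟩ := exists_comparison_vertex ψ X v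
  have h := congrFun (congrArg Graph.Hom.vertex (famμ_comparison ψ (corInclusion ψ) X Y))
    (Sum.inl w)
  refine (congrArg (corIndex ψ (sum X Y)) h).trans ?_
  refine (corIndex_comparison ψ (sum X Y) _).trans ?_
  refine (Graph.index_tensorSum_inl (fun i => ψ.obj ((corInclusion ψ).obj ((sum X Y).obj i)))
    w).trans ?_
  exact congrArg Sum.inl (corIndex_comparison ψ X w).symm

theorem corIndex_inr (X Y : FinFam (Cor ψ)) (v : (ψ.obj ((corUnion ψ).obj Y)).Vertex) :
    corIndex ψ (sum X Y) ((ψ.map (corμ ψ X Y)).vertex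
      ((μ ψ ((corUnion ψ).obj X) ((corUnion ψ).obj Y)).vertex (Sum.inr v))) =
      Sum.inr (corIndex ψ Y v) := by
  obtain ⟨w, rfl⟩ := exists_comparison_vertex ψ Y v
  have h := congrFun (congrArg Graph.Hom.vertex (famμ_comparison ψ (corInclusion ψ) X Y))
    (Sum.inr w)
  refine (congrArg (corIndex ψ (sum X Y)) h).trans ?_
  refine (corIndex_comparison ψ (sum X Y) _).trans ?_
  refine (Graph.index_tensorSum_inr (fun i => ψ.obj ((corInclusion ψ).obj ((sum X Y).obj i)))
    w).trans ?_
  exact congrArg Sum.inr (corIndex_comparison ψ Y w).symm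

/-- The morphism `∐ (X ⊔ Y) ⟶ τ ⊔ σ` given by `∐ X ⟶ τ` and `∐ Y ⟶ σ`. -/
noncomputable def corPair {X Y : FinFam (Cor ψ)} {τ σ : Γ} (r : (corUnion ψ).obj X ⟶ τ)
    (s : (corUnion ψ).obj Y ⟶ σ) : (corUnion ψ).obj (sum X Y) ⟶ τ ⊗ σ :=
  inv (corμ ψ X Y) ≫ (r ⊗ₘ s)

theorem corμ_corPair {X Y : FinFam (Cor ψ)} {τ σ : Γ} (r : (corUnion ψ).obj X ⟶ τ)
    (s : (corUnion ψ).obj Y ⟶ σ) :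
    corμ ψ X Y ≫ corPair ψ r s = r ⊗ₘ s :=
  IsIso.hom_inv_id_assoc _ _

theorem corPair_comp {X Y : FinFam (Cor ψ)} {τ σ τ' σ' : Γ} (r : (corUnion ψ).obj X ⟶ τ)
    (s : (corUnion ψ).obj Y ⟶ σ) (f : τ ⟶ τ') (g : σ ⟶ σ') :
    corPair ψ r s ≫ (f ⊗ₘ g) = corPair ψ (r ≫ f) (s ≫ g) := by
  rw [corPair, corPair, Category.assoc, tensorHom_comp_tensorHom]

theorem map_corPair {X Y X' Y' : FinFam (Cor ψ)} {τ σ : Γ} (f : X ⟶ X') (g : Y ⟶ Y')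
    (r : (corUnion ψ).obj X' ⟶ τ) (s : (corUnion ψ).obj Y' ⟶ σ) :
    (corUnion ψ).map (sumMap f g) ≫ corPair ψ r s =
      corPair ψ ((corUnion ψ).map f ≫ r) ((corUnion ψ).map g ≫ s) := by
  rw [← cancel_epi (corμ ψ X Y), corμ_corPair]
  have h := corμ_natural ψ f g
  refine (comp_assoc_of_eq h.symm (corPair ψ r s)).trans ?_
  rw [corμ_corPair]
  exact tensorHom_comp_tensorHom _ _ _ _

/-- Under the morphism `∐ (X ⊔ Y) ⟶ τ ⊔ σ` given by `∐ X ⟶ τ` and `∐ Y ⟶ σ`, vertices of the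
members of `X` are mapped to vertices of `τ`. -/
theorem corPair_vertex_inl {X Y : FinFam (Cor ψ)} {τ σ : Γ} (r : (corUnion ψ).obj X ⟶ τ)
    (s : (corUnion ψ).obj Y ⟶ σ) (v : (ψ.obj ((corUnion ψ).obj (sum X Y))).Vertex) (i : X.ι)
    (hv : corIndex ψ (sum X Y) v = Sum.inl i) :
    ∃ w, (ψ.map (corPair ψ r s)).vertex v = (μ ψ τ σ).vertex (Sum.inl w) := by
  obtain ⟨v, rfl⟩ := (ψ.map (corμ ψ X Y)).vertex_surjective v
  obtain ⟨v, rfl⟩ := (μ ψ ((corUnion ψ).obj X) ((corUnion ψ).obj Y)).vertex_surjective v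
  have h1 : (ψ.map (corPair ψ r s)).vertex ((ψ.map (corμ ψ X Y)).vertex
      ((μ ψ ((corUnion ψ).obj X) ((corUnion ψ).obj Y)).vertex v)) =
      (μ ψ τ σ).vertex (Sum.map (ψ.map r).vertex (ψ.map s).vertex v) := by
    have h : (μ ψ ((corUnion ψ).obj X) ((corUnion ψ).obj Y)) ≫ ψ.map (corμ ψ X Y) ≫
        ψ.map (corPair ψ r s) = (ψ.map r ⊗ₘ ψ.map s) ≫ μ ψ τ σ := by
      rw [← ψ.map_comp, corμ_corPair, μ_natural]
    exact congrFun (congrArg Graph.Hom.vertex h) v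
  rcases v with v | v
  · exact ⟨_, h1⟩
  · rw [corIndex_inr] at hv
    exact (Sum.inr_ne_inl hv).elim

/-- The analogue of `corPair_vertex_inl` for the second summand. -/
theorem corPair_vertex_inr {X Y : FinFam (Cor ψ)} {τ σ : Γ} (r : (corUnion ψ).obj X ⟶ τ)
    (s : (corUnion ψ).obj Y ⟶ σ) (v : (ψ.obj ((corUnion ψ).obj (sum X Y))).Vertex) (i : Y.ι)
    (hv : corIndex ψ (sum X Y) v = Sum.inr i) :
    ∃ w, (ψ.map (corPair ψ r s)).vertex v = (μ ψ τ σ).vertex (Sum.inr w) := by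
  obtain ⟨v, rfl⟩ := (ψ.map (corμ ψ X Y)).vertex_surjective v
  obtain ⟨v, rfl⟩ := (μ ψ ((corUnion ψ).obj X) ((corUnion ψ).obj Y)).vertex_surjective v
  have h1 : (ψ.map (corPair ψ r s)).vertex ((ψ.map (corμ ψ X Y)).vertex
      ((μ ψ ((corUnion ψ).obj X) ((corUnion ψ).obj Y)).vertex v)) =
      (μ ψ τ σ).vertex (Sum.map (ψ.map r).vertex (ψ.map s).vertex v) := by
    have h : (μ ψ ((corUnion ψ).obj X) ((corUnion ψ).obj Y)) ≫ ψ.map (corμ ψ X Y) ≫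
        ψ.map (corPair ψ r s) = (ψ.map r ⊗ₘ ψ.map s) ≫ μ ψ τ σ := by
      rw [← ψ.map_comp, corμ_corPair, μ_natural]
    exact congrFun (congrArg Graph.Hom.vertex h) v
  rcases v with v | v
  · rw [corIndex_inl] at hv
    exact (Sum.inl_ne_inr hv).elim
  · exact ⟨_, h1⟩

/-- A morphism between disjoint unions of families that respects the two summands is a disjoint
union of morphisms. -/
theorem FinFam.exists_sumMap {C : Type*} [Category* C] {X Y X' Y' : FinFam C}
    (e : sum X Y ⟶ sum X' Y') (hl : ∀ i, ∃ i', FinFam.Hom.e e (Sum.inl i) = Sum.inl i')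
    (hr : ∀ i, ∃ i', FinFam.Hom.e e (Sum.inr i) = Sum.inr i') :
    ∃ (f : X ⟶ X') (g : Y ⟶ Y'), e = sumMap f g := by
  choose a ha using hl
  choose b hb using hr
  have ha' : Function.Bijective a := by
    refine ⟨fun i j hij => ?_, fun i' => ?_⟩
    · have : FinFam.Hom.e e (Sum.inl i) = FinFam.Hom.e e (Sum.inl j) := by rw [ha, ha, hij]
      exact Sum.inl_injective ((FinFam.Hom.e e).injective this)
    · obtain ⟨i | i, hi⟩ := (FinFam.Hom.e e).surjective (Sum.inl i')
      · exact ⟨i, Sum.inl_injective ((ha i).symm.trans hi)⟩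
      · exact (Sum.inr_ne_inl ((hb i).symm.trans hi)).elim
  have hb' : Function.Bijective b := by
    refine ⟨fun i j hij => ?_, fun i' => ?_⟩
    · have : FinFam.Hom.e e (Sum.inr i) = FinFam.Hom.e e (Sum.inr j) := by rw [hb, hb, hij]
      exact Sum.inr_injective ((FinFam.Hom.e e).injective this)
    · obtain ⟨i | i, hi⟩ := (FinFam.Hom.e e).surjective (Sum.inr i')
      · exact (Sum.inl_ne_inr ((ha i).symm.trans hi)).elim
      · exact ⟨i, Sum.inr_injective ((hb i).symm.trans hi)⟩
  refine ⟨⟨Equiv.ofBijective a ha', fun i => FinFam.Hom.app e (Sum.inl i) ≫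
      eqToHom (congrArg (sum X' Y').obj (ha i))⟩,
    ⟨Equiv.ofBijective b hb', fun i => FinFam.Hom.app e (Sum.inr i) ≫
      eqToHom (congrArg (sum X' Y').obj (hb i))⟩, ?_⟩
  refine hom_ext_famMap (FamMap.ext_of_app ?_)
  rintro (i | i)
  · exact ⟨ha i, rfl⟩
  · exact ⟨hb i, rfl⟩

/-- A morphism over `τ ⊔ σ` between unions of families over `τ` and over `σ` splits. A member of
`X` goes to a member of `X'`, because its vertices go to vertices of `τ`. -/
theorem exists_sumMap_of_corPair [ψ.Faithful] {X Y X' Y' : FinFam (Cor ψ)} {τ σ : Γ}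
    (r : (corUnion ψ).obj X ⟶ τ) (s : (corUnion ψ).obj Y ⟶ σ) (r' : (corUnion ψ).obj X' ⟶ τ)
    (s' : (corUnion ψ).obj Y' ⟶ σ) (e : sum X Y ⟶ sum X' Y')
    (he : (corUnion ψ).map e ≫ corPair ψ r' s' = corPair ψ r s) :
    ∃ (f : X ⟶ X') (g : Y ⟶ Y'), e = sumMap f g ∧ (corUnion ψ).map f ≫ r' = r ∧
      (corUnion ψ).map g ≫ s' = s := by
  have hμ := (Graph.iso_bijective (μ ψ τ σ)).2.1
  obtain ⟨f, g, rfl⟩ : ∃ (f : X ⟶ X') (g : Y ⟶ Y'), e = sumMap f g := by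
    apply FinFam.exists_sumMap
    · intro i
      obtain ⟨v, hv⟩ := exists_corIndex ψ (sum X Y) (Sum.inl i)
      obtain ⟨w, hw⟩ := corPair_vertex_inl ψ r s v i hv
      have h1 := corIndex_map ψ e v
      rw [hv] at h1
      rcases h2 : FinFam.Hom.e e (Sum.inl i) with i' | i'
      · exact ⟨i', rfl⟩
      · rw [h2] at h1
        obtain ⟨w', hw'⟩ := corPair_vertex_inr ψ r' s' _ i' h1
        rw [← he, ψ.map_comp] at hw
        exact (Sum.inl_ne_inr (hμ (hw.symm.trans hw'))).elim
    · intro i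
      obtain ⟨v, hv⟩ := exists_corIndex ψ (sum X Y) (Sum.inr i)
      obtain ⟨w, hw⟩ := corPair_vertex_inr ψ r s v i hv
      have h1 := corIndex_map ψ e v
      rw [hv] at h1
      rcases h2 : FinFam.Hom.e e (Sum.inr i) with i' | i'
      · rw [h2] at h1
        obtain ⟨w', hw'⟩ := corPair_vertex_inl ψ r' s' _ i' h1
        rw [← he, ψ.map_comp] at hw
        exact (Sum.inr_ne_inl (hμ (hw.symm.trans hw'))).elim
      · exact ⟨i', rfl⟩
  rw [map_corPair] at he
  have h1 := congrArg (corμ ψ X Y ≫ ·) he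
  simp only [corμ_corPair] at h1
  obtain ⟨h2, h3⟩ := tensor_injective ψ h1
  exact ⟨f, g, rfl, h2, h3⟩

variable [GraphCategory ψ]

/-- The union of total graftings of `τ` and of `σ`. -/
noncomputable abbrev TotalGrafting.pair {τ σ : Γ} (d : TotalGrafting ψ τ) (d' : TotalGrafting ψ σ) :
    TotalGrafting ψ (τ ⊗ σ) where
  cor := sum d.cor d'.cor
  map := corPair ψ d.map d'.map
  isGrafting := (IsGrafting.of_isIso ψ _).comp (d.isGrafting.tensor d'.isGrafting)

variable {ψ} in
/-- The composition of a total grafting with a grafting. -/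
noncomputable abbrev TotalGrafting.comp {τ σ : Γ} (d : TotalGrafting ψ τ) {g : τ ⟶ σ}
    (hg : IsGrafting ψ g) : TotalGrafting ψ σ where
  cor := d.cor
  map := d.map ≫ g
  isGrafting := d.isGrafting.comp hg

/-- The identity as a total grafting. -/
noncomputable abbrev TotalGrafting.refl (X : FinFam (Cor ψ)) :
    TotalGrafting ψ ((corUnion ψ).obj X) where
  cor := X
  map := 𝟙 _
  isGrafting := IsGrafting.of_isIso ψ _

/-- Graftings are monomorphisms in every graph category. -/
theorem grafting_cancel {ρ τ σ : Γ} {g : τ ⟶ σ} (hg : IsGrafting ψ g) {r r' : ρ ⟶ τ}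
    (h : r ≫ g = r' ≫ g) : r = r' := by
  have := GraphCategory.faithful (ψ := ψ)
  refine ψ.map_injective (Graph.cancel_of_bijective hg.1 hg.2 ?_)
  rw [← ψ.map_comp, h, ψ.map_comp]

/-- Every grafting onto a disjoint union of corollas is dominated by an isomorphism of families. -/
theorem exists_lift_of_grafting {ρ : Γ} {X : FinFam (Cor ψ)} (k : ρ ⟶ (corUnion ψ).obj X)
    (hk : IsGrafting ψ k) (d : TotalGrafting ψ ρ) :
    ∃ e : d.cor ⟶ X, (corUnion ψ).map e = d.map ≫ k := by
  obtain ⟨e, he, -⟩ := GraphCategory.totalGrafting_unique (d.comp hk) (TotalGrafting.refl ψ X)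
  exact ⟨e, (Category.comp_id _).symm.trans he⟩

/-- Every morphism from a union of corollas to `σ` lifts along a grafting `τ ⟶ σ`, up to an
isomorphism of families: in the atomization over the total grafting of `σ` through `τ`, the grafting
has a union of corollas as target, hence amounts to an isomorphism of families of corollas. -/
theorem exists_lift_along_grafting {τ σ : Γ} (g : τ ⟶ σ) (hg : IsGrafting ψ g)
    {X : FinFam (Cor ψ)} (q : (corUnion ψ).obj X ⟶ σ) :
    ∃ (Y : FinFam (Cor ψ)) (r : (corUnion ψ).obj Y ⟶ τ) (e : Y ⟶ X),
      (corUnion ψ).map e ≫ q = r ≫ g := by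
  let d := (totalGrafting ψ τ).comp hg
  obtain ⟨Z, hZ, k, h⟩ := GraphCategory.exists_atomization q d
  obtain ⟨e, he⟩ := exists_lift_of_grafting ψ k h.isGrafting (totalGrafting ψ _)
  refine ⟨_, (totalGrafting ψ (disjUnion Z)).map ≫ disjUnionMap hZ ≫ (totalGrafting ψ τ).map, e, ?_⟩
  refine (congrArg (· ≫ q) he).trans ((Category.assoc _ _ _).trans
    ((congrArg (_ ≫ ·) h.comm).trans ?_))
  exact ((Category.assoc _ _ _).trans (congrArg (_ ≫ ·) (Category.assoc _ _ _))).symm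

/-- Every morphism from a union of corollas to `τ ⊔ σ` splits, up to an isomorphism of families:
the parts of its atomization over the total grafting of `τ ⊔ σ` are parts over `τ` or over `σ`. -/
theorem exists_corPair {τ σ : Γ} {X : FinFam (Cor ψ)} (q : (corUnion ψ).obj X ⟶ τ ⊗ σ) :
    ∃ (Y Y' : FinFam (Cor ψ)) (r : (corUnion ψ).obj Y ⟶ τ) (s : (corUnion ψ).obj Y' ⟶ σ)
      (e : sum Y Y' ⟶ X), (corUnion ψ).map e ≫ q = corPair ψ r s := by
  let dτ := totalGrafting ψ τ
  let dσ := totalGrafting ψ σ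
  obtain ⟨Z, hZ, k, h⟩ := GraphCategory.exists_atomization q (dτ.pair ψ dσ)
  let Zl : dτ.cor.ι → Γ := fun i => Z (Sum.inl i)
  let Zr : dσ.cor.ι → Γ := fun i => Z (Sum.inr i)
  have h1 : (disjUnionMap (X := Zl) (fun i => hZ (Sum.inl i)) ⊗ₘ
      disjUnionMap (X := Zr) (fun i => hZ (Sum.inr i))) ≫
      tensorSum (fun i => (corInclusion ψ).obj ((sum dτ.cor dσ.cor).obj i)) =
      tensorSum Z ≫ disjUnionMap hZ := by
    refine tensorSum_natural (Z := Z)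
      (Z' := fun i => (corInclusion ψ).obj ((sum dτ.cor dσ.cor).obj i))
      (homMk fun i => hZ (Sum.inl i)) (homMk fun i => hZ (Sum.inr i)) (homMk hZ) ?_ ?_
    · exact FamMap.ext_of_app fun i => ⟨rfl, (Category.comp_id _).trans
        ((Category.id_comp (hZ (Sum.inl i))).trans (Category.comp_id (hZ (Sum.inl i))).symm)⟩
    · exact FamMap.ext_of_app fun i => ⟨rfl, (Category.comp_id _).trans
        ((Category.id_comp (hZ (Sum.inr i))).trans (Category.comp_id (hZ (Sum.inr i))).symm)⟩
  let dl := totalGrafting ψ (disjUnion Zl)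
  let dr := totalGrafting ψ (disjUnion Zr)
  let k' : disjUnion Zl ⊗ disjUnion Zr ⟶ (corUnion ψ).obj X := tensorSum Z ≫ k
  have hk' : IsGrafting ψ k' := (IsGrafting.of_isIso ψ _).comp h.isGrafting
  obtain ⟨e, he⟩ := exists_lift_of_grafting ψ k' hk' (dl.pair ψ dr)
  refine ⟨dl.cor, dr.cor, dl.map ≫ disjUnionMap (X := Zl) (fun i => hZ (Sum.inl i)) ≫ dτ.map,
    dr.map ≫ disjUnionMap (X := Zr) (fun i => hZ (Sum.inr i)) ≫ dσ.map, e, ?_⟩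
  have h2 : k' ≫ q = (disjUnionMap (X := Zl) (fun i => hZ (Sum.inl i)) ⊗ₘ
      disjUnionMap (X := Zr) (fun i => hZ (Sum.inr i))) ≫ (dτ.map ⊗ₘ dσ.map) := by
    refine (Category.assoc _ _ _).trans ((congrArg (_ ≫ ·) h.comm).trans ?_)
    refine (comp_assoc_of_eq h1.symm (corPair ψ dτ.map dσ.map)).trans ?_
    exact congrArg (_ ≫ ·) (corμ_corPair ψ dτ.map dσ.map)
  refine (congrArg (· ≫ q) he).trans ((Category.assoc _ _ _).trans ((congrArg (_ ≫ ·) h2).trans ?_))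
  refine (congrArg (_ ≫ ·) (tensorHom_comp_tensorHom _ _ _ _)).trans ?_
  exact corPair_comp ψ dl.map dr.map _ _

/-- Only the empty union of corollas maps to the unit object, because that has no vertices. -/
theorem isEmpty_of_hom_unit {X : FinFam (Cor ψ)} (q : (corUnion ψ).obj X ⟶ 𝟙_ Γ) :
    IsEmpty X.ι := by
  refine ⟨fun i => ?_⟩
  obtain ⟨v, -⟩ := exists_corIndex ψ X i
  exact Empty.elim ((Functor.OplaxMonoidal.η ψ).vertex ((ψ.map q).vertex v))

theorem hom_unit_unique {X : FinFam (Cor ψ)} (q q' : (corUnion ψ).obj X ⟶ 𝟙_ Γ) : q = q' := by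
  have := GraphCategory.faithful (ψ := ψ)
  have h0 := isEmpty_of_hom_unit ψ q
  have h1 : IsEmpty (ψ.obj ((corUnion ψ).obj X)).Vertex := ⟨fun v => h0.elim (corIndex ψ X v)⟩
  refine ψ.map_injective (Graph.hom_ext (fun f => ?_) (fun w => h1.elim w) (fun f => ?_))
  · exact h1.elim ((ψ.obj _).bd ((ψ.map q).flag f))
  · exact h1.elim ((ψ.obj _).bd f)

end GraphCat

/-! ### Colimits over families of corollas -/

section Shapes

variable {J : Type*} [Category* J] {J' : Type*} [Category* J'] {C : Type*} [Category* C]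
  {D : Type*} [Category* D]

section Retract

variable (S : J' ⥤ J) (R : J ⥤ J') (i : S ⋙ R ≅ 𝟭 J')

/-- A cocone over the restriction of a diagram along a retraction induces a cocone over the
diagram. -/
def retractCocone {F : J' ⥤ C} (t : Cocone (R ⋙ F)) : Cocone F where
  pt := t.pt
  ι :=
    { app := fun j => F.map (i.inv.app j) ≫ t.ι.app (S.obj j)
      naturality := fun j k f => by
        have h := t.w (S.map f)
        have h' := i.inv.naturality f
        dsimp at h h' ⊢
        rw [← F.map_comp_assoc, h', F.map_comp_assoc, h, Category.comp_id] }

theorem retractCocone_w {F : J' ⥤ C} (t : Cocone F) (j : J') :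
    F.map (i.inv.app j) ≫ t.ι.app (R.obj (S.obj j)) = t.ι.app j :=
  t.w (i.inv.app j)

include i in
/-- A colimit over a retract `J'` of `J` splits an idempotent on the colimit over `J`. The splitting
is obtained as a coequalizer. -/
theorem hasColimitsOfShape_of_retract [HasColimitsOfShape J C] [HasCoequalizers C] :
    HasColimitsOfShape J' C := by
  refine ⟨fun F => ⟨⟨?_⟩⟩⟩
  let t := colimit.cocone (R ⋙ F)
  let e : colimit (R ⋙ F) ⟶ colimit (R ⋙ F) :=
    colimit.desc (R ⋙ F) ((retractCocone S R i t).whisker R)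
  have he : ∀ j, colimit.ι (R ⋙ F) j ≫ e = F.map (i.inv.app (R.obj j)) ≫
      colimit.ι (R ⋙ F) (S.obj (R.obj j)) := fun j => colimit.ι_desc _ j
  let π := coequalizer.π (𝟙 _) e
  have hπ : e ≫ π = π := ((coequalizer.condition (𝟙 _) e).symm.trans (Category.id_comp _))
  let d (s : Cocone F) : colimit (R ⋙ F) ⟶ s.pt := colimit.desc (R ⋙ F) (s.whisker R)
  have hd (s : Cocone F) (j) : colimit.ι (R ⋙ F) j ≫ d s = s.ι.app (R.obj j) :=
    colimit.ι_desc _ j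
  refine ⟨(retractCocone S R i t).extend π, ?_, ?_, ?_⟩
  · refine fun s => coequalizer.desc (d s) ?_
    refine colimit.hom_ext fun j => ?_
    rw [Category.id_comp, ← Category.assoc, he, Category.assoc, hd, hd, retractCocone_w]
  · intro s j
    change ((F.map (i.inv.app j) ≫ colimit.ι (R ⋙ F) (S.obj j)) ≫ π) ≫ coequalizer.desc _ _ = _
    rw [Category.assoc, coequalizer.π_desc, Category.assoc, hd, retractCocone_w]
  · intro s m hm
    refine coequalizer.hom_ext ?_
    rw [coequalizer.π_desc]
    refine colimit.hom_ext fun j => ?_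
    rw [hd, ← hm]
    change _ ≫ π ≫ m = ((F.map (i.inv.app _) ≫ colimit.ι (R ⋙ F) _) ≫ π) ≫ m
    rw [← he, Category.assoc, Category.assoc, ← Category.assoc e, hπ]

include i in
/-- A colimit over a retract `J'` of `J` is a retract of the colimit over `J`, hence it is preserved
by every functor that preserves the latter. -/
theorem preservesColimitsOfShape_of_retract [HasColimitsOfShape J C] (T : C ⥤ D)
    [PreservesColimitsOfShape J T] : PreservesColimitsOfShape J' T := by
  refine ⟨fun {F} => ⟨fun {c} hc => ⟨?_⟩⟩⟩
  let t := colimit.cocone (R ⋙ F)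
  have ht : IsColimit (T.mapCocone t) := isColimitOfPreserves T (colimit.isColimit (R ⋙ F))
  let s : c.pt ⟶ t.pt := hc.desc (retractCocone S R i t)
  have hs (j) : c.ι.app j ≫ s = F.map (i.inv.app j) ≫ t.ι.app (S.obj j) := hc.fac _ j
  let q : t.pt ⟶ c.pt := colimit.desc (R ⋙ F) (c.whisker R)
  have hq (j) : t.ι.app j ≫ q = c.ι.app (R.obj j) := colimit.ι_desc _ j
  have hsq : s ≫ q = 𝟙 _ := hc.hom_ext fun j => by
    rw [← Category.assoc, hs, Category.assoc, hq, retractCocone_w, Category.comp_id]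
  refine ⟨fun u => T.map s ≫ ht.desc (u.whisker R), fun u j => ?_, fun u m hm => ?_⟩
  · have h1 : (T.mapCocone t).ι.app (S.obj j) ≫ ht.desc (u.whisker R) =
      u.ι.app (R.obj (S.obj j)) := ht.fac _ _
    change T.map (c.ι.app j) ≫ _ = _
    rw [← Category.assoc, ← T.map_comp, hs, T.map_comp, Category.assoc]
    exact (congrArg (_ ≫ ·) h1).trans (u.w (i.inv.app j))
  · have h2 : T.map q ≫ m = ht.desc (u.whisker R) := by
      refine ht.hom_ext fun j => ?_
      rw [ht.fac]
      change T.map (t.ι.app j) ≫ T.map q ≫ m = _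
      rw [← Category.assoc, ← T.map_comp, hq]
      exact hm _
    rw [← h2, ← Category.assoc, ← T.map_comp, hsq]
    exact (T.map_id c.pt ▸ Category.id_comp m).symm

end Retract

/-- Colimits over a product are iterated colimits. -/
theorem preservesColimitsOfShape_prod {K : Type*} [Category* K] [HasColimitsOfShape K C]
    [HasColimitsOfShape J C] (T : C ⥤ D) [PreservesColimitsOfShape J T]
    [PreservesColimitsOfShape K T] : PreservesColimitsOfShape (J × K) T := by
  refine ⟨fun {F} => ?_⟩
  refine preservesColimit_of_preserves_colimit_cocone
    (isColimitCoconeOfHasColimitCurryCompColim F) ?_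
  let H : J ⥤ K ⥤ C := Functor.curry.obj F
  have hL (j : J) := isColimitOfPreserves T (colimit.isColimit (H.obj j))
  have hM := isColimitOfPreserves T (colimit.isColimit (H ⋙ colim))
  let cc (s : Cocone (F ⋙ T)) (j : J) : Cocone (H.obj j ⋙ T) :=
    { pt := s.pt
      ι := { app := fun k => s.ι.app (j, k)
             naturality := fun k k' f => s.ι.naturality (X := (j, k)) (Y := (j, k')) (𝟙 j, f) } }
  have h1 (s : Cocone (F ⋙ T)) (j k) : T.map (colimit.ι (H.obj j) k) ≫ (hL j).desc (cc s j) =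
      s.ι.app (j, k) := (hL j).fac _ k
  have h3 {j j' : J} (f : j ⟶ j') (k : K) : colimit.ι (H.obj j) k ≫ colim.map (H.map f) =
      F.map (X := (j, k)) (Y := (j', k)) (f, 𝟙 k) ≫ colimit.ι (H.obj j') k :=
    ι_colimMap (H.map f) k
  let dd (s : Cocone (F ⋙ T)) : Cocone ((H ⋙ colim) ⋙ T) :=
    { pt := s.pt
      ι := { app := fun j => (hL j).desc (cc s j)
             naturality := fun j j' f => by
              refine ((hL j).hom_ext fun k => ?_).trans (Category.comp_id _).symm
              rw [(hL j).fac]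
              change T.map (colimit.ι (H.obj j) k) ≫ T.map (colim.map (H.map f)) ≫ _ = _
              rw [← Category.assoc, ← T.map_comp, h3, T.map_comp, Category.assoc]
              refine (congrArg (_ ≫ ·) (h1 s j' k)).trans ?_
              exact s.w (show ((j, k) : J × K) ⟶ (j', k) from (f, 𝟙 k)) } }
  have h2 (s : Cocone (F ⋙ T)) (j) : T.map (colimit.ι (H ⋙ colim) j) ≫ hM.desc (dd s) =
      (hL j).desc (cc s j) := hM.fac _ j
  have h5 (j k) : T.map ((coconeOfHasColimitCurryCompColim F).ι.app (j, k)) =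
      T.map (colimit.ι (H.obj j) k) ≫ T.map (colimit.ι (H ⋙ colim) j) := T.map_comp _ _
  refine ⟨fun s => hM.desc (dd s), ?_, ?_⟩
  · rintro s ⟨j, k⟩
    refine (congrArg (· ≫ hM.desc (dd s)) (h5 j k)).trans ?_
    refine (Category.assoc _ _ _).trans ?_
    exact (congrArg (_ ≫ ·) (h2 s j)).trans (h1 s j k)
  · intro s m hm
    refine hM.hom_ext fun j => (hL j).hom_ext fun k => ?_
    rw [hM.fac]
    refine Eq.trans ?_ (h1 s j k).symm
    exact (Category.assoc _ _ _).symm.trans ((congrArg (· ≫ m) (h5 j k).symm).trans (hm (j, k)))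

/-- Colimits of shape `J` exist in `G` and are preserved by the tensor product in each argument. -/
structure DistributiveShape (J : Type*) [Category* J] (G : Type u') [Category.{v'} G]
    [MonoidalCategory G] : Prop where
  hasColimits : HasColimitsOfShape J G
  preserves_left : ∀ X : G, PreservesColimitsOfShape J (tensorLeft X)
  preserves_right : ∀ X : G, PreservesColimitsOfShape J (tensorRight X)

namespace DistributiveShape

variable {G : Type u'} [Category.{v'} G] [MonoidalCategory G]

theorem of_equivalence (h : DistributiveShape J G) (e : J ≌ J') : DistributiveShape J' G where
  hasColimits := have := h.hasColimits; hasColimitsOfShape_of_equivalence e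
  preserves_left X := have := h.preserves_left X; preservesColimitsOfShape_of_equiv e _
  preserves_right X := have := h.preserves_right X; preservesColimitsOfShape_of_equiv e _

theorem of_retract [HasCoequalizers G] (h : DistributiveShape J G) (S : J' ⥤ J) (R : J ⥤ J')
    (i : S ⋙ R ≅ 𝟭 J') : DistributiveShape J' G where
  hasColimits := have := h.hasColimits; hasColimitsOfShape_of_retract S R i
  preserves_left X := by
    have := h.hasColimits
    have := h.preserves_left X
    exact preservesColimitsOfShape_of_retract S R i _
  preserves_right X := by
    have := h.hasColimits
    have := h.preserves_right X
    exact preservesColimitsOfShape_of_retract S R i _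

theorem prod (h : DistributiveShape J G) (h' : DistributiveShape J' G) :
    DistributiveShape (J × J') G where
  hasColimits := by
    have := h.hasColimits
    have := h'.hasColimits
    exact ⟨fun F => inferInstance⟩
  preserves_left X := by
    have := h.hasColimits
    have := h'.hasColimits
    have := h.preserves_left X
    have := h'.preserves_left X
    exact preservesColimitsOfShape_prod _
  preserves_right X := by
    have := h.hasColimits
    have := h'.hasColimits
    have := h.preserves_right X
    have := h'.preserves_right X
    exact preservesColimitsOfShape_prod _

end DistributiveShape

end Shapes

/-! ### Families of corollas over an object -/

section CorShapes

open FinFam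

variable {Γ : Type u} [Category.{v} Γ] [MonoidalCategory Γ] [SymmetricCategory Γ]
  (ψ : Γ ⥤ Graph)

/-- The category of morphisms `∐ X ⟶ τ`, where `X` is a finite family of corollas. -/
abbrev CorOver (τ : Γ) := CostructuredArrow (corUnion ψ) τ

instance isIso_of_finFam_cor {X Y : FinFam (Cor ψ)} (e : X ⟶ Y) : IsIso e :=
  isIso_of_isIso_app e fun _ => inferInstance

instance {τ : Γ} {X Y : CorOver ψ τ} (e : X ⟶ Y) : IsIso e := by
  have : IsIso ((CostructuredArrow.proj (corUnion ψ) τ).map e) := isIso_of_finFam_cor ψ _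
  exact isIso_of_reflects_iso e (CostructuredArrow.proj (corUnion ψ) τ)

/-- The isomorphism between a corolla and the disjoint union of the family with this member. -/
noncomputable def corOne (a : Cor ψ) : (corInclusion ψ).obj a ⟶ (corUnion ψ).obj (single a) :=
  famOne (corInclusion ψ) a

instance (a : Cor ψ) : IsIso (corOne ψ a) :=
  isIso_tensorOne fun _ => (corInclusion ψ).obj a

variable [ψ.Braided] [GraphCategory ψ]

/-- Families of corollas over `τ` and over `σ` agree, if there is a grafting `τ ⟶ σ`. -/
theorem isEquivalence_map_of_isGrafting {τ σ : Γ} {g : τ ⟶ σ} (hg : IsGrafting ψ g) :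
    (CostructuredArrow.map (S := corUnion ψ) g).IsEquivalence where
  faithful := ⟨fun {X Y a b} h => by
    have h' := congrArg CommaMorphism.left h
    ext
    exact h'⟩
  full := ⟨fun {X Y} a => by
    refine ⟨CostructuredArrow.homMk a.left ?_, rfl⟩
    refine grafting_cancel ψ hg ?_
    rw [Category.assoc]
    exact CostructuredArrow.w a⟩
  essSurj := ⟨fun Y => by
    obtain ⟨X, r, e, h⟩ := exists_lift_along_grafting ψ g hg Y.hom
    exact ⟨CostructuredArrow.mk r, ⟨asIso (CostructuredArrow.homMk e h)⟩⟩⟩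

/-- Isomorphisms of families of corollas are determined by the isomorphism of their disjoint unions,
by uniqueness of total graftings. -/
theorem corUnion_map_injective {X Y : FinFam (Cor ψ)} {e e' : X ⟶ Y}
    (h : (corUnion ψ).map e = (corUnion ψ).map e') : e = e' := by
  obtain ⟨a, -, ha⟩ := GraphCategory.totalGrafting_unique
    ((TotalGrafting.refl ψ X).comp (IsGrafting.of_isIso ψ ((corUnion ψ).map e)))
    (TotalGrafting.refl ψ Y)
  rw [ha e ((Category.comp_id _).trans (Category.id_comp _).symm), ha e'
    ((Category.comp_id _).trans (h.symm.trans (Category.id_comp _).symm))]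

theorem FinFam.sumMap_id {C : Type*} [Category* C] (X Y : FinFam C) :
    sumMap (𝟙 X) (𝟙 Y) = 𝟙 (sum X Y) := by
  refine hom_ext_famMap (FamMap.ext_of_app ?_)
  rintro (i | i)
  · exact ⟨rfl, Category.comp_id _⟩
  · exact ⟨rfl, Category.comp_id _⟩

theorem FinFam.sumMap_comp {C : Type*} [Category* C] {X Y X' Y' X'' Y'' : FinFam C} (f : X ⟶ X')
    (g : Y ⟶ Y') (f' : X' ⟶ X'') (g' : Y' ⟶ Y'') :
    sumMap f g ≫ sumMap f' g' = sumMap (f ≫ f') (g ≫ g') := by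
  refine hom_ext_famMap (FamMap.ext_of_app ?_)
  rintro (i | i)
  · exact ⟨rfl, Category.comp_id _⟩
  · exact ⟨rfl, Category.comp_id _⟩

theorem sumMap_injective {X Y X' Y' : FinFam (Cor ψ)} {f f' : X ⟶ X'} {g g' : Y ⟶ Y'}
    (h : sumMap f g = sumMap f' g') : f = f' ∧ g = g' := by
  have := GraphCategory.faithful (ψ := ψ)
  have h1 := corμ_natural ψ f g
  rw [h, ← corμ_natural ψ f' g', cancel_mono] at h1
  obtain ⟨h2, h3⟩ := tensor_injective ψ h1
  exact ⟨corUnion_map_injective ψ h2, corUnion_map_injective ψ h3⟩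

/-- The functor sending `∐ X ⟶ τ` and `∐ Y ⟶ σ` to `∐ (X ⊔ Y) ⟶ τ ⊔ σ`. -/
noncomputable def corOverPair (τ σ : Γ) : CorOver ψ τ × CorOver ψ σ ⥤ CorOver ψ (τ ⊗ σ) where
  obj X := CostructuredArrow.mk (corPair ψ X.1.hom X.2.hom)
  map {X Y} f := CostructuredArrow.homMk (sumMap f.1.left f.2.left) (by
    refine (map_corPair ψ _ _ _ _).trans ?_
    rw [CostructuredArrow.w, CostructuredArrow.w]
    rfl)
  map_id X := by
    ext
    exact sumMap_id _ _
  map_comp f g := by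
    ext
    exact (sumMap_comp _ _ _ _).symm

/-- Families of corollas over `τ ⊔ σ` are pairs of families over `τ` and over `σ`. -/
instance (τ σ : Γ) : (corOverPair ψ τ σ).IsEquivalence where
  faithful := ⟨fun {X Y a b} h => by
    obtain ⟨h1, h2⟩ := sumMap_injective ψ (congrArg CommaMorphism.left h)
    exact Prod.ext (by ext; exact h1) (by ext; exact h2)⟩
  full := ⟨fun {X Y} a => by
    have := GraphCategory.faithful (ψ := ψ)
    obtain ⟨f, g, h, hf, hg⟩ := exists_sumMap_of_corPair ψ X.1.hom X.2.hom Y.1.hom Y.2.hom a.left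
      (CostructuredArrow.w a)
    exact ⟨(CostructuredArrow.homMk f hf, CostructuredArrow.homMk g hg), by ext; exact h.symm⟩⟩
  essSurj := ⟨fun Z => by
    obtain ⟨Y, Y', r, s, e, h⟩ := exists_corPair ψ Z.hom
    exact ⟨(CostructuredArrow.mk r, CostructuredArrow.mk s),
      ⟨asIso (CostructuredArrow.homMk e h)⟩⟩⟩

/-- Only the empty family lies over the unit object, in exactly one way. -/
theorem isEquivalence_unit :
    (Functor.fromPUnit (CostructuredArrow.mk (inv (corε ψ))) :
      Discrete PUnit ⥤ CorOver ψ (𝟙_ Γ)).IsEquivalence where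
  faithful := ⟨fun _ => Subsingleton.elim _ _⟩
  full := ⟨fun {X Y} a => by
    refine ⟨eqToHom (Subsingleton.elim _ _), ?_⟩
    ext
    refine hom_ext_famMap (FamMap.ext_of_app fun i => (i : Empty).elim)⟩
  essSurj := ⟨fun Z => by
    have := isEmpty_of_hom_unit ψ Z.hom
    let e : empty (Cor ψ) ⟶ Z.left := ⟨Equiv.equivOfIsEmpty Empty _, fun i => i.elim⟩
    exact ⟨⟨⟨⟩⟩, ⟨asIso (CostructuredArrow.homMk e (hom_unit_unique ψ _ _))⟩⟩⟩

/-- A family of corollas over `σ`, considered as an object over `σ`. -/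
noncomputable def corOverToCore (σ : Γ) : CorOver ψ σ ⥤ Core (Over σ) where
  obj X := ⟨Over.mk X.hom⟩
  map {X Y} e := ⟨Over.isoMk (asIso ((corUnion ψ).map e.left)) (CostructuredArrow.w e)⟩
  map_id X := Core.hom_ext (by ext; exact (corUnion ψ).map_id _)
  map_comp f g := Core.hom_ext (by ext; exact (corUnion ψ).map_comp _ _)

/-- The total grafting of an object over `σ`, considered as a family of corollas over `σ`. -/
noncomputable def coreToCorOver (σ : Γ) : Core (Over σ) ⥤ CorOver ψ σ where
  obj X := CostructuredArrow.mk ((totalGrafting ψ X.of.left).map ≫ X.of.hom)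
  map {X Y} a := CostructuredArrow.homMk ((corFamily ψ).map ((Over.forget σ).core.map a)) (by
    have h := corFamilyMap_spec ψ ((Over.forget σ).core.map a).iso
    refine (Category.assoc _ _ _).symm.trans ((congrArg (· ≫ Y.of.hom) h).trans ?_)
    exact (Category.assoc _ _ _).trans (congrArg (_ ≫ ·) (Over.w a.iso.hom)))
  map_id X := by
    ext
    exact ((Over.forget σ).core ⋙ corFamily ψ).map_id X
  map_comp f g := by
    ext
    exact ((Over.forget σ).core ⋙ corFamily ψ).map_comp f g

/-- The isomorphism from the total grafting of a disjoint union of corollas to its members. -/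
noncomputable def corUnionFamily (X : FinFam (Cor ψ)) :
    (totalGrafting ψ ((corUnion ψ).obj X)).cor ⟶ X :=
  (GraphCategory.totalGrafting_unique (totalGrafting ψ ((corUnion ψ).obj X))
    (TotalGrafting.refl ψ X)).choose

theorem map_corUnionFamily (X : FinFam (Cor ψ)) :
    (corUnion ψ).map (corUnionFamily ψ X) = (totalGrafting ψ ((corUnion ψ).obj X)).map :=
  (Category.comp_id _).symm.trans
    (GraphCategory.totalGrafting_unique (totalGrafting ψ ((corUnion ψ).obj X))
      (TotalGrafting.refl ψ X)).choose_spec.1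

/-- Families of corollas over `σ` are a retract of the groupoid of objects over `σ`. -/
noncomputable def corOverRetract (σ : Γ) :
    corOverToCore ψ σ ⋙ coreToCorOver ψ σ ≅ 𝟭 (CorOver ψ σ) :=
  NatIso.ofComponents
    (fun X => asIso (CostructuredArrow.homMk (corUnionFamily ψ X.left)
      (congrArg (· ≫ X.hom) (map_corUnionFamily ψ X.left)) :
        (corOverToCore ψ σ ⋙ coreToCorOver ψ σ).obj X ⟶ X))
    (fun {X Y} e => by
      ext
      refine corUnion_map_injective ψ ?_
      have h := corFamilyMap_spec ψ ((Over.forget σ).core.map ((corOverToCore ψ σ).map e)).iso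
      have h1 := map_corUnionFamily ψ Y.left
      have h2 := map_corUnionFamily ψ X.left
      refine ((corUnion ψ).map_comp _ _).trans (Eq.trans ?_ ((corUnion ψ).map_comp _ _).symm)
      refine ((congrArg (_ ≫ ·) h1).trans h).trans ?_
      exact congrArg (· ≫ (corUnion ψ).map e.left) h2.symm)

theorem DistributiveShape.of_isGrafting {G : Type u'} [Category.{v'} G] [MonoidalCategory G]
    {τ σ : Γ} {g : τ ⟶ σ} (hg : IsGrafting ψ g) (h : DistributiveShape (CorOver ψ τ) G) :
    DistributiveShape (CorOver ψ σ) G :=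
  have := isEquivalence_map_of_isGrafting ψ hg
  h.of_equivalence (CostructuredArrow.map (S := corUnion ψ) g).asEquivalence

variable (G : Type u') [Category.{v'} G] [Abelian G] [MonoidalCategory G] [SymmetricCategory G]
  [ExactTensor G] [HasGraphColimits ψ G]

theorem distributiveShape_corolla (σ : Cor ψ) :
    DistributiveShape (CorOver ψ ((corInclusion ψ).obj σ)) G :=
  DistributiveShape.of_retract ⟨HasGraphColimits.hasColimits σ, HasGraphColimits.preserves_left σ,
    HasGraphColimits.preserves_right σ⟩ _ _ (corOverRetract ψ _)

theorem distributiveShape_unit : DistributiveShape (CorOver ψ (𝟙_ Γ)) G := by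
  have h : DistributiveShape (Discrete PUnit.{1}) G :=
    { hasColimits := inferInstance
      preserves_left := fun X =>
        (ExactTensor.preservesFiniteColimits_left X).preservesFiniteColimits _
      preserves_right := fun X =>
        (ExactTensor.preservesFiniteColimits_right X).preservesFiniteColimits _ }
  have := isEquivalence_unit ψ
  exact h.of_equivalence
    (Functor.fromPUnit (CostructuredArrow.mk (inv (corε ψ)))).asEquivalence

/-- The tensor product of `G` is distributive with respect to colimits over the families of
corollas over an arbitrary object `τ`. The total grafting of `τ` reduces this to a disjoint union of
corollas, where the shape is a product of the shapes for the members. -/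
theorem distributiveShape (τ : Γ) : DistributiveShape (CorOver ψ τ) G := by
  refine DistributiveShape.of_isGrafting ψ (totalGrafting ψ τ).isGrafting ?_
  generalize (totalGrafting ψ τ).cor = X
  refine FinFam.induction (motive := fun X => DistributiveShape (CorOver ψ ((corUnion ψ).obj X)) G)
    (fun {X Y} f _ h => ?_) ?_ (fun a X h => ?_) X
  · exact h.of_isGrafting ψ (IsGrafting.of_isIso ψ ((corUnion ψ).map f))
  · exact (distributiveShape_unit ψ G).of_isGrafting ψ (IsGrafting.of_isIso ψ (corε ψ))
  · have h1 : DistributiveShape (CorOver ψ ((corUnion ψ).obj (single a))) G :=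
      DistributiveShape.of_isGrafting ψ (g := corOne ψ a) (IsGrafting.of_isIso ψ _)
        (distributiveShape_corolla ψ G a)
    have h2 := (h1.prod h).of_equivalence (corOverPair ψ _ _).asEquivalence
    exact DistributiveShape.of_isGrafting ψ (IsGrafting.of_isIso ψ (corμ ψ (single a) X)) h2

end CorShapes

/-! ### Coherence of the disjoint union of corollas over a pair of objects -/

section CorCoherence

open FinFam

variable {Γ : Type u} [Category.{v} Γ] [MonoidalCategory Γ] [SymmetricCategory Γ]
  (ψ : Γ ⥤ Graph) [ψ.Braided]

theorem corμ_braid (X Y : FinFam (Cor ψ)) :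
    (β_ _ _).hom ≫ corμ ψ Y X = corμ ψ X Y ≫ (corUnion ψ).map (sumComm X Y) :=
  famμ_braid _ X Y

theorem corμ_assoc (X Y Z : FinFam (Cor ψ)) :
    (corμ ψ X Y ▷ (corUnion ψ).obj Z) ≫ corμ ψ (sum X Y) Z ≫ (corUnion ψ).map (sumAssoc X Y Z) =
      (α_ _ _ _).hom ≫ ((corUnion ψ).obj X ◁ corμ ψ Y Z) ≫ corμ ψ X (sum Y Z) :=
  famμ_assoc _ X Y Z

theorem corμ_empty_left (X : FinFam (Cor ψ)) :
    (corε ψ ▷ (corUnion ψ).obj X) ≫ corμ ψ (empty (Cor ψ)) X ≫ (corUnion ψ).map (emptySum X) =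
      (λ_ _).hom :=
  famμ_empty_left _ X

variable {ψ}

theorem sumComm_corPair {X Y : FinFam (Cor ψ)} {τ σ : Γ} (r : (corUnion ψ).obj X ⟶ τ)
    (s : (corUnion ψ).obj Y ⟶ σ) :
    (corUnion ψ).map (sumComm X Y) ≫ corPair ψ s r = corPair ψ r s ≫ (β_ τ σ).hom := by
  rw [← cancel_epi (corμ ψ X Y), ← Category.assoc, ← Category.assoc, corμ_corPair, ← corμ_braid,
    Category.assoc, corμ_corPair, BraidedCategory.braiding_naturality]

theorem sumAssoc_corPair {X Y Z : FinFam (Cor ψ)} {τ σ ρ : Γ} (r : (corUnion ψ).obj X ⟶ τ)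
    (s : (corUnion ψ).obj Y ⟶ σ) (t : (corUnion ψ).obj Z ⟶ ρ) :
    (corUnion ψ).map (sumAssoc X Y Z) ≫ corPair ψ r (corPair ψ s t) =
      corPair ψ (corPair ψ r s) t ≫ (α_ τ σ ρ).hom := by
  rw [← cancel_epi (corμ ψ (sum X Y) Z), ← cancel_epi (corμ ψ X Y ▷ (corUnion ψ).obj Z)]
  have h2 := corμ_assoc ψ X Y Z
  calc _ = ((corμ ψ X Y ▷ (corUnion ψ).obj Z) ≫ corμ ψ (sum X Y) Z ≫
        (corUnion ψ).map (sumAssoc X Y Z)) ≫ corPair ψ r (corPair ψ s t) := by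
        simp only [Category.assoc]
    _ = (α_ _ _ _).hom ≫ ((corUnion ψ).obj X ◁ corμ ψ Y Z) ≫ (r ⊗ₘ corPair ψ s t) := by
        rw [h2, Category.assoc, Category.assoc, corμ_corPair]
    _ = (α_ _ _ _).hom ≫ (r ⊗ₘ (s ⊗ₘ t)) := by
        rw [← id_tensorHom, tensorHom_comp_tensorHom, Category.id_comp, corμ_corPair]
    _ = ((r ⊗ₘ s) ⊗ₘ t) ≫ (α_ _ _ _).hom := by rw [associator_naturality]
    _ = (corμ ψ X Y ▷ (corUnion ψ).obj Z) ≫ (corPair ψ r s ⊗ₘ t) ≫ (α_ τ σ ρ).hom := by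
        rw [← tensorHom_id, tensorHom_comp_tensorHom_assoc, Category.id_comp, corμ_corPair]
    _ = _ := by rw [← Category.assoc (corμ ψ (sum X Y) Z), corμ_corPair]

theorem emptySum_corPair {X : FinFam (Cor ψ)} {τ : Γ} (r : (corUnion ψ).obj X ⟶ τ) :
    (corUnion ψ).map (emptySum X) ≫ r = corPair ψ (inv (corε ψ)) r ≫ (λ_ τ).hom := by
  rw [← cancel_epi (corμ ψ _ X), ← cancel_epi (corε ψ ▷ (corUnion ψ).obj X)]
  have h := corμ_empty_left ψ X
  calc _ = ((corε ψ ▷ (corUnion ψ).obj X) ≫ corμ ψ (empty (Cor ψ)) X ≫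
        (corUnion ψ).map (emptySum X)) ≫ r := by simp only [Category.assoc]
    _ = (λ_ _).hom ≫ r := by rw [h]
    _ = (𝟙_ Γ ◁ r) ≫ (λ_ τ).hom := by rw [leftUnitor_naturality]
    _ = (corε ψ ▷ (corUnion ψ).obj X) ≫ (inv (corε ψ) ⊗ₘ r) ≫ (λ_ τ).hom := by
        rw [← tensorHom_id, tensorHom_comp_tensorHom_assoc, Category.id_comp, IsIso.hom_inv_id,
          id_tensorHom]
    _ = _ := by rw [← Category.assoc (corμ ψ _ X), corμ_corPair]

end CorCoherence

/-! ### Construction of operads from a multiplication and a unit -/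

section MkOperad

variable {Γ : Type u} [Category.{v} Γ] [MonoidalCategory Γ] [SymmetricCategory Γ]
  {ψ : Γ ⥤ Graph} {G : Type u'} [Category.{v'} G] [MonoidalCategory G] [SymmetricCategory G]

/-- An operad given by a functor with an invertible, natural, associative, unital, symmetric
multiplication. Right unitality is implied by symmetry. -/
noncomputable def Operad.ofMul (F : Γ ⥤ G) (e : 𝟙_ G ⟶ F.obj (𝟙_ Γ))
    (m : ∀ τ σ, F.obj τ ⊗ F.obj σ ⟶ F.obj (τ ⊗ σ)) (he : IsIso e) (hm : ∀ τ σ, IsIso (m τ σ))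
    (natural : ∀ {τ σ τ' σ' : Γ} (f : τ ⟶ τ') (g : σ ⟶ σ'),
      (F.map f ⊗ₘ F.map g) ≫ m τ' σ' = m τ σ ≫ F.map (f ⊗ₘ g))
    (assoc : ∀ τ σ ρ, (m τ σ ▷ F.obj ρ) ≫ m (τ ⊗ σ) ρ ≫ F.map (α_ τ σ ρ).hom =
      (α_ _ _ _).hom ≫ (F.obj τ ◁ m σ ρ) ≫ m τ (σ ⊗ ρ))
    (unit : ∀ τ, (λ_ (F.obj τ)).hom = (e ▷ F.obj τ) ≫ m (𝟙_ Γ) τ ≫ F.map (λ_ τ).hom)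
    (braid : ∀ τ σ, m τ σ ≫ F.map (β_ τ σ).hom = (β_ (F.obj τ) (F.obj σ)).hom ≫ m σ τ)
    (isIso_map : ∀ {τ σ : Γ} (h : τ ⟶ σ), IsGrafting ψ h → IsIso (F.map h)) : Operad ψ G :=
  let lax : F.LaxMonoidal :=
    { ε := e
      μ := m
      μ_natural_left := fun f ρ => by
        have := natural f (𝟙 ρ)
        rwa [F.map_id, tensorHom_id, tensorHom_id] at this
      μ_natural_right := fun ρ f => by
        have := natural (𝟙 ρ) f
        rwa [F.map_id, id_tensorHom, id_tensorHom] at this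
      associativity := assoc
      left_unitality := unit
      right_unitality := fun τ => by
        rw [← braiding_leftUnitor, ← braiding_leftUnitor, F.map_comp,
          ← Category.assoc (m τ (𝟙_ Γ)), braid, Category.assoc,
          ← Category.assoc (F.obj τ ◁ e), BraidedCategory.braiding_naturality_right,
          Category.assoc, ← unit] }
  have : IsIso (Functor.LaxMonoidal.ε F) := he
  have : ∀ τ σ, IsIso (Functor.LaxMonoidal.μ F τ σ) := hm
  let mon : F.Monoidal := Functor.Monoidal.ofLaxMonoidal F
  let br : F.Braided := { toMonoidal := mon, braided := braid }
  { functor := F, braided := br, isIso_map := isIso_map }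

end MkOperad

/-! ### The free operad -/

section FreeOperad

open FinFam Functor.LaxMonoidal

variable {Γ : Type u} [Category.{v} Γ] [MonoidalCategory Γ] [SymmetricCategory Γ]
  {ψ : Γ ⥤ Graph} [ψ.Braided] [GraphCategory ψ]
  {G : Type u'} [Category.{v'} G] [Abelian G] [MonoidalCategory G] [SymmetricCategory G]
  [ExactTensor G] [HasGraphColimits ψ G]

instance (τ : Γ) : HasColimitsOfShape (CorOver ψ τ) G := (distributiveShape ψ G τ).hasColimits

variable (A₁ : Collection ψ G)

/-- The value of the free operad: the colimit of `⨂ᵢ A₁(Xᵢ)` over all morphisms `∐ Xᵢ ⟶ τ` from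
disjoint unions of corollas. Unlike for `freeCollection`, the source of the morphism is a family of
corollas rather than an object with a chosen total grafting, and `τ` need not be a corolla; this
makes the values on all objects, and the multiplication, accessible to universal properties. -/
noncomputable def freeObj (τ : Γ) : G :=
  colimit (CostructuredArrow.proj (corUnion ψ) τ ⋙ famTensor A₁)

/-- The morphism `⨂ᵢ A₁(Xᵢ) ⟶ P(τ)` to the free operad corresponding to `r : ∐ Xᵢ ⟶ τ`. -/
noncomputable def leg {X : FinFam (Cor ψ)} {τ : Γ} (r : (corUnion ψ).obj X ⟶ τ) :
    (famTensor A₁).obj X ⟶ freeObj A₁ τ :=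
  colimit.ι (CostructuredArrow.proj (corUnion ψ) τ ⋙ famTensor A₁) (CostructuredArrow.mk r)

theorem map_leg {X Y : FinFam (Cor ψ)} {τ : Γ} (e : X ⟶ Y) (r : (corUnion ψ).obj Y ⟶ τ) :
    (famTensor A₁).map e ≫ leg A₁ r = leg A₁ ((corUnion ψ).map e ≫ r) :=
  colimit.w (CostructuredArrow.proj (corUnion ψ) τ ⋙ famTensor A₁)
    (CostructuredArrow.homMk e rfl : CostructuredArrow.mk ((corUnion ψ).map e ≫ r) ⟶
      CostructuredArrow.mk r)

variable {A₁}

/-- A compatible family of morphisms, as a cocone over the diagram tensored with an object. -/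
noncomputable def legCocone (T : G ⥤ G) {τ : Γ} {Z : G}
    (t : ∀ (X : FinFam (Cor ψ)) (_ : (corUnion ψ).obj X ⟶ τ), T.obj ((famTensor A₁).obj X) ⟶ Z)
    (ht : ∀ {X Y : FinFam (Cor ψ)} (e : X ⟶ Y) (r : (corUnion ψ).obj Y ⟶ τ),
      T.map ((famTensor A₁).map e) ≫ t Y r = t X ((corUnion ψ).map e ≫ r)) :
    Cocone ((CostructuredArrow.proj (corUnion ψ) τ ⋙ famTensor A₁) ⋙ T) where
  pt := Z
  ι :=
    { app := fun X => t X.left X.hom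
      naturality := fun X Y e =>
        (ht e.left Y.hom).trans ((congrArg (t X.left) (CostructuredArrow.w e)).trans
          (Category.comp_id _).symm) }

section Preserving

variable (T : G ⥤ G) {τ : Γ} [PreservesColimitsOfShape (CorOver ψ τ) T]

theorem legs_hom_ext {Z : G} {f g : T.obj (freeObj A₁ τ) ⟶ Z}
    (h : ∀ (X : FinFam (Cor ψ)) (r : (corUnion ψ).obj X ⟶ τ),
      T.map (leg A₁ r) ≫ f = T.map (leg A₁ r) ≫ g) : f = g :=
  (isColimitOfPreserves T (colimit.isColimit
    (CostructuredArrow.proj (corUnion ψ) τ ⋙ famTensor A₁))).hom_ext fun X => h X.left X.hom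

/-- The morphism from `T(P(τ))` given by its restrictions to the legs. -/
noncomputable def legsDesc {Z : G}
    (t : ∀ (X : FinFam (Cor ψ)) (_ : (corUnion ψ).obj X ⟶ τ), T.obj ((famTensor A₁).obj X) ⟶ Z)
    (ht : ∀ {X Y : FinFam (Cor ψ)} (e : X ⟶ Y) (r : (corUnion ψ).obj Y ⟶ τ),
      T.map ((famTensor A₁).map e) ≫ t Y r = t X ((corUnion ψ).map e ≫ r)) :
    T.obj (freeObj A₁ τ) ⟶ Z :=
  (isColimitOfPreserves T (colimit.isColimit
    (CostructuredArrow.proj (corUnion ψ) τ ⋙ famTensor A₁))).desc (legCocone T t ht)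

theorem leg_legsDesc {Z : G}
    (t : ∀ (X : FinFam (Cor ψ)) (_ : (corUnion ψ).obj X ⟶ τ), T.obj ((famTensor A₁).obj X) ⟶ Z)
    (ht : ∀ {X Y : FinFam (Cor ψ)} (e : X ⟶ Y) (r : (corUnion ψ).obj Y ⟶ τ),
      T.map ((famTensor A₁).map e) ≫ t Y r = t X ((corUnion ψ).map e ≫ r))
    {X : FinFam (Cor ψ)} (r : (corUnion ψ).obj X ⟶ τ) :
    T.map (leg A₁ r) ≫ legsDesc T t ht = t X r :=
  (isColimitOfPreserves T (colimit.isColimit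
    (CostructuredArrow.proj (corUnion ψ) τ ⋙ famTensor A₁))).fac (legCocone T t ht)
    (CostructuredArrow.mk r)

end Preserving

theorem leg_hom_ext {τ : Γ} {Z : G} {f g : freeObj A₁ τ ⟶ Z}
    (h : ∀ (X : FinFam (Cor ψ)) (r : (corUnion ψ).obj X ⟶ τ), leg A₁ r ≫ f = leg A₁ r ≫ g) :
    f = g :=
  legs_hom_ext (𝟭 G) h

/-- The morphism from `P(τ)` given by its restrictions to the legs. -/
noncomputable def legDesc {τ : Γ} {Z : G}
    (t : ∀ (X : FinFam (Cor ψ)) (_ : (corUnion ψ).obj X ⟶ τ), (famTensor A₁).obj X ⟶ Z)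
    (ht : ∀ {X Y : FinFam (Cor ψ)} (e : X ⟶ Y) (r : (corUnion ψ).obj Y ⟶ τ),
      (famTensor A₁).map e ≫ t Y r = t X ((corUnion ψ).map e ≫ r)) : freeObj A₁ τ ⟶ Z :=
  legsDesc (𝟭 G) t ht

theorem leg_legDesc {τ : Γ} {Z : G}
    (t : ∀ (X : FinFam (Cor ψ)) (_ : (corUnion ψ).obj X ⟶ τ), (famTensor A₁).obj X ⟶ Z)
    (ht : ∀ {X Y : FinFam (Cor ψ)} (e : X ⟶ Y) (r : (corUnion ψ).obj Y ⟶ τ),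
      (famTensor A₁).map e ≫ t Y r = t X ((corUnion ψ).map e ≫ r))
    {X : FinFam (Cor ψ)} (r : (corUnion ψ).obj X ⟶ τ) : leg A₁ r ≫ legDesc t ht = t X r :=
  leg_legsDesc (𝟭 G) t ht r

instance (τ : Γ) (X : G) : PreservesColimitsOfShape (CorOver ψ τ) (tensorLeft X) :=
  (distributiveShape ψ G τ).preserves_left X

instance (τ : Γ) (X : G) : PreservesColimitsOfShape (CorOver ψ τ) (tensorRight X) :=
  (distributiveShape ψ G τ).preserves_right X

theorem leg_hom_ext_left {τ : Γ} {W Z : G} {f g : W ⊗ freeObj A₁ τ ⟶ Z}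
    (h : ∀ (X : FinFam (Cor ψ)) (r : (corUnion ψ).obj X ⟶ τ),
      (W ◁ leg A₁ r) ≫ f = (W ◁ leg A₁ r) ≫ g) : f = g :=
  legs_hom_ext (tensorLeft W) h

theorem leg_hom_ext_right {τ : Γ} {W Z : G} {f g : freeObj A₁ τ ⊗ W ⟶ Z}
    (h : ∀ (X : FinFam (Cor ψ)) (r : (corUnion ψ).obj X ⟶ τ),
      (leg A₁ r ▷ W) ≫ f = (leg A₁ r ▷ W) ≫ g) : f = g :=
  legs_hom_ext (tensorRight W) h

theorem leg_hom_ext₂ {B₁ : Collection ψ G} {τ σ : Γ} {Z : G}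
    {f g : freeObj A₁ τ ⊗ freeObj B₁ σ ⟶ Z}
    (h : ∀ (X Y : FinFam (Cor ψ)) (r : (corUnion ψ).obj X ⟶ τ) (s : (corUnion ψ).obj Y ⟶ σ),
      (leg A₁ r ⊗ₘ leg B₁ s) ≫ f = (leg A₁ r ⊗ₘ leg B₁ s) ≫ g) : f = g := by
  refine leg_hom_ext_right fun X r => leg_hom_ext_left fun Y s => ?_
  have := h X Y r s
  rwa [MonoidalCategory.tensorHom_def', Category.assoc, Category.assoc] at this

theorem leg_hom_ext₃ {τ σ ρ : Γ} {Z : G}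
    {f g : (freeObj A₁ τ ⊗ freeObj A₁ σ) ⊗ freeObj A₁ ρ ⟶ Z}
    (h : ∀ (X Y W : FinFam (Cor ψ)) (r : (corUnion ψ).obj X ⟶ τ) (s : (corUnion ψ).obj Y ⟶ σ)
      (t : (corUnion ψ).obj W ⟶ ρ),
      ((leg A₁ r ⊗ₘ leg A₁ s) ⊗ₘ leg A₁ t) ≫ f = ((leg A₁ r ⊗ₘ leg A₁ s) ⊗ₘ leg A₁ t) ≫ g) :
    f = g := by
  refine leg_hom_ext_left fun W t => ?_
  refine legs_hom_ext (tensorLeft (freeObj A₁ τ) ⋙ tensorRight ((famTensor A₁).obj W))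
    fun Y s => ?_
  refine legs_hom_ext (tensorRight ((famTensor A₁).obj Y) ⋙ tensorRight ((famTensor A₁).obj W))
    fun X r => ?_
  have h1 : ((leg A₁ r ⊗ₘ leg A₁ s) ⊗ₘ leg A₁ t) =
      ((leg A₁ r ▷ (famTensor A₁).obj Y) ▷ (famTensor A₁).obj W) ≫
        ((freeObj A₁ τ ◁ leg A₁ s) ▷ (famTensor A₁).obj W) ≫
        ((freeObj A₁ τ ⊗ freeObj A₁ σ) ◁ leg A₁ t) := by
    rw [MonoidalCategory.tensorHom_def (leg A₁ r ⊗ₘ leg A₁ s),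
      MonoidalCategory.tensorHom_def (leg A₁ r), comp_whiskerRight, Category.assoc]
  have h2 := h X Y W r s t
  rw [h1, Category.assoc, Category.assoc, Category.assoc, Category.assoc] at h2
  exact h2

/-- The morphism from `P(τ) ⊗ P(σ)` given by its restrictions to the legs. -/
theorem exists_legDesc₂ {τ σ : Γ} {Z : G}
    (t : ∀ {X Y : FinFam (Cor ψ)} (_ : (corUnion ψ).obj X ⟶ τ) (_ : (corUnion ψ).obj Y ⟶ σ),
      (famTensor A₁).obj X ⊗ (famTensor A₁).obj Y ⟶ Z)
    (ht : ∀ {X Y X' Y' : FinFam (Cor ψ)} (e : X ⟶ X') (e' : Y ⟶ Y')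
      (r : (corUnion ψ).obj X' ⟶ τ) (s : (corUnion ψ).obj Y' ⟶ σ),
      ((famTensor A₁).map e ⊗ₘ (famTensor A₁).map e') ≫ t r s =
        t ((corUnion ψ).map e ≫ r) ((corUnion ψ).map e' ≫ s)) :
    ∃ d : freeObj A₁ τ ⊗ freeObj A₁ σ ⟶ Z, ∀ {X Y : FinFam (Cor ψ)}
      (r : (corUnion ψ).obj X ⟶ τ) (s : (corUnion ψ).obj Y ⟶ σ),
      (leg A₁ r ⊗ₘ leg A₁ s) ≫ d = t r s := by
  have h1 : ∀ (X : FinFam (Cor ψ)) (r : (corUnion ψ).obj X ⟶ τ),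
      ∃ d : (famTensor A₁).obj X ⊗ freeObj A₁ σ ⟶ Z, ∀ (Y : FinFam (Cor ψ))
        (s : (corUnion ψ).obj Y ⟶ σ), ((famTensor A₁).obj X ◁ leg A₁ s) ≫ d = t r s := by
    intro X r
    have h2 : ∀ {Y Y' : FinFam (Cor ψ)} (e : Y ⟶ Y') (s : (corUnion ψ).obj Y' ⟶ σ),
        ((famTensor A₁).obj X ◁ (famTensor A₁).map e) ≫ t r s =
          t r ((corUnion ψ).map e ≫ s) := by
      intro Y Y' e s
      have := ht (𝟙 X) e r s
      rwa [(famTensor A₁).map_id, (corUnion ψ).map_id, Category.id_comp, id_tensorHom] at this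
    exact ⟨_, fun Y s => leg_legsDesc (tensorLeft ((famTensor A₁).obj X)) (fun Y s => t r s) h2 s⟩
  choose d hd using h1
  have h3 : ∀ {X X' : FinFam (Cor ψ)} (e : X ⟶ X') (r : (corUnion ψ).obj X' ⟶ τ),
      ((famTensor A₁).map e ▷ freeObj A₁ σ) ≫ d X' r = d X ((corUnion ψ).map e ≫ r) := by
    intro X X' e r
    refine leg_hom_ext_left fun Y s => ?_
    have := ht e (𝟙 Y) r s
    rw [(famTensor A₁).map_id, (corUnion ψ).map_id, Category.id_comp, tensorHom_id] at this
    refine Eq.trans ?_ (hd _ ((corUnion ψ).map e ≫ r) Y s).symm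
    rw [← this, whisker_exchange_assoc, hd]
  refine ⟨legsDesc (tensorRight (freeObj A₁ σ)) d h3, fun {X Y} r s => ?_⟩
  have h2 := leg_legsDesc (tensorRight (freeObj A₁ σ)) d h3 r
  rw [MonoidalCategory.tensorHom_def', Category.assoc]
  exact (congrArg (_ ≫ ·) h2).trans (hd X r Y s)

variable (A₁)

/-- The action of a morphism on the free operad. -/
noncomputable def freeMap {τ σ : Γ} (g : τ ⟶ σ) : freeObj A₁ τ ⟶ freeObj A₁ σ :=
  legDesc (fun _ r => leg A₁ (r ≫ g)) fun e r => by rw [map_leg, Category.assoc]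

theorem leg_map {X : FinFam (Cor ψ)} {τ σ : Γ} (r : (corUnion ψ).obj X ⟶ τ) (g : τ ⟶ σ) :
    leg A₁ r ≫ freeMap A₁ g = leg A₁ (r ≫ g) :=
  leg_legDesc (fun _ r => leg A₁ (r ≫ g)) (fun e r => by rw [map_leg, Category.assoc]) _

/-- The free operad as a functor. -/
noncomputable def freeFunctor : Γ ⥤ G where
  obj τ := freeObj A₁ τ
  map g := freeMap A₁ g
  map_id τ := leg_hom_ext fun X r => by
    rw [leg_map, Category.comp_id, Category.comp_id]
  map_comp f g := leg_hom_ext fun X r => by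
    rw [leg_map, ← Category.assoc (leg A₁ r), leg_map, leg_map, Category.assoc]

/-- A version of `exists_lift_along_grafting` without change of the family. -/
theorem exists_lift_along_grafting' {τ σ : Γ} {g : τ ⟶ σ} (hg : IsGrafting ψ g)
    {X : FinFam (Cor ψ)} (q : (corUnion ψ).obj X ⟶ σ) :
    ∃ r : (corUnion ψ).obj X ⟶ τ, r ≫ g = q := by
  obtain ⟨Y, r, e, h⟩ := exists_lift_along_grafting ψ g hg q
  refine ⟨(corUnion ψ).map (inv e) ≫ r, ?_⟩
  rw [Category.assoc, ← h, ← Category.assoc, ← (corUnion ψ).map_comp, IsIso.inv_hom_id,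
    (corUnion ψ).map_id, Category.id_comp]

/-- Graftings act by isomorphisms, because morphisms from unions of corollas lift uniquely along
them. -/
theorem isIso_freeFunctor_map {τ σ : Γ} (g : τ ⟶ σ) (hg : IsGrafting ψ g) :
    IsIso (freeMap A₁ g) := by
  choose l hl using fun (X : FinFam (Cor ψ)) (q : (corUnion ψ).obj X ⟶ σ) =>
    exists_lift_along_grafting' hg q
  have h1 : ∀ {X Y : FinFam (Cor ψ)} (e : X ⟶ Y) (r : (corUnion ψ).obj Y ⟶ σ),
      (famTensor A₁).map e ≫ leg A₁ (l Y r) = leg A₁ (l X ((corUnion ψ).map e ≫ r)) := by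
    intro X Y e r
    rw [map_leg]
    refine congrArg (leg A₁) (grafting_cancel ψ hg ?_)
    rw [Category.assoc, hl, hl]
  refine ⟨legDesc (fun X q => leg A₁ (l X q)) h1, leg_hom_ext fun X r => ?_,
    leg_hom_ext fun X q => ?_⟩
  · rw [← Category.assoc, leg_map, leg_legDesc,
      grafting_cancel ψ hg (hl X (r ≫ g))]
    exact (Category.comp_id _).symm
  · rw [← Category.assoc, leg_legDesc]
    refine (leg_map A₁ _ g).trans ?_
    rw [hl]
    exact (Category.comp_id _).symm

theorem exists_freeMul (τ σ : Γ) : ∃ m : freeObj A₁ τ ⊗ freeObj A₁ σ ⟶ freeObj A₁ (τ ⊗ σ),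
    ∀ {X Y : FinFam (Cor ψ)} (r : (corUnion ψ).obj X ⟶ τ) (s : (corUnion ψ).obj Y ⟶ σ),
      (leg A₁ r ⊗ₘ leg A₁ s) ≫ m = famμ A₁ X Y ≫ leg A₁ (corPair ψ r s) := by
  refine exists_legDesc₂ (fun {X Y} r s => famμ A₁ X Y ≫ leg A₁ (corPair ψ r s)) ?_
  intro X Y X' Y' e e' r s
  refine (comp_assoc_of_eq (famμ_natural A₁ e e') _).trans ?_
  rw [map_leg, map_corPair]

/-- The multiplication `P(τ) ⊗ P(σ) ⟶ P(τ ⊔ σ)` of the free operad. -/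
noncomputable def freeMul (τ σ : Γ) : freeObj A₁ τ ⊗ freeObj A₁ σ ⟶ freeObj A₁ (τ ⊗ σ) :=
  (exists_freeMul A₁ τ σ).choose

theorem leg_freeMul {X Y : FinFam (Cor ψ)} {τ σ : Γ} (r : (corUnion ψ).obj X ⟶ τ)
    (s : (corUnion ψ).obj Y ⟶ σ) :
    (leg A₁ r ⊗ₘ leg A₁ s) ≫ freeMul A₁ τ σ = famμ A₁ X Y ≫ leg A₁ (corPair ψ r s) :=
  (exists_freeMul A₁ τ σ).choose_spec r s

/-- The unit of the free operad. -/
noncomputable def freeUnit : 𝟙_ G ⟶ freeObj A₁ (𝟙_ Γ) := famε A₁ ≫ leg A₁ (inv (corε ψ))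

theorem isIso_freeUnit : IsIso (freeUnit A₁) := by
  have h0 : ∀ (X : FinFam (Cor ψ)) (_ : (corUnion ψ).obj X ⟶ 𝟙_ Γ),
      Nonempty (X ⟶ empty (Cor ψ)) := fun X q => by
    have := isEmpty_of_hom_unit ψ q
    exact ⟨⟨Equiv.equivOfIsEmpty _ _, fun i => isEmptyElim i⟩⟩
  have h1 : ∀ {X : FinFam (Cor ψ)} (e e' : X ⟶ empty (Cor ψ)), e = e' := fun {X} e e' => by
    have : IsEmpty X.ι := ⟨fun i => (FinFam.Hom.e e i : Empty).elim⟩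
    exact hom_ext_famMap (FamMap.ext_of_app fun i => isEmptyElim i)
  have l := fun (X : FinFam (Cor ψ)) q => (h0 X q).some
  have h2 : ∀ {X Y : FinFam (Cor ψ)} (e : X ⟶ Y) (r : (corUnion ψ).obj Y ⟶ 𝟙_ Γ),
      (famTensor A₁).map e ≫ (famTensor A₁).map (l Y r) ≫ inv (famε A₁) =
        (famTensor A₁).map (l X ((corUnion ψ).map e ≫ r)) ≫ inv (famε A₁) := by
    intro X Y e r
    rw [← Category.assoc, ← (famTensor A₁).map_comp, h1 (e ≫ l Y r)]
  refine ⟨legDesc (fun X q => (famTensor A₁).map (l X q) ≫ inv (famε A₁)) h2, ?_,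
    leg_hom_ext fun X q => ?_⟩
  · rw [freeUnit, Category.assoc, leg_legDesc, h1 (l _ _) (𝟙 _), (famTensor A₁).map_id,
      Category.id_comp, IsIso.hom_inv_id]
  · rw [← Category.assoc, leg_legDesc, freeUnit, Category.assoc, IsIso.inv_hom_id_assoc, map_leg,
      hom_unit_unique ψ (_ ≫ inv (corε ψ)) q]
    exact (Category.comp_id _).symm

/-- A version of `exists_corPair` with the isomorphism of families in the other direction. -/
theorem exists_corPair' {τ σ : Γ} (X : FinFam (Cor ψ)) (q : (corUnion ψ).obj X ⟶ τ ⊗ σ) :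
    ∃ (Y Y' : FinFam (Cor ψ)) (r : (corUnion ψ).obj Y ⟶ τ) (s : (corUnion ψ).obj Y' ⟶ σ)
      (e : X ⟶ sum Y Y'), q = (corUnion ψ).map e ≫ corPair ψ r s := by
  obtain ⟨Y, Y', r, s, e, h⟩ := exists_corPair ψ q
  refine ⟨Y, Y', r, s, inv e, ?_⟩
  rw [← h, ← Category.assoc, ← (corUnion ψ).map_comp, IsIso.inv_hom_id, (corUnion ψ).map_id,
    Category.id_comp]

/-- The inverse of the multiplication is well defined: splittings of isomorphic morphisms to `τ ⊔ σ`
give the same morphism to `P(τ) ⊗ P(σ)`. -/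
theorem map_inv_famμ_leg {X X' Y Y' : FinFam (Cor ψ)} {τ σ : Γ} (r : (corUnion ψ).obj X ⟶ τ)
    (s : (corUnion ψ).obj Y ⟶ σ) (r' : (corUnion ψ).obj X' ⟶ τ) (s' : (corUnion ψ).obj Y' ⟶ σ)
    (e : sum X Y ⟶ sum X' Y') (he : (corUnion ψ).map e ≫ corPair ψ r' s' = corPair ψ r s) :
    (famTensor A₁).map e ≫ inv (famμ A₁ X' Y') ≫ (leg A₁ r' ⊗ₘ leg A₁ s') =
      inv (famμ A₁ X Y) ≫ (leg A₁ r ⊗ₘ leg A₁ s) := by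
  have := GraphCategory.faithful (ψ := ψ)
  obtain ⟨f, g, rfl, hf, hg⟩ := exists_sumMap_of_corPair ψ r s r' s' e he
  rw [← hf, ← hg, ← map_leg, ← map_leg, ← tensorHom_comp_tensorHom, IsIso.eq_inv_comp,
    ← comp_assoc_of_eq (famμ_natural A₁ f g), IsIso.hom_inv_id_assoc]

/-- The multiplication is invertible, because morphisms from unions of corollas to `τ ⊔ σ` split
uniquely into morphisms to `τ` and to `σ`. -/
theorem isIso_freeMul (τ σ : Γ) : IsIso (freeMul A₁ τ σ) := by
  choose Y Y' r s e h using fun (X : FinFam (Cor ψ)) (q : (corUnion ψ).obj X ⟶ τ ⊗ σ) =>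
    exists_corPair' X q
  let t : ∀ (X : FinFam (Cor ψ)) (_ : (corUnion ψ).obj X ⟶ τ ⊗ σ),
      (famTensor A₁).obj X ⟶ freeObj A₁ τ ⊗ freeObj A₁ σ := fun X q =>
    (famTensor A₁).map (e X q) ≫ inv (famμ A₁ _ _) ≫ (leg A₁ (r X q) ⊗ₘ leg A₁ (s X q))
  -- the chosen splittings may be replaced by arbitrary ones
  have key : ∀ {Z Z' X : FinFam (Cor ψ)} (r' : (corUnion ψ).obj Z ⟶ τ)
      (s' : (corUnion ψ).obj Z' ⟶ σ) (a : sum Z Z' ⟶ X) (q : (corUnion ψ).obj X ⟶ τ ⊗ σ),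
      (corUnion ψ).map a ≫ q = corPair ψ r' s' →
      (famTensor A₁).map a ≫ t X q = inv (famμ A₁ _ _) ≫ (leg A₁ r' ⊗ₘ leg A₁ s') := by
    intro Z Z' X r' s' a q ha
    rw [← Category.assoc, ← (famTensor A₁).map_comp]
    refine map_inv_famμ_leg A₁ r' s' _ _ _ ?_
    rw [(corUnion ψ).map_comp, Category.assoc, ← h, ha]
  have ht : ∀ {X X' : FinFam (Cor ψ)} (a : X ⟶ X') (q : (corUnion ψ).obj X' ⟶ τ ⊗ σ),
      (famTensor A₁).map a ≫ t X' q = t X ((corUnion ψ).map a ≫ q) := by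
    intro X X' a q
    have h1 := key (r X ((corUnion ψ).map a ≫ q)) (s X ((corUnion ψ).map a ≫ q))
      (inv (e X ((corUnion ψ).map a ≫ q)) ≫ a) q (by
        rw [(corUnion ψ).map_comp, Category.assoc, (corUnion ψ).map_inv, IsIso.inv_comp_eq]
        exact h X ((corUnion ψ).map a ≫ q))
    rw [(famTensor A₁).map_comp, Category.assoc, (famTensor A₁).map_inv,
      IsIso.inv_comp_eq] at h1
    exact h1
  refine ⟨legDesc t ht, leg_hom_ext₂ fun X X' r' s' => ?_, leg_hom_ext fun X q => ?_⟩
  · rw [← Category.assoc, leg_freeMul, Category.assoc, leg_legDesc]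
    have h1 := key r' s' (𝟙 _) _ (by rw [(corUnion ψ).map_id, Category.id_comp])
    rw [(famTensor A₁).map_id, Category.id_comp] at h1
    rw [h1, IsIso.hom_inv_id_assoc, Category.comp_id]
  · rw [← Category.assoc, leg_legDesc, Category.assoc, Category.assoc, leg_freeMul,
      IsIso.inv_hom_id_assoc, map_leg, ← h]
    exact (Category.comp_id _).symm

theorem freeMul_natural {τ σ τ' σ' : Γ} (f : τ ⟶ τ') (g : σ ⟶ σ') :
    (freeMap A₁ f ⊗ₘ freeMap A₁ g) ≫ freeMul A₁ τ' σ' =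
      freeMul A₁ τ σ ≫ freeMap A₁ (f ⊗ₘ g) := by
  refine leg_hom_ext₂ fun X Y r s => ?_
  rw [tensorHom_comp_tensorHom_assoc, leg_map, leg_map, leg_freeMul, ← Category.assoc,
    leg_freeMul, Category.assoc, leg_map, corPair_comp]

theorem freeMul_assoc (τ σ ρ : Γ) : (freeMul A₁ τ σ ▷ freeObj A₁ ρ) ≫ freeMul A₁ (τ ⊗ σ) ρ ≫
      freeMap A₁ (α_ τ σ ρ).hom =
    (α_ _ _ _).hom ≫ (freeObj A₁ τ ◁ freeMul A₁ σ ρ) ≫ freeMul A₁ τ (σ ⊗ ρ) := by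
  refine leg_hom_ext₃ fun X Y Z r s t => ?_
  calc _ = (famμ A₁ X Y ▷ (famTensor A₁).obj Z) ≫ (leg A₁ (corPair ψ r s) ⊗ₘ leg A₁ t) ≫
        freeMul A₁ (τ ⊗ σ) ρ ≫ freeMap A₁ (α_ τ σ ρ).hom := by
        rw [← tensorHom_id, ← tensorHom_id, tensorHom_comp_tensorHom_assoc,
          tensorHom_comp_tensorHom_assoc, leg_freeMul, Category.comp_id, Category.id_comp]
    _ = ((famμ A₁ X Y ▷ (famTensor A₁).obj Z) ≫ famμ A₁ (sum X Y) Z ≫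
        (famTensor A₁).map (sumAssoc X Y Z)) ≫ leg A₁ (corPair ψ r (corPair ψ s t)) := by
        rw [← Category.assoc (leg A₁ _ ⊗ₘ _), leg_freeMul, Category.assoc, leg_map,
          ← sumAssoc_corPair, ← map_leg]
        simp only [Category.assoc]
    _ = (α_ _ _ _).hom ≫ ((famTensor A₁).obj X ◁ famμ A₁ Y Z) ≫
        (leg A₁ r ⊗ₘ leg A₁ (corPair ψ s t)) ≫ freeMul A₁ τ (σ ⊗ ρ) := by
        rw [famμ_assoc, leg_freeMul]
        simp only [Category.assoc]
    _ = (α_ _ _ _).hom ≫ (leg A₁ r ⊗ₘ (leg A₁ s ⊗ₘ leg A₁ t)) ≫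
        (freeObj A₁ τ ◁ freeMul A₁ σ ρ) ≫ freeMul A₁ τ (σ ⊗ ρ) := by
        rw [← id_tensorHom, ← id_tensorHom, tensorHom_comp_tensorHom_assoc,
          tensorHom_comp_tensorHom_assoc, leg_freeMul, Category.comp_id, Category.id_comp]
    _ = _ := by rw [associator_naturality_assoc]

theorem freeMul_unit (τ : Γ) : (λ_ (freeObj A₁ τ)).hom =
    (freeUnit A₁ ▷ freeObj A₁ τ) ≫ freeMul A₁ (𝟙_ Γ) τ ≫
      freeMap A₁ (λ_ τ).hom := by
  refine leg_hom_ext_left fun X r => ?_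
  calc _ = (λ_ _).hom ≫ leg A₁ r := leftUnitor_naturality _
    _ = ((famε A₁ ▷ (famTensor A₁).obj X) ≫ famμ A₁ (empty _) X ≫
        (famTensor A₁).map (emptySum X)) ≫ leg A₁ r := by rw [famμ_empty_left]
    _ = (famε A₁ ▷ (famTensor A₁).obj X) ≫ (leg A₁ (inv (corε ψ)) ⊗ₘ leg A₁ r) ≫
        freeMul A₁ (𝟙_ Γ) τ ≫ freeMap A₁ (λ_ τ).hom := by
        rw [← Category.assoc (leg A₁ _ ⊗ₘ _), leg_freeMul, Category.assoc, Category.assoc,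
          Category.assoc, leg_map, ← emptySum_corPair, map_leg]
    _ = _ := by
        rw [freeUnit, ← tensorHom_id, ← tensorHom_id, ← id_tensorHom,
          tensorHom_comp_tensorHom_assoc, tensorHom_comp_tensorHom_assoc, Category.id_comp,
          Category.id_comp, Category.comp_id]

theorem freeMul_braid (τ σ : Γ) : freeMul A₁ τ σ ≫ freeMap A₁ (β_ τ σ).hom =
    (β_ _ _).hom ≫ freeMul A₁ σ τ := by
  refine leg_hom_ext₂ fun X Y r s => ?_
  rw [← Category.assoc, leg_freeMul, Category.assoc, leg_map, ← sumComm_corPair, ← map_leg,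
    BraidedCategory.braiding_naturality_assoc, leg_freeMul]
  exact (comp_assoc_of_eq (famμ_braid A₁ X Y) _).symm

/-- The free operad generated by a collection. -/
noncomputable def freeOperad : Operad ψ G :=
  Operad.ofMul (freeFunctor A₁) (freeUnit A₁) (freeMul A₁) (isIso_freeUnit A₁) (isIso_freeMul A₁)
    (freeMul_natural A₁) (freeMul_assoc A₁) (freeMul_unit A₁) (freeMul_braid A₁)
    (isIso_freeFunctor_map A₁)

end FreeOperad

/-! ### Evaluation of families of elements in an operad -/

section Evaluation

open FinFam Functor.LaxMonoidal

theorem FinFam.famε_app {C : Type u} [Category.{v} C] {D : Type u'} [Category.{v'} D]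
    [MonoidalCategory D] [SymmetricCategory D] {A A' : C ⥤ D} (t : ∀ a, A.obj a ⟶ A'.obj a) :
    famε A ≫ famApp t (empty C) = famε A' := by
  have h1 := Tr1.comp (famε_spec A)
    (tensor_map_spec (homMk (fun i : (empty C).ι => t ((empty C).obj i))))
  have h2 : Tr1 (FamMap.comp (FamMap.id (fun i => A.obj ((empty C).obj i)))
      (Hom.toFamMap (homMk fun i : (empty C).ι => t ((empty C).obj i)))) (l := [])
      (n := Finset.univ.toList) (famε A') :=
    ⟨_, reorder_spec _ _, (Category.id_comp _).symm⟩
  exact Tr1.unique (Finset.nodup_toList _) h1 h2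

variable {Γ : Type u} [Category.{v} Γ] [MonoidalCategory Γ] [SymmetricCategory Γ]
  {ψ : Γ ⥤ Graph} [ψ.Braided] {G : Type u'} [Category.{v'} G] [MonoidalCategory G]
  [SymmetricCategory G]

namespace Operad

/-- The comparison `⨂ᵢ O(Xᵢ) ⟶ O(∐ Xᵢ)` for a family of corollas. -/
noncomputable def cmp (O : Operad ψ G) (X : FinFam (Cor ψ)) :
    (famTensor ((coll ψ G).obj O)).obj X ⟶ O.functor.obj ((corUnion ψ).obj X) :=
  (comparison O.functor).app ((mapFunctor (corInclusion ψ)).obj X)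

instance (O : Operad ψ G) (X : FinFam (Cor ψ)) : IsIso (O.cmp X) :=
  inferInstanceAs (IsIso ((comparison O.functor).app ((mapFunctor (corInclusion ψ)).obj X)))

theorem cmp_natural (O : Operad ψ G) {X Y : FinFam (Cor ψ)} (e : X ⟶ Y) :
    (famTensor ((coll ψ G).obj O)).map e ≫ O.cmp Y = O.cmp X ≫ O.functor.map ((corUnion ψ).map e) :=
  (comparison O.functor).naturality ((mapFunctor (corInclusion ψ)).map e)

theorem cmp_sum (O : Operad ψ G) (X Y : FinFam (Cor ψ)) :
    (O.cmp X ⊗ₘ O.cmp Y) ≫ μ O.functor _ _ ≫ O.functor.map (corμ ψ X Y) =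
      famμ ((coll ψ G).obj O) X Y ≫ O.cmp (sum X Y) :=
  famμ_comparison O.functor (corInclusion ψ) X Y

theorem cmp_empty (O : Operad ψ G) :
    famε ((coll ψ G).obj O) ≫ O.cmp (empty (Cor ψ)) = ε O.functor ≫ O.functor.map (corε ψ) :=
  famε_comparison O.functor (corInclusion ψ)

theorem cmp_single (O : Operad ψ G) (a : Cor ψ) :
    famOne ((coll ψ G).obj O) a ≫ O.cmp (single a) = O.functor.map (corOne ψ a) :=
  famOne_comparison O.functor (corInclusion ψ) a

/-- Monoidal transformations are compatible with iterated tensor products, not only with binary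
ones. -/
theorem cmp_hom {O O' : Operad ψ G} (f : O ⟶ O') (X : FinFam (Cor ψ)) :
    O.cmp X ≫ f.natTrans.app ((corUnion ψ).obj X) =
      famApp ((coll ψ G).map f).app X ≫ O'.cmp X := by
  have := f.isMonoidal
  refine FinFam.induction (motive := fun X => O.cmp X ≫ f.natTrans.app ((corUnion ψ).obj X) =
    famApp ((coll ψ G).map f).app X ≫ O'.cmp X) (fun {X Y} e _ h => ?_) ?_ (fun a X h => ?_) X
  · rw [← cancel_epi ((famTensor ((coll ψ G).obj O)).map e),
      comp_assoc_of_eq (famApp_natural ((coll ψ G).map f) e), cmp_natural,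
      comp_assoc_of_eq (cmp_natural O e), ← Category.assoc (famApp _ _), ← h, Category.assoc,
      f.natTrans.naturality]
  · rw [← cancel_epi (famε ((coll ψ G).obj O)), comp_assoc_of_eq (cmp_empty O),
      f.natTrans.naturality, ← Category.assoc, NatTrans.IsMonoidal.unit, ← cmp_empty,
      ← Category.assoc (famε ((coll ψ G).obj O))]
    exact congrArg (· ≫ O'.cmp _)
      (famε_app (A := (coll ψ G).obj O) (A' := (coll ψ G).obj O') ((coll ψ G).map f).app).symm
  · have h1 : O.cmp (single a) ≫ f.natTrans.app ((corUnion ψ).obj (single a)) =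
        famApp ((coll ψ G).map f).app (single a) ≫ O'.cmp (single a) := by
      have : IsIso (famOne ((coll ψ G).obj O) a) := isIso_tensorOne _
      have h2 := famOne_app (A := (coll ψ G).obj O) (A' := (coll ψ G).obj O')
        ((coll ψ G).map f).app a
      rw [← cancel_epi (famOne ((coll ψ G).obj O) a), comp_assoc_of_eq h2, cmp_single,
        ← Category.assoc, cmp_single]
      exact f.natTrans.naturality (corOne ψ a)
    have h3 := famμ_app (A := (coll ψ G).obj O) (A' := (coll ψ G).obj O')
      ((coll ψ G).map f).app (single a) X
    rw [← cancel_epi (famμ ((coll ψ G).obj O) (single a) X), ← Category.assoc (famμ _ _ _),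
      ← cmp_sum, Category.assoc, Category.assoc, f.natTrans.naturality,
      ← Category.assoc (μ O.functor _ _), NatTrans.IsMonoidal.tensor, Category.assoc,
      tensorHom_comp_tensorHom_assoc, h1, h, ← comp_assoc_of_eq h3, ← cmp_sum,
      tensorHom_comp_tensorHom_assoc]

variable {A₁ : Collection ψ G} {O O' : Operad ψ G}

/-- The morphism `⨂ᵢ A₁(Xᵢ) ⟶ O(∐ Xᵢ)` induced by a morphism of collections `A₁ ⟶ O`. -/
noncomputable def eval (j : A₁ ⟶ (coll ψ G).obj O) (X : FinFam (Cor ψ)) :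
    (famTensor A₁).obj X ⟶ O.functor.obj ((corUnion ψ).obj X) :=
  famApp j.app X ≫ O.cmp X

theorem eval_natural (j : A₁ ⟶ (coll ψ G).obj O) {X Y : FinFam (Cor ψ)} (e : X ⟶ Y) :
    (famTensor A₁).map e ≫ eval j Y = eval j X ≫ O.functor.map ((corUnion ψ).map e) := by
  rw [eval, eval, comp_assoc_of_eq (famApp_natural j e), cmp_natural, Category.assoc]

theorem eval_sum (j : A₁ ⟶ (coll ψ G).obj O) (X Y : FinFam (Cor ψ)) :
    (eval j X ⊗ₘ eval j Y) ≫ μ O.functor _ _ ≫ O.functor.map (corμ ψ X Y) =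
      famμ A₁ X Y ≫ eval j (sum X Y) := by
  have h := famμ_app (A := A₁) (A' := (coll ψ G).obj O) j.app X Y
  rw [eval, eval, eval, ← tensorHom_comp_tensorHom, Category.assoc, cmp_sum,
    comp_assoc_of_eq h]

theorem eval_empty (j : A₁ ⟶ (coll ψ G).obj O) :
    famε A₁ ≫ eval j (empty (Cor ψ)) = ε O.functor ≫ O.functor.map (corε ψ) := by
  have h := famε_app (A := A₁) (A' := (coll ψ G).obj O) j.app
  rw [eval, ← Category.assoc, h, cmp_empty]

theorem eval_single (j : A₁ ⟶ (coll ψ G).obj O) (a : Cor ψ) :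
    famOne A₁ a ≫ eval j (single a) = j.app a ≫ O.functor.map (corOne ψ a) := by
  have h := famOne_app (A := A₁) (A' := (coll ψ G).obj O) j.app a
  rw [eval, comp_assoc_of_eq h, cmp_single]

theorem eval_hom (j : A₁ ⟶ (coll ψ G).obj O) (f : O ⟶ O') (X : FinFam (Cor ψ)) :
    eval j X ≫ f.natTrans.app ((corUnion ψ).obj X) = eval (j ≫ (coll ψ G).map f) X := by
  rw [eval, eval, Category.assoc, cmp_hom, ← Category.assoc]
  refine congrArg (· ≫ _) ((tensor.map_comp _ _).symm.trans rfl)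

/-- A morphism of operads is determined by its values on corollas. -/
theorem app_eq_of_forall_app_corolla {f g : O ⟶ O'} [GraphCategory ψ]
    (h : ∀ σ : Cor ψ, f.natTrans.app ((corInclusion ψ).obj σ) =
      g.natTrans.app ((corInclusion ψ).obj σ)) : f = g := by
  have h0 : (coll ψ G).map f = (coll ψ G).map g := by
    ext σ
    exact h σ
  refine hom_ext (NatTrans.ext (funext fun τ => ?_))
  have := O.isIso_map _ (totalGrafting ψ τ).isGrafting
  rw [← cancel_epi (O.functor.map (totalGrafting ψ τ).map), f.natTrans.naturality,
    g.natTrans.naturality, ← cancel_epi (O.cmp _), ← Category.assoc, ← Category.assoc (O.cmp _),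
    cmp_hom, cmp_hom, h0]

end Operad

end Evaluation

/-! ### Exactness of the tensor product -/

section TensorExactness

variable {G : Type u'} [Category.{v'} G] [Abelian G] [MonoidalCategory G] [ExactTensor G]

instance (X : G) : PreservesFiniteColimits (tensorLeft X) :=
  ExactTensor.preservesFiniteColimits_left X

instance (X : G) : PreservesFiniteColimits (tensorRight X) :=
  ExactTensor.preservesFiniteColimits_right X

instance (X : G) : PreservesFiniteLimits (tensorLeft X) :=
  ExactTensor.preservesFiniteLimits_left X

instance (X : G) : PreservesFiniteLimits (tensorRight X) :=
  ExactTensor.preservesFiniteLimits_right X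

instance whiskerLeft_epi (X : G) {Y Z : G} (f : Y ⟶ Z) [Epi f] : Epi (X ◁ f) :=
  inferInstanceAs (Epi ((tensorLeft X).map f))

instance whiskerRight_epi (X : G) {Y Z : G} (f : Y ⟶ Z) [Epi f] : Epi (f ▷ X) :=
  inferInstanceAs (Epi ((tensorRight X).map f))

instance whiskerLeft_mono (X : G) {Y Z : G} (f : Y ⟶ Z) [Mono f] : Mono (X ◁ f) :=
  inferInstanceAs (Mono ((tensorLeft X).map f))

instance whiskerRight_mono (X : G) {Y Z : G} (f : Y ⟶ Z) [Mono f] : Mono (f ▷ X) :=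
  inferInstanceAs (Mono ((tensorRight X).map f))

instance tensorHom_epi {X Y X' Y' : G} (f : X ⟶ Y) (g : X' ⟶ Y') [Epi f] [Epi g] :
    Epi (f ⊗ₘ g) := by
  rw [MonoidalCategory.tensorHom_def]
  infer_instance

instance tensorHom_mono {X Y X' Y' : G} (f : X ⟶ Y) (g : X' ⟶ Y') [Mono f] [Mono g] :
    Mono (f ⊗ₘ g) := by
  rw [MonoidalCategory.tensorHom_def]
  infer_instance

end TensorExactness

/-! ### Presentations of operads -/

section Presentations

open FinFam Functor.LaxMonoidal Operad

variable {Γ : Type u} [Category.{v} Γ] [MonoidalCategory Γ] [SymmetricCategory Γ]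
  {ψ : Γ ⥤ Graph} [ψ.Braided] [GraphCategory ψ]
  {G : Type u'} [Category.{v'} G] [Abelian G] [MonoidalCategory G] [SymmetricCategory G]
  [ExactTensor G]

theorem epi_famApp {C : Type*} [Category* C] {A A' : C ⥤ G} (t : ∀ a, A.obj a ⟶ A'.obj a)
    (ht : ∀ a, Epi (t a)) (X : FinFam C) : Epi (famApp t X) := by
  have h : ∀ (l : List X.ι), Epi (listMap (Y := fun i => A'.obj (X.obj i)) _root_.id
      (fun i => t (X.obj i)) l) := by
    intro l
    induction l with
    | nil => exact inferInstanceAs (Epi (𝟙 _))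
    | cons a l ih =>
      have := ht (X.obj a)
      exact inferInstanceAs (Epi (t (X.obj a) ⊗ₘ listMap _ _ l))
  have h1 := h Finset.univ.toList
  have h2 := (reorder_spec (fun i => A'.obj (X.obj i))
    (perm_toList (Equiv.refl X.ι))).isIso
  exact epi_comp' h1 (@IsIso.epi_of_iso _ _ _ _ _ h2)

/-- A morphism of operads that is epi on corollas is epi everywhere. -/
theorem Operad.epi_app {O O' : Operad ψ G} (f : O ⟶ O')
    (h : ∀ σ : Cor ψ, Epi (f.natTrans.app ((corInclusion ψ).obj σ))) (τ : Γ) :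
    Epi (f.natTrans.app τ) := by
  have h1 : Epi (famApp (A := (coll ψ G).obj O) (A' := (coll ψ G).obj O')
      ((coll ψ G).map f).app (totalGrafting ψ τ).cor ≫ O'.cmp (totalGrafting ψ τ).cor) :=
    epi_comp' (epi_famApp _ h _) inferInstance
  rw [← cmp_hom] at h1
  have h2 : Epi (f.natTrans.app ((corUnion ψ).obj (totalGrafting ψ τ).cor)) := by
    exact epi_of_epi (O.cmp _) _
  have := O.isIso_map _ (totalGrafting ψ τ).isGrafting
  have := O'.isIso_map _ (totalGrafting ψ τ).isGrafting
  have h3 : Epi (f.natTrans.app _ ≫ O'.functor.map (totalGrafting ψ τ).map) :=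
    epi_comp' h2 inferInstance
  rw [← f.natTrans.naturality] at h3
  exact epi_of_epi (O.functor.map (totalGrafting ψ τ).map) _

variable [HasGraphColimits ψ G] {A₁ : Collection ψ G} {A O : Operad ψ G}

/-- The morphism `𝓕(A₁) ⟶ A`, restricted to the part of the colimit belonging to `h : τ ⟶ σ`, in
terms of `eval`. -/
theorem overDiagramι_desc (i : A₁ ⟶ (coll ψ G).obj A) (σ : Cor ψ) {τ : Γ}
    (h : τ ⟶ (corInclusion ψ).obj σ) :
    overDiagramι A₁ σ h ≫ (freeCollectionDesc i).app σ =
      eval i (totalGrafting ψ τ).cor ≫ A.functor.map (totalGrafting ψ τ).map ≫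
        A.functor.map h :=
  (overDiagramι_freeDescCocone_desc i σ h).trans (by
    refine (Category.assoc _ _ _).trans (Eq.trans ?_ (Category.assoc _ _ _).symm)
    exact congrArg (_ ≫ ·) (Category.assoc _ _ _))

theorem overDiagramι_hom_ext {σ : Cor ψ} {Z : G} {f g : (freeCollection A₁).obj σ ⟶ Z}
    (h : ∀ {τ : Γ} (h : τ ⟶ (corInclusion ψ).obj σ),
      overDiagramι A₁ σ h ≫ f = overDiagramι A₁ σ h ≫ g) : f = g :=
  colimit.hom_ext fun X => h X.of.hom

theorem freeCollectionDesc_comp (i : A₁ ⟶ (coll ψ G).obj A) (f : A ⟶ O) :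
    freeCollectionDesc i ≫ (coll ψ G).map f = freeCollectionDesc (i ≫ (coll ψ G).map f) := by
  ext σ
  refine overDiagramι_hom_ext fun {τ} h => ?_
  have h1 := overDiagramι_desc (i ≫ (coll ψ G).map f) σ h
  have h2 := overDiagramι_desc i σ h
  refine Eq.trans ?_ h1.symm
  refine (Category.assoc _ _ _).symm.trans ((congrArg (· ≫ _) h2).trans ?_)
  have h3 : (A.functor.map (totalGrafting ψ τ).map ≫ A.functor.map h) ≫
      f.natTrans.app ((corInclusion ψ).obj σ) = f.natTrans.app _ ≫
        O.functor.map (totalGrafting ψ τ).map ≫ O.functor.map h := by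
    rw [Category.assoc, f.natTrans.naturality, f.natTrans.naturality_assoc]
  have h4 := congrArg (· ≫ O.functor.map (totalGrafting ψ τ).map ≫ O.functor.map h)
    (eval_hom i f (totalGrafting ψ τ).cor)
  exact (Category.assoc _ _ _).trans ((congrArg (eval i _ ≫ ·) h3).trans
    ((Category.assoc _ _ _).symm.trans h4))

/-- A morphism of operads is determined by its values on generators. -/
theorem IsPresentation.hom_ext {i : A₁ ⟶ (coll ψ G).obj A} (hi : IsPresentation i) {f g : A ⟶ O}
    (h : i ≫ (coll ψ G).map f = i ≫ (coll ψ G).map g) : f = g := by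
  refine app_eq_of_forall_app_corolla fun σ => ?_
  have := hi σ
  have h1 := freeCollectionDesc_comp i f
  rw [h, ← freeCollectionDesc_comp] at h1
  have h2 := congrArg (fun t => NatTrans.app t σ) h1
  exact (cancel_epi ((freeCollectionDesc i).app σ)).1 h2

/-- The image of a presentation under a morphism of operads that is epi on corollas. -/
theorem IsPresentation.comp {i : A₁ ⟶ (coll ψ G).obj A} (hi : IsPresentation i) {f : A ⟶ O}
    (hf : ∀ σ : Cor ψ, Epi (f.natTrans.app ((corInclusion ψ).obj σ))) :
    IsPresentation (i ≫ (coll ψ G).map f) := by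
  intro σ
  rw [← freeCollectionDesc_comp]
  exact epi_comp' (hi σ) (hf σ)

end Presentations

/-! ### The universal property of the free operad -/

section FreeOperadUniversal

open FinFam Functor.LaxMonoidal Operad

variable {Γ : Type u} [Category.{v} Γ] [MonoidalCategory Γ] [SymmetricCategory Γ]
  {ψ : Γ ⥤ Graph} [ψ.Braided] [GraphCategory ψ]
  {G : Type u'} [Category.{v'} G] [Abelian G] [MonoidalCategory G] [SymmetricCategory G]
  [ExactTensor G] [HasGraphColimits ψ G] (A₁ : Collection ψ G)

theorem corOne_natural {a b : Cor ψ} (f : a ⟶ b) :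
    corOne ψ a ≫ (corUnion ψ).map (singleMap f) = (corInclusion ψ).map f ≫ corOne ψ b :=
  famOne_natural _ f

/-- The morphism `leg A₁ r`, with target written as a value of the functor underlying the free
operad, so that the structure of an operad can be applied to it. -/
noncomputable def freeLeg {X : FinFam (Cor ψ)} {τ : Γ} (r : (corUnion ψ).obj X ⟶ τ) :
    (famTensor A₁).obj X ⟶ (freeOperad A₁).functor.obj τ :=
  leg A₁ r

theorem map_freeLeg {X Y : FinFam (Cor ψ)} {τ : Γ} (e : X ⟶ Y) (r : (corUnion ψ).obj Y ⟶ τ) :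
    (famTensor A₁).map e ≫ freeLeg A₁ r = freeLeg A₁ ((corUnion ψ).map e ≫ r) :=
  map_leg A₁ e r

theorem freeLeg_map {X : FinFam (Cor ψ)} {τ σ : Γ} (r : (corUnion ψ).obj X ⟶ τ) (g : τ ⟶ σ) :
    freeLeg A₁ r ≫ (freeOperad A₁).functor.map g = freeLeg A₁ (r ≫ g) :=
  leg_map A₁ r g

theorem freeLeg_μ {X Y : FinFam (Cor ψ)} {τ σ : Γ} (r : (corUnion ψ).obj X ⟶ τ)
    (s : (corUnion ψ).obj Y ⟶ σ) :
    (freeLeg A₁ r ⊗ₘ freeLeg A₁ s) ≫ μ (freeOperad A₁).functor τ σ =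
      famμ A₁ X Y ≫ freeLeg A₁ (corPair ψ r s) :=
  leg_freeMul A₁ r s

theorem freeOperad_ε : ε (freeOperad A₁).functor = famε A₁ ≫ freeLeg A₁ (inv (corε ψ)) :=
  rfl

variable {A₁} in
theorem freeLeg_hom_ext {τ : Γ} {Z : G} {f g : (freeOperad A₁).functor.obj τ ⟶ Z}
    (h : ∀ (X : FinFam (Cor ψ)) (r : (corUnion ψ).obj X ⟶ τ),
      freeLeg A₁ r ≫ f = freeLeg A₁ r ≫ g) : f = g :=
  leg_hom_ext h

variable {A₁} in
theorem freeLeg_hom_ext₂ {τ σ : Γ} {Z : G}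
    {f g : (freeOperad A₁).functor.obj τ ⊗ (freeOperad A₁).functor.obj σ ⟶ Z}
    (h : ∀ (X Y : FinFam (Cor ψ)) (r : (corUnion ψ).obj X ⟶ τ) (s : (corUnion ψ).obj Y ⟶ σ),
      (freeLeg A₁ r ⊗ₘ freeLeg A₁ s) ≫ f = (freeLeg A₁ r ⊗ₘ freeLeg A₁ s) ≫ g) : f = g :=
  leg_hom_ext₂ h

theorem exists_freeLegDesc {τ : Γ} {Z : G}
    (t : ∀ (X : FinFam (Cor ψ)) (_ : (corUnion ψ).obj X ⟶ τ), (famTensor A₁).obj X ⟶ Z)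
    (ht : ∀ {X Y : FinFam (Cor ψ)} (e : X ⟶ Y) (r : (corUnion ψ).obj Y ⟶ τ),
      (famTensor A₁).map e ≫ t Y r = t X ((corUnion ψ).map e ≫ r)) :
    ∃ d : (freeOperad A₁).functor.obj τ ⟶ Z, ∀ {X : FinFam (Cor ψ)}
      (r : (corUnion ψ).obj X ⟶ τ), freeLeg A₁ r ≫ d = t X r :=
  ⟨legDesc t ht, leg_legDesc t ht⟩

/-- The inclusion of the generators into the free operad. -/
noncomputable def freeι : A₁ ⟶ (coll ψ G).obj (freeOperad A₁) where
  app a := famOne A₁ a ≫ freeLeg A₁ (inv (corOne ψ a))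
  naturality a b f := by
    have h1 := famOne_natural A₁ f
    have h2 : (corUnion ψ).map (singleMap f) ≫ inv (corOne ψ b) =
        inv (corOne ψ a) ≫ (corInclusion ψ).map f := by
      rw [IsIso.comp_inv_eq, Category.assoc, ← corOne_natural, IsIso.inv_hom_id_assoc]
    refine (comp_assoc_of_eq h1.symm (freeLeg A₁ (inv (corOne ψ b)))).trans ?_
    rw [map_freeLeg, h2, ← freeLeg_map]
    exact (Category.assoc _ _ _).symm

theorem freeι_app (a : Cor ψ) :
    (freeι A₁).app a = famOne A₁ a ≫ freeLeg A₁ (inv (corOne ψ a)) := rfl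

/-- Evaluating generators in the free operad gives back the tautological legs. -/
theorem eval_freeι (X : FinFam (Cor ψ)) :
    eval (freeι A₁) X = freeLeg A₁ (𝟙 ((corUnion ψ).obj X)) := by
  refine FinFam.induction (motive := fun X => eval (freeι A₁) X =
    freeLeg A₁ (𝟙 ((corUnion ψ).obj X))) (fun {X Y} e _ h => ?_) ?_ (fun a X h => ?_) X
  · rw [← cancel_epi ((famTensor A₁).map e), eval_natural, h, map_freeLeg, freeLeg_map,
      Category.comp_id, Category.id_comp]
  · rw [← cancel_epi (famε A₁), eval_empty, freeOperad_ε, Category.assoc, freeLeg_map,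
      IsIso.inv_hom_id]
  · have h1 : eval (freeι A₁) (single a) = freeLeg A₁ (𝟙 _) := by
      have : IsIso (famOne A₁ a) := isIso_tensorOne _
      rw [← cancel_epi (famOne A₁ a), eval_single, freeι_app]
      refine (Category.assoc _ _ _).trans (congrArg (_ ≫ ·) ?_)
      exact (freeLeg_map A₁ _ _).trans (by rw [IsIso.inv_hom_id])
    rw [← cancel_epi (famμ A₁ (single a) X), ← eval_sum, h1, h, ← Category.assoc, freeLeg_μ,
      Category.assoc, freeLeg_map, corPair, id_tensorHom_id, Category.comp_id, IsIso.inv_hom_id]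

theorem freeLeg_eq {X : FinFam (Cor ψ)} {τ : Γ} (r : (corUnion ψ).obj X ⟶ τ) :
    freeLeg A₁ r = eval (freeι A₁) X ≫ (freeOperad A₁).functor.map r := by
  rw [eval_freeι, freeLeg_map, Category.id_comp]

/-- The legs for all families of corollas factor through `𝓕(A₁)`, hence `𝓕(A₁)` maps epimorphically
to the free operad. -/
theorem isPresentation_freeι : IsPresentation (freeι A₁) := by
  refine fun σ => ⟨fun {Z} (f g : (freeOperad A₁).functor.obj ((corInclusion ψ).obj σ) ⟶ Z) h =>
    freeLeg_hom_ext fun X r => ?_⟩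
  have h1 := overDiagramι_desc (freeι A₁) σ r
  have h2 : overDiagramι A₁ σ r ≫ (freeCollectionDesc (freeι A₁)).app σ =
      (famTensor A₁).map (corUnionFamily ψ X) ≫ freeLeg A₁ r := by
    rw [map_freeLeg, map_corUnionFamily]
    refine h1.trans ?_
    rw [← Functor.map_comp, ← freeLeg_eq]
  rw [← cancel_epi ((famTensor A₁).map (corUnionFamily ψ X))]
  refine (Category.assoc _ _ _).symm.trans (Eq.trans ?_ (Category.assoc _ _ _))
  refine (congrArg (· ≫ f) h2.symm).trans (Eq.trans ?_ (congrArg (· ≫ g) h2))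
  exact (Category.assoc _ _ _).trans ((congrArg (_ ≫ ·) h).trans (Category.assoc _ _ _).symm)

variable {A₁} {O : Operad ψ G} (j : A₁ ⟶ (coll ψ G).obj O)

theorem exists_freeExtApp (τ : Γ) : ∃ d : (freeOperad A₁).functor.obj τ ⟶ O.functor.obj τ,
    ∀ {X : FinFam (Cor ψ)} (r : (corUnion ψ).obj X ⟶ τ),
      freeLeg A₁ r ≫ d = eval j X ≫ O.functor.map r :=
  exists_freeLegDesc A₁ (fun X r => eval j X ≫ O.functor.map r) fun e r => by
    rw [← Category.assoc, eval_natural, Category.assoc, O.functor.map_comp]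

/-- The components of the extension to the free operad of a morphism `j : A₁ ⟶ O`. -/
noncomputable def freeExtApp (τ : Γ) : (freeOperad A₁).functor.obj τ ⟶ O.functor.obj τ :=
  (exists_freeExtApp j τ).choose

theorem freeLeg_freeExtApp {X : FinFam (Cor ψ)} {τ : Γ} (r : (corUnion ψ).obj X ⟶ τ) :
    freeLeg A₁ r ≫ freeExtApp j τ = eval j X ≫ O.functor.map r :=
  (exists_freeExtApp j τ).choose_spec r

theorem eval_corPair {X Y : FinFam (Cor ψ)} {τ σ : Γ} (r : (corUnion ψ).obj X ⟶ τ)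
    (s : (corUnion ψ).obj Y ⟶ σ) :
    ((eval j X ≫ O.functor.map r) ⊗ₘ (eval j Y ≫ O.functor.map s)) ≫ μ O.functor τ σ =
      famμ A₁ X Y ≫ eval j (sum X Y) ≫ O.functor.map (corPair ψ r s) := by
  have h := comp_assoc_of_eq (eval_sum j X Y).symm (O.functor.map (corPair ψ r s))
  rw [h, Category.assoc, ← O.functor.map_comp, corμ_corPair, ← tensorHom_comp_tensorHom,
    Category.assoc, μ_natural]

/-- The extension to the free operad of a morphism of collections `j : A₁ ⟶ O`. -/
noncomputable def freeExt : freeOperad A₁ ⟶ O where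
  natTrans :=
    { app := freeExtApp j
      naturality := fun τ σ g => freeLeg_hom_ext fun X r => by
        rw [← Category.assoc, freeLeg_map, freeLeg_freeExtApp, ← Category.assoc,
          freeLeg_freeExtApp, O.functor.map_comp, Category.assoc] }
  isMonoidal :=
    { unit := by
        rw [freeOperad_ε, Category.assoc, freeLeg_freeExtApp, ← Category.assoc, eval_empty,
          Category.assoc, ← O.functor.map_comp, IsIso.hom_inv_id, O.functor.map_id,
          Category.comp_id]
      tensor := fun τ σ => freeLeg_hom_ext₂ fun X Y r s => by
        rw [← Category.assoc, freeLeg_μ, Category.assoc, freeLeg_freeExtApp,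
          tensorHom_comp_tensorHom_assoc, freeLeg_freeExtApp, freeLeg_freeExtApp, eval_corPair] }

theorem freeι_freeExt : freeι A₁ ≫ (coll ψ G).map (freeExt j) = j := by
  ext a
  refine (Category.assoc _ _ _).trans
    ((congrArg (famOne A₁ a ≫ ·) (freeLeg_freeExtApp j (inv (corOne ψ a)))).trans ?_)
  have h : O.functor.map (corOne ψ a) ≫ O.functor.map (inv (corOne ψ a)) = 𝟙 _ := by
    rw [← O.functor.map_comp, IsIso.hom_inv_id, O.functor.map_id]
  rw [← Category.assoc, eval_single]
  exact (Category.assoc _ _ _).trans ((congrArg (j.app a ≫ ·) h).trans (Category.comp_id _))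

variable {j} in
/-- For a presentation, the morphism from the free operad is epi. -/
theorem IsPresentation.epi_freeExt (hj : IsPresentation j) (τ : Γ) :
    Epi ((freeExt j).natTrans.app τ) := by
  refine epi_app _ (fun σ => ?_) τ
  have h := freeCollectionDesc_comp (freeι A₁) (freeExt j)
  rw [freeι_freeExt] at h
  have h1 : Epi ((freeCollectionDesc (freeι A₁)).app σ ≫
      (freeExt j).natTrans.app ((corInclusion ψ).obj σ)) := by
    have h2 := hj σ
    rw [← h] at h2
    exact h2
  exact epi_of_epi ((freeCollectionDesc (freeι A₁)).app σ) _

end FreeOperadUniversal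

/-! ### Factorizations in an abelian tensor category -/

section Factorizations

variable {G : Type u'} [Category.{v'} G] [Abelian G]

/-- The diagonal of a commutative square with an epimorphism and a monomorphism. -/
theorem exists_lift_of_epi_mono {X Y Z W : G} (e : X ⟶ Y) (m : Z ⟶ W) [Epi e] [Mono m]
    {a : X ⟶ Z} {b : Y ⟶ W} (h : a ≫ m = e ≫ b) : ∃ d : Y ⟶ Z, e ≫ d = a ∧ d ≫ m = b :=
  have sq : CommSq a e m b := ⟨h⟩
  have := strongEpi_of_epi e
  ⟨sq.lift, sq.fac_left, sq.fac_right⟩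

/-- Objectwise quotients of a functor form a functor if the morphisms descend. -/
theorem exists_quotientFunctor {C : Type*} [Category* C] {P : C ⥤ G} {E : C → G}
    {q : ∀ τ, P.obj τ ⟶ E τ}
    (hq : ∀ τ, Epi (q τ))
    (hmap : ∀ {τ σ : C} (g : τ ⟶ σ), ∃ y, q τ ≫ y = P.map g ≫ q σ) :
    ∃ F : C ⥤ G, ∃ h : F.obj = E, ∀ {τ σ : C} (g : τ ⟶ σ),
      q τ ≫ eqToHom (congrFun h τ).symm ≫ F.map g =
        P.map g ≫ q σ ≫ eqToHom (congrFun h σ).symm := by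
  choose y hy using @hmap
  refine ⟨{ obj := E, map := y, map_id := fun τ => ?_, map_comp := fun f g => ?_ }, rfl,
    fun g => ?_⟩
  · rw [← cancel_epi (q τ), hy, P.map_id, Category.id_comp, Category.comp_id]
  · rw [← cancel_epi (q _), hy, ← Category.assoc, hy, P.map_comp, Category.assoc,
      Category.assoc, hy]
  · simpa using hy g

variable [MonoidalCategory G] [ExactTensor G]

/-- A morphism on a tensor product that factors through an epimorphism in each argument factors
through their tensor product. -/
theorem exists_fac_tensorHom {X X' Y Y' Z : G} (f : X ⟶ X') (g : Y ⟶ Y') [Epi f] [Epi g]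
    {x : X ⊗ Y ⟶ Z} {a : X' ⊗ Y ⟶ Z} {b : X ⊗ Y' ⟶ Z} (ha : (f ▷ Y) ≫ a = x)
    (hb : (X ◁ g) ≫ b = x) : ∃ c : X' ⊗ Y' ⟶ Z, (f ⊗ₘ g) ≫ c = x := by
  have hg := Abelian.epiIsCokernelOfKernel (KernelFork.ofι (kernel.ι g) (kernel.condition g))
    (kernelIsKernel g)
  have hg' := CokernelCofork.mapIsColimit _ hg (tensorLeft X')
  -- `a` vanishes on `X' ⊗ ker g`, as it does so after composition with the epimorphism `f ▷ ker g`
  have h0 : (X' ◁ kernel.ι g) ≫ a = 0 := by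
    have h1 : (X ◁ kernel.ι g) ≫ (X ◁ g) = 0 :=
      ((tensorLeft X).map_comp _ _).symm.trans
        ((congrArg (tensorLeft X).map (kernel.condition g)).trans ((tensorLeft X).map_zero _ _))
    rw [← cancel_epi (f ▷ kernel g), ← whisker_exchange_assoc, ha, ← hb, ← Category.assoc, h1,
      zero_comp, comp_zero]
  obtain ⟨c, hc⟩ := CokernelCofork.IsColimit.desc' hg' a h0
  refine ⟨c, ?_⟩
  rw [MonoidalCategory.tensorHom_def, ← ha]
  exact (Category.assoc _ _ _).trans (congrArg ((f ▷ Y) ≫ ·) hc)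

/-- The tensor product preserves pushouts in the first argument. -/
theorem exists_fac_whiskerRight {X Y P Y' : G} {a : X ⟶ Y} {b : X ⟶ Y'} {i : Y ⟶ P} {j : Y' ⟶ P}
    (h : IsPushout a b i j) (T : G) {Z : G} {y : Y ⊗ T ⟶ Z} {y' : Y' ⊗ T ⟶ Z}
    (hy : (a ▷ T) ≫ y = (b ▷ T) ≫ y') :
    ∃ w : P ⊗ T ⟶ Z, ((a ≫ i) ▷ T) ≫ w = (a ▷ T) ≫ y := by
  have h1 := h.map (tensorRight T)
  refine ⟨h1.desc y y' hy, ?_⟩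
  rw [comp_whiskerRight, Category.assoc]
  exact congrArg (_ ≫ ·) (h1.inl_desc y y' hy)

/-- The tensor product preserves pushouts in the second argument. -/
theorem exists_fac_whiskerLeft {X Y P Y' : G} {a : X ⟶ Y} {b : X ⟶ Y'} {i : Y ⟶ P} {j : Y' ⟶ P}
    (h : IsPushout a b i j) (T : G) {Z : G} {y : T ⊗ Y ⟶ Z} {y' : T ⊗ Y' ⟶ Z}
    (hy : (T ◁ a) ≫ y = (T ◁ b) ≫ y') :
    ∃ w : T ⊗ P ⟶ Z, (T ◁ (a ≫ i)) ≫ w = (T ◁ a) ≫ y := by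
  have h1 := h.map (tensorLeft T)
  refine ⟨h1.desc y y' hy, ?_⟩
  rw [MonoidalCategory.whiskerLeft_comp, Category.assoc]
  exact congrArg (_ ≫ ·) (h1.inl_desc y y' hy)

end Factorizations

/-! ### Quotients of operads -/

section Quotients

open FinFam Functor.LaxMonoidal Operad

variable {Γ : Type u} [Category.{v} Γ] [MonoidalCategory Γ] [SymmetricCategory Γ]
  {ψ : Γ ⥤ Graph} [ψ.Braided] {G : Type u'} [Category.{v'} G] [Abelian G] [MonoidalCategory G]
  [SymmetricCategory G] [ExactTensor G]

namespace Operad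

/-- Objectwise quotients `E(τ)` of an operad `P` form an operad if the structure morphisms of `P`
and their inverses descend. The isomorphisms `e` allow for a choice of objects in the result. -/
theorem exists_quotient (P : Operad ψ G) {E : Γ → G} (q : ∀ τ, P.functor.obj τ ⟶ E τ)
    (hq : ∀ τ, Epi (q τ))
    (hmap : ∀ {τ σ : Γ} (g : τ ⟶ σ), ∃ y, q τ ≫ y = P.functor.map g ≫ q σ)
    (hinv : ∀ {τ σ : Γ} (g : τ ⟶ σ), IsGrafting ψ g →
      ∃ y, P.functor.map g ≫ q σ ≫ y = q τ)
    (hμ : ∀ τ σ, ∃ y, (q τ ⊗ₘ q σ) ≫ y = μ P.functor τ σ ≫ q (τ ⊗ σ))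
    (hδ : ∀ τ σ, ∃ y, μ P.functor τ σ ≫ q (τ ⊗ σ) ≫ y = q τ ⊗ₘ q σ)
    (hε : ∃ y, ε P.functor ≫ q (𝟙_ Γ) ≫ y = 𝟙 _) :
    ∃ (O : Operad ψ G) (p : P ⟶ O) (e : ∀ τ, E τ ≅ O.functor.obj τ),
      ∀ τ, q τ ≫ (e τ).hom = p.natTrans.app τ := by
  obtain ⟨F, rfl, hF⟩ := exists_quotientFunctor hq hmap
  simp only [eqToHom_refl, Category.id_comp, Category.comp_id] at hF
  choose m hm using hμ
  choose d hd using hδ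
  obtain ⟨n, hn⟩ := hε
  let O : Operad ψ G := Operad.ofMul F (ε P.functor ≫ q (𝟙_ Γ)) m
    ⟨n, (Category.assoc _ _ _).trans hn, by
      have : Epi (ε P.functor ≫ q (𝟙_ Γ)) := epi_comp _ _
      rw [← cancel_epi (ε P.functor ≫ q (𝟙_ Γ)), Category.comp_id, Category.assoc,
        ← Category.assoc (q _), ← Category.assoc (ε P.functor) (q _ ≫ n), hn, Category.id_comp]⟩
    (fun τ σ => ⟨d τ σ, by
        rw [← cancel_epi (q τ ⊗ₘ q σ), ← Category.assoc, hm, Category.assoc, hd, Category.comp_id],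
      by
        rw [← cancel_epi (q (τ ⊗ σ)), ← cancel_epi (μ P.functor τ σ), ← Category.assoc (q _),
          ← Category.assoc (μ _ _ _), hd, hm, Category.comp_id]⟩)
    (fun {τ σ τ' σ'} f g => by
      rw [← cancel_epi (q τ ⊗ₘ q σ), tensorHom_comp_tensorHom_assoc, hF, hF,
        ← Category.assoc, hm, Category.assoc, hF, ← tensorHom_comp_tensorHom_assoc, hm,
        ← Category.assoc, μ_natural, Category.assoc])
    (fun τ σ ρ => by
      rw [← cancel_epi ((q τ ⊗ₘ q σ) ⊗ₘ q ρ)]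
      have h1 : ((q τ ⊗ₘ q σ) ⊗ₘ q ρ) ≫ (m τ σ ▷ F.obj ρ) =
          (μ P.functor τ σ ▷ _) ≫ (q (τ ⊗ σ) ⊗ₘ q ρ) := by
        rw [← tensorHom_id, tensorHom_comp_tensorHom, hm, Category.comp_id, ← tensorHom_id,
          tensorHom_comp_tensorHom, Category.id_comp]
      have h2 : (q τ ⊗ₘ (q σ ⊗ₘ q ρ)) ≫ (F.obj τ ◁ m σ ρ) =
          (_ ◁ μ P.functor σ ρ) ≫ (q τ ⊗ₘ q (σ ⊗ ρ)) := by
        rw [← id_tensorHom, tensorHom_comp_tensorHom, hm, Category.comp_id, ← id_tensorHom,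
          tensorHom_comp_tensorHom, Category.id_comp]
      rw [comp_assoc_of_eq h1, comp_assoc_of_eq (hm _ _), hF, associator_naturality_assoc,
        comp_assoc_of_eq h2, hm, associativity_assoc])
    (fun τ => by
      have h1 : (𝟙_ G ◁ q τ) ≫ ((ε P.functor ≫ q (𝟙_ Γ)) ▷ F.obj τ) =
          (ε P.functor ▷ _) ≫ (q (𝟙_ Γ) ⊗ₘ q τ) := by
        rw [← id_tensorHom, ← tensorHom_id, tensorHom_comp_tensorHom, ← tensorHom_id,
          tensorHom_comp_tensorHom, Category.id_comp, Category.id_comp, Category.comp_id]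
      rw [← cancel_epi (𝟙_ G ◁ q τ), leftUnitor_naturality, comp_assoc_of_eq h1,
        comp_assoc_of_eq (hm _ _), hF, left_unitality]
      simp only [Category.assoc])
    (fun τ σ => by
      rw [← cancel_epi (q τ ⊗ₘ q σ), comp_assoc_of_eq (hm _ _), hF,
        comp_assoc_of_eq (BraidedCategory.braiding_naturality _ _), hm, ← Category.assoc,
        Functor.LaxBraided.braided, Category.assoc])
    (fun {τ σ} g hg => by
      obtain ⟨y, hy⟩ := hinv g hg
      have := P.isIso_map g hg
      refine ⟨y, ?_, ?_⟩
      · rw [← cancel_epi (q τ), ← Category.assoc, hF, Category.assoc, hy, Category.comp_id]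
      · rw [← cancel_epi (q σ), ← cancel_epi (P.functor.map g), ← Category.assoc (q σ),
          ← Category.assoc, hy, hF, Category.comp_id])
  exact ⟨O, ⟨⟨q, fun τ σ g => (hF g).symm⟩, ⟨rfl, fun τ σ => (hm τ σ).symm⟩⟩,
    fun τ => Iso.refl _, fun τ => Category.comp_id _⟩

end Operad

end Quotients

/-! ### Descent, images and pushouts of operads -/

section Descent

open FinFam Functor.LaxMonoidal

variable {Γ : Type u} [Category.{v} Γ] [MonoidalCategory Γ] [SymmetricCategory Γ]
  {ψ : Γ ⥤ Graph} [ψ.Braided] {G : Type u'} [Category.{v'} G] [Abelian G] [MonoidalCategory G]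
  [SymmetricCategory G] [ExactTensor G]

namespace Operad

theorem congr_app {P E : Operad ψ G} {f g : P ⟶ E} (h : f = g) (τ : Γ) :
    f.natTrans.app τ = g.natTrans.app τ := by rw [h]

/-- Objectwise epimorphisms of operads are epimorphisms. -/
theorem epi_hom_ext {P E O : Operad ψ G} {p : P ⟶ E} (hp : ∀ τ, Epi (p.natTrans.app τ))
    {f g : E ⟶ O} (h : p ≫ f = p ≫ g) : f = g :=
  hom_ext (NatTrans.ext (funext fun τ => (cancel_epi (p.natTrans.app τ)).1 (congr_app h τ)))

/-- Objectwise monomorphisms of operads are monomorphisms. -/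
theorem mono_hom_ext {P E O : Operad ψ G} {m : E ⟶ O} (hm : ∀ τ, Mono (m.natTrans.app τ))
    {f g : P ⟶ E} (h : f ≫ m = g ≫ m) : f = g :=
  hom_ext (NatTrans.ext (funext fun τ => (cancel_mono (m.natTrans.app τ)).1 (congr_app h τ)))

/-- A morphism of operads that factors objectwise through an objectwise epimorphism of operads
factors through it. -/
theorem exists_desc {P E O : Operad ψ G} {p : P ⟶ E} (hp : ∀ τ, Epi (p.natTrans.app τ))
    (f : P ⟶ O) (hf : ∀ τ, ∃ y, p.natTrans.app τ ≫ y = f.natTrans.app τ) :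
    ∃ m : E ⟶ O, p ≫ m = f := by
  choose y hy using hf
  have := p.isMonoidal
  have := f.isMonoidal
  refine ⟨⟨⟨y, fun τ σ g => ?_⟩, ⟨?_, fun τ σ => ?_⟩⟩, hom_ext (NatTrans.ext (funext hy))⟩
  · rw [← cancel_epi (p.natTrans.app τ), ← p.natTrans.naturality_assoc, hy, comp_comp_of_eq (hy τ),
      f.natTrans.naturality]
  · rw [← NatTrans.IsMonoidal.unit (τ := p.natTrans), Category.assoc]
    exact (congrArg (_ ≫ ·) (hy _)).trans NatTrans.IsMonoidal.unit
  · change μ E.functor τ σ ≫ y _ = (y τ ⊗ₘ y σ) ≫ μ O.functor τ σ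
    rw [← cancel_epi (p.natTrans.app τ ⊗ₘ p.natTrans.app σ),
      ← comp_assoc_of_eq (NatTrans.IsMonoidal.tensor (τ := p.natTrans) τ σ), hy,
      tensorHom_comp_tensorHom_assoc, hy, hy, NatTrans.IsMonoidal.tensor]

/-- A morphism of operads that factors through an epimorphism of operads on corollas factors
through it. -/
theorem exists_desc_of_corollas [GraphCategory ψ] {P E O : Operad ψ G} {p : P ⟶ E}
    (hp : ∀ σ : Cor ψ, Epi (p.natTrans.app ((corInclusion ψ).obj σ)))
    (f : P ⟶ O) (hf : ∀ σ : Cor ψ, ∃ y, p.natTrans.app ((corInclusion ψ).obj σ) ≫ y =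
      f.natTrans.app ((corInclusion ψ).obj σ)) :
    ∃ m : E ⟶ O, p ≫ m = f := by
  choose y hy using hf
  refine exists_desc (fun τ => epi_app p hp τ) f fun τ => ?_
  let X : FinFam (Cor ψ) := (totalGrafting ψ τ).cor
  let r : (corUnion ψ).obj X ⟶ τ := (totalGrafting ψ τ).map
  have hP : IsIso (P.functor.map r) := P.isIso_map _ (totalGrafting ψ τ).isGrafting
  have hE : IsIso (E.functor.map r) := E.isIso_map _ (totalGrafting ψ τ).isGrafting
  have h1 : famApp (A := (coll ψ G).obj P) (A' := (coll ψ G).obj E) ((coll ψ G).map p).app X ≫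
      famApp (A := (coll ψ G).obj E) (A' := (coll ψ G).obj O) y X =
      famApp (A := (coll ψ G).obj P) (A' := (coll ψ G).obj O) ((coll ψ G).map f).app X := by
    refine (famApp_comp (A := (coll ψ G).obj P) (A' := (coll ψ G).obj E)
      (A'' := (coll ψ G).obj O) _ _ X).trans ?_
    exact congrArg (fun t => famApp (A := (coll ψ G).obj P) (A' := (coll ψ G).obj O) t X)
      (funext hy)
  have h2 : p.natTrans.app ((corUnion ψ).obj X) ≫ inv (E.cmp X) ≫
      famApp (A := (coll ψ G).obj E) (A' := (coll ψ G).obj O) y X ≫ O.cmp X =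
        f.natTrans.app ((corUnion ψ).obj X) := by
    rw [← cancel_epi (P.cmp X), cmp_hom, comp_assoc_of_eq (cmp_hom p X), IsIso.hom_inv_id_assoc,
      comp_comp_of_eq h1]
  refine ⟨inv (E.functor.map r) ≫ (inv (E.cmp X) ≫
      famApp (A := (coll ψ G).obj E) (A' := (coll ψ G).obj O) y X ≫ O.cmp X) ≫
      O.functor.map r, ?_⟩
  rw [← cancel_epi (P.functor.map r), p.natTrans.naturality_assoc,
    IsIso.hom_inv_id_assoc, comp_comp_of_eq h2, f.natTrans.naturality]

/-- The image of a morphism of operads. It is formed objectwise; the structure morphisms and their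
inverses descend to it as diagonals of squares with an epimorphism and a monomorphism. -/
theorem exists_image {P O : Operad ψ G} (f : P ⟶ O) :
    ∃ (E : Operad ψ G) (p : P ⟶ E) (m : E ⟶ O), (∀ τ, Epi (p.natTrans.app τ)) ∧
      (∀ τ, Mono (m.natTrans.app τ)) ∧ p ≫ m = f := by
  have := f.isMonoidal
  let q : ∀ τ, P.functor.obj τ ⟶ image (f.natTrans.app τ) := fun τ =>
    factorThruImage (f.natTrans.app τ)
  let i : ∀ τ, image (f.natTrans.app τ) ⟶ O.functor.obj τ := fun τ => image.ι (f.natTrans.app τ)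
  have hq : ∀ τ, Epi (q τ) := fun τ => inferInstanceAs (Epi (factorThruImage _))
  have hi : ∀ τ, Mono (i τ) := fun τ => inferInstanceAs (Mono (image.ι _))
  have hqi : ∀ τ, q τ ≫ i τ = f.natTrans.app τ := fun τ => image.fac _
  obtain ⟨E, p, e, h⟩ := exists_quotient P q hq
    (fun {τ σ} g => by
      obtain ⟨y, hy, -⟩ := exists_lift_of_epi_mono (q τ) (i σ) (a := P.functor.map g ≫ q σ)
        (b := i τ ≫ O.functor.map g) (by
          rw [Category.assoc, hqi, f.natTrans.naturality, comp_comp_of_eq (hqi τ)])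
      exact ⟨y, hy⟩)
    (fun {τ σ} g hg => by
      have := P.isIso_map g hg
      have := O.isIso_map g hg
      obtain ⟨y, hy, -⟩ := exists_lift_of_epi_mono (q σ) (i τ) (a := inv (P.functor.map g) ≫ q τ)
        (b := i σ ≫ inv (O.functor.map g)) (by
          rw [Category.assoc, hqi, comp_comp_of_eq (hqi σ), IsIso.inv_comp_eq,
            f.natTrans.naturality_assoc, IsIso.hom_inv_id, Category.comp_id])
      exact ⟨y, by rw [hy, IsIso.hom_inv_id_assoc]⟩)
    (fun τ σ => by
      obtain ⟨y, hy, -⟩ := exists_lift_of_epi_mono (q τ ⊗ₘ q σ) (i (τ ⊗ σ))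
        (a := μ P.functor τ σ ≫ q (τ ⊗ σ)) (b := (i τ ⊗ₘ i σ) ≫ μ O.functor τ σ) (by
          rw [Category.assoc, hqi, tensorHom_comp_tensorHom_assoc, hqi, hqi,
            NatTrans.IsMonoidal.tensor])
      exact ⟨y, hy⟩)
    (fun τ σ => by
      obtain ⟨y, hy, -⟩ := exists_lift_of_epi_mono (q (τ ⊗ σ)) (i τ ⊗ₘ i σ)
        (a := inv (μ P.functor τ σ) ≫ (q τ ⊗ₘ q σ)) (b := i (τ ⊗ σ) ≫ inv (μ O.functor τ σ)) (by
          rw [Category.assoc, tensorHom_comp_tensorHom, hqi, hqi, comp_comp_of_eq (hqi _),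
            IsIso.inv_comp_eq, ← Category.assoc, NatTrans.IsMonoidal.tensor, Category.assoc,
            IsIso.hom_inv_id, Category.comp_id])
      exact ⟨y, by rw [hy, IsIso.hom_inv_id_assoc]⟩)
    (by
      obtain ⟨y, hy, -⟩ := exists_lift_of_epi_mono (q (𝟙_ Γ)) (ε O.functor)
        (a := inv (ε P.functor)) (b := i (𝟙_ Γ)) (by
          rw [hqi, IsIso.inv_comp_eq, NatTrans.IsMonoidal.unit])
      exact ⟨y, by rw [hy, IsIso.hom_inv_id]⟩)
  have hp : ∀ τ, Epi (p.natTrans.app τ) := fun τ => by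
    rw [← h]
    exact epi_comp _ _
  obtain ⟨m, hm⟩ := exists_desc hp f fun τ => ⟨(e τ).inv ≫ i τ, by
    rw [← h, Category.assoc, Iso.hom_inv_id_assoc, hqi]⟩
  refine ⟨E, p, m, hp, fun τ => ?_, hm⟩
  have h1 : m.natTrans.app τ = (e τ).inv ≫ i τ := by
    rw [← cancel_epi (p.natTrans.app τ)]
    refine (congr_app hm τ).trans ?_
    rw [← h, Category.assoc, Iso.hom_inv_id_assoc, hqi]
  rw [h1]
  exact mono_comp _ _

/-- The pushout of two objectwise epimorphisms of operads. It is formed objectwise: as a quotient of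
`F`, it is the largest quotient that is a quotient both of `P` and of `P'`. -/
theorem exists_pushout {F P P' : Operad ψ G} (a : F ⟶ P) (b : F ⟶ P')
    (ha : ∀ τ, Epi (a.natTrans.app τ)) (hb : ∀ τ, Epi (b.natTrans.app τ)) :
    ∃ (E : Operad ψ G) (p : P ⟶ E) (p' : P' ⟶ E), (∀ τ, Epi (p.natTrans.app τ)) ∧
      a ≫ p = b ≫ p' ∧ ∀ {O : Operad ψ G} (f : P ⟶ O) (f' : P' ⟶ O), a ≫ f = b ≫ f' →
        ∃ m : E ⟶ O, p ≫ m = f := by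
  have := a.isMonoidal
  have := b.isMonoidal
  let po := fun τ => IsPushout.of_hasPushout (a.natTrans.app τ) (b.natTrans.app τ)
  let q : ∀ τ, F.functor.obj τ ⟶ pushout (a.natTrans.app τ) (b.natTrans.app τ) := fun τ =>
    a.natTrans.app τ ≫ pushout.inl _ _
  have hqb : ∀ τ, q τ = b.natTrans.app τ ≫ pushout.inr _ _ := fun τ => pushout.condition
  have hq : ∀ τ, Epi (q τ) := fun τ => epi_comp _ _
  -- a morphism descends to the pushout if it descends to `P` and to `P'`
  have fac : ∀ {τ : Γ} {Z : G} {x : F.functor.obj τ ⟶ Z}, (∃ y, a.natTrans.app τ ≫ y = x) →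
      (∃ y, b.natTrans.app τ ≫ y = x) → ∃ w, q τ ≫ w = x := by
    rintro τ Z x ⟨y, rfl⟩ ⟨y', hy'⟩
    exact ⟨(po τ).desc y y' hy'.symm, by
      rw [Category.assoc, (po τ).inl_desc]⟩
  -- the same for tensor products of two values, by exactness in one argument at a time
  have fac₂ : ∀ {τ σ : Γ} {Z : G} {x : F.functor.obj τ ⊗ F.functor.obj σ ⟶ Z},
      (∃ y, (a.natTrans.app τ ⊗ₘ a.natTrans.app σ) ≫ y = x) →
      (∃ y, (b.natTrans.app τ ⊗ₘ b.natTrans.app σ) ≫ y = x) → ∃ w, (q τ ⊗ₘ q σ) ≫ w = x := by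
    rintro τ σ Z x ⟨y, hy⟩ ⟨y', hy'⟩
    have h1 : (a.natTrans.app τ ▷ F.functor.obj σ) ≫ (_ ◁ a.natTrans.app σ) ≫ y =
        (b.natTrans.app τ ▷ F.functor.obj σ) ≫ (_ ◁ b.natTrans.app σ) ≫ y' := by
      rw [← Category.assoc, ← Category.assoc (b.natTrans.app τ ▷ _),
        ← MonoidalCategory.tensorHom_def, ← MonoidalCategory.tensorHom_def, hy, hy']
    have h2 : (F.functor.obj τ ◁ a.natTrans.app σ) ≫ (a.natTrans.app τ ▷ _) ≫ y =
        (F.functor.obj τ ◁ b.natTrans.app σ) ≫ (b.natTrans.app τ ▷ _) ≫ y' := by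
      rw [← Category.assoc, ← Category.assoc (_ ◁ b.natTrans.app σ),
        ← tensorHom_def', ← tensorHom_def', hy, hy']
    obtain ⟨w1, hw1⟩ := exists_fac_whiskerRight (po τ) _ h1
    obtain ⟨w2, hw2⟩ := exists_fac_whiskerLeft (po σ) _ h2
    refine exists_fac_tensorHom (q τ) (q σ) (a := w1) (b := w2) (hw1.trans ?_) (hw2.trans ?_)
    · rw [← Category.assoc, ← MonoidalCategory.tensorHom_def, hy]
    · rw [← Category.assoc, ← tensorHom_def', hy]
  obtain ⟨E, p, e, h⟩ := exists_quotient F q hq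
    (fun {τ σ} g => fac
      ⟨P.functor.map g ≫ pushout.inl _ _, by rw [← a.natTrans.naturality_assoc]⟩
      ⟨P'.functor.map g ≫ pushout.inr _ _, by rw [← b.natTrans.naturality_assoc, hqb]⟩)
    (fun {τ σ} g hg => by
      have := F.isIso_map g hg
      have := P.isIso_map g hg
      have := P'.isIso_map g hg
      obtain ⟨w, hw⟩ := fac (x := inv (F.functor.map g) ≫ q τ)
        ⟨inv (P.functor.map g) ≫ pushout.inl _ _, by
          rw [IsIso.eq_inv_comp, a.natTrans.naturality_assoc, IsIso.hom_inv_id_assoc]⟩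
        ⟨inv (P'.functor.map g) ≫ pushout.inr _ _, by
          rw [IsIso.eq_inv_comp, b.natTrans.naturality_assoc, IsIso.hom_inv_id_assoc, hqb]⟩
      exact ⟨w, by rw [hw, IsIso.hom_inv_id_assoc]⟩)
    (fun τ σ => fac₂
      ⟨μ P.functor τ σ ≫ pushout.inl _ _, by
        rw [← Category.assoc, ← NatTrans.IsMonoidal.tensor, Category.assoc]⟩
      ⟨μ P'.functor τ σ ≫ pushout.inr _ _, by
        rw [← Category.assoc, ← NatTrans.IsMonoidal.tensor, Category.assoc, hqb]⟩)
    (fun τ σ => by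
      obtain ⟨w, hw⟩ := fac (x := inv (μ F.functor τ σ) ≫ (q τ ⊗ₘ q σ))
        ⟨inv (μ P.functor τ σ) ≫ (pushout.inl _ _ ⊗ₘ pushout.inl _ _), by
          rw [IsIso.eq_inv_comp, ← Category.assoc, NatTrans.IsMonoidal.tensor, Category.assoc,
            IsIso.hom_inv_id_assoc, tensorHom_comp_tensorHom]⟩
        ⟨inv (μ P'.functor τ σ) ≫ (pushout.inr _ _ ⊗ₘ pushout.inr _ _), by
          rw [IsIso.eq_inv_comp, ← Category.assoc, NatTrans.IsMonoidal.tensor, Category.assoc,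
            IsIso.hom_inv_id_assoc, tensorHom_comp_tensorHom, hqb, hqb]⟩
      exact ⟨w, by rw [hw, IsIso.hom_inv_id_assoc]⟩)
    (by
      obtain ⟨w, hw⟩ := fac (x := inv (ε F.functor))
        ⟨inv (ε P.functor), by
          rw [← cancel_epi (ε F.functor), comp_comp_of_eq NatTrans.IsMonoidal.unit,
            IsIso.hom_inv_id, IsIso.hom_inv_id]⟩
        ⟨inv (ε P'.functor), by
          rw [← cancel_epi (ε F.functor), comp_comp_of_eq NatTrans.IsMonoidal.unit,
            IsIso.hom_inv_id, IsIso.hom_inv_id]⟩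
      exact ⟨w, by rw [hw, IsIso.hom_inv_id]⟩)
  obtain ⟨l, hl⟩ := exists_desc ha p fun τ => ⟨pushout.inl _ _ ≫ (e τ).hom, by
    rw [← h, Category.assoc]⟩
  obtain ⟨l', hl'⟩ := exists_desc hb p fun τ => ⟨pushout.inr _ _ ≫ (e τ).hom, by
    rw [← h, hqb, Category.assoc]⟩
  have hp : ∀ τ, Epi (p.natTrans.app τ) := fun τ => by
    rw [← h]
    exact epi_comp _ _
  refine ⟨E, l, l', fun τ => ?_, hl.trans hl'.symm, fun {O} f f' hf => ?_⟩
  · have h1 := hp τ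
    rw [← hl] at h1
    exact epi_of_epi_fac (h := (a ≫ l).natTrans.app τ) rfl
  · obtain ⟨m, hm⟩ := exists_desc hp (a ≫ f) fun τ => by
      obtain ⟨w, hw⟩ := fac (x := (a ≫ f).natTrans.app τ) ⟨f.natTrans.app τ, rfl⟩
        ⟨f'.natTrans.app τ, (congr_app hf τ).symm⟩
      exact ⟨(e τ).inv ≫ w, by rw [← h, Category.assoc, Iso.hom_inv_id_assoc, hw]⟩
    refine ⟨m, epi_hom_ext ha ?_⟩
    rw [← Category.assoc, hl, hm]

end Operad

end Descent

/-! ### Suboperads and quotients of presented operads -/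

section Presented

open Operad

variable {Γ : Type u} [Category.{v} Γ] [MonoidalCategory Γ] [SymmetricCategory Γ]
  {ψ : Γ ⥤ Graph} [ψ.Braided] [GraphCategory ψ]
  {G : Type u'} [Category.{v'} G] [Abelian G] [MonoidalCategory G] [SymmetricCategory G]
  [ExactTensor G] [HasGraphColimits ψ G]

/-- A morphism from a presented operad lifts to a suboperad if it does so on generators. -/
theorem IsPresentation.exists_lift {A₁ : Collection ψ G} {A O O' : Operad ψ G}
    {i : A₁ ⟶ (coll ψ G).obj A} (hi : IsPresentation i) (f : A ⟶ O) {m : O' ⟶ O}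
    (hm : ∀ τ, Mono (m.natTrans.app τ)) (j : A₁ ⟶ (coll ψ G).obj O')
    (hj : j ≫ (coll ψ G).map m = i ≫ (coll ψ G).map f) :
    ∃ f' : A ⟶ O', f' ≫ m = f ∧ i ≫ (coll ψ G).map f' = j := by
  have h1 : freeExt j ≫ m = freeExt i ≫ f := by
    refine (isPresentation_freeι A₁).hom_ext ?_
    rw [Functor.map_comp, Functor.map_comp, ← Category.assoc, ← Category.assoc, freeι_freeExt,
      freeι_freeExt, hj]
  obtain ⟨f', hf'⟩ := exists_desc hi.epi_freeExt (freeExt j) fun τ => by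
    have := hi.epi_freeExt τ
    have := hm τ
    obtain ⟨d, hd, -⟩ := exists_lift_of_epi_mono _ _ (congr_app h1 τ)
    exact ⟨d, hd⟩
  refine ⟨f', epi_hom_ext hi.epi_freeExt ?_, ?_⟩
  · rw [← Category.assoc, hf', h1]
  · rw [← freeι_freeExt i, Category.assoc, ← Functor.map_comp, hf', freeι_freeExt]

/-- The free operad preserves epimorphisms. -/
theorem epi_freeExt_comp_freeι {A₁ Q : Collection ψ G} (π : A₁ ⟶ Q) [Epi π] (τ : Γ) :
    Epi ((freeExt (π ≫ freeι Q)).natTrans.app τ) := by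
  have hπ : ∀ a, Epi (π.app a) := fun a => inferInstance
  have h1 : ∀ {X : FinFam (Cor ψ)} (r : (corUnion ψ).obj X ⟶ τ),
      freeLeg A₁ r ≫ (freeExt (π ≫ freeι Q)).natTrans.app τ =
        FinFam.famApp π.app X ≫ freeLeg Q r := by
    intro X r
    refine (freeLeg_freeExtApp _ r).trans ?_
    rw [freeLeg_eq, ← Category.assoc (FinFam.famApp _ _)]
    refine congrArg (· ≫ _) (Eq.trans ?_ (Category.assoc _ _ _))
    exact congrArg (· ≫ _) (FinFam.famApp_comp (A := A₁) (A' := Q) _ _ X).symm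
  refine ⟨fun {Z} f g h => freeLeg_hom_ext fun X r => ?_⟩
  have := epi_famApp π.app hπ X
  rw [← cancel_epi (FinFam.famApp π.app X), ← comp_assoc_of_eq (h1 r), h, comp_assoc_of_eq (h1 r)]

/-- A quotient `Q` of the underlying collection of an operad `P` generates a universal quotient
operad. It is the pushout of `Free(P) ⟶ P` and `Free(P) ⟶ Free(Q)`. -/
theorem Operad.exists_quotient_coll (P : Operad ψ G) {Q : Collection ψ G}
    (π : (coll ψ G).obj P ⟶ Q) [Epi π] :
    ∃ (E : Operad ψ G) (p : P ⟶ E) (h : Q ⟶ (coll ψ G).obj E),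
      (∀ τ, Epi (p.natTrans.app τ)) ∧ (coll ψ G).map p = π ≫ h ∧
      ∀ {O : Operad ψ G} (f : P ⟶ O) (h' : Q ⟶ (coll ψ G).obj O),
        (coll ψ G).map f = π ≫ h' → ∃ m : E ⟶ O, p ≫ m = f := by
  have ha : ∀ τ, Epi ((freeExt (𝟙 ((coll ψ G).obj P))).natTrans.app τ) :=
    -- on corollas this morphism is a retraction of the inclusion of generators
    fun τ => epi_app _ (fun σ => by
      have h1 := congrArg (fun t => NatTrans.app t σ) (freeι_freeExt (𝟙 ((coll ψ G).obj P)))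
      exact @epi_of_epi_fac _ _ _ _ _ _ _ _ (inferInstanceAs (Epi (𝟙 _))) h1) τ
  have hb : ∀ τ, Epi ((freeExt (π ≫ freeι Q)).natTrans.app τ) := epi_freeExt_comp_freeι π
  obtain ⟨E, p, p', hp, hpp, hE⟩ := exists_pushout _ _ ha hb
  refine ⟨E, p, freeι Q ≫ (coll ψ G).map p', hp, ?_, fun {O} f h' hf => ?_⟩
  · have h1 := congrArg (fun t => freeι _ ≫ (coll ψ G).map t) hpp
    simp only [Functor.map_comp] at h1
    rw [← Category.assoc, ← Category.assoc, freeι_freeExt, freeι_freeExt] at h1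
    simpa using h1
  · refine hE f (freeExt h') ((isPresentation_freeι _).hom_ext ?_)
    rw [Functor.map_comp, Functor.map_comp, ← Category.assoc, ← Category.assoc, freeι_freeExt,
      freeι_freeExt, Category.assoc, freeι_freeExt, Category.id_comp, hf]

end Presented

/-! ### Inner cohomomorphism objects of collections -/

section CohomFunctor

variable {C : Type*} [Groupoid C] {G : Type u'} [Category.{v'} G] [MonoidalCategory G]

theorem IsCohom.hom_ext {X Z H Y : G} {c : X ⟶ H ⊗ Z} (hc : IsCohom c) {f g : H ⟶ Y}
    (h : c ≫ f ▷ Z = c ≫ g ▷ Z) : f = g :=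
  (hc Y _).unique h rfl

/-- Inner cohomomorphism objects of functors on a groupoid exist and can be formed objectwise. -/
theorem exists_isCohom_functor (hcohom : ∀ X Z : G, ∃ (H : G) (c : X ⟶ H ⊗ Z), IsCohom c)
    (X Z : C ⥤ G) : ∃ (H : C ⥤ G) (c : X ⟶ H ⊗ Z), IsCohom c := by
  choose H c hc using fun a => hcohom (X.obj a) (Z.obj a)
  have hZ : ∀ {a b : C} (f : a ⟶ b), Z.map f ≫ Z.map (Groupoid.inv f) = 𝟙 _ := fun f => by
    rw [← Z.map_comp, Groupoid.comp_inv, Z.map_id]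
  have hZ' : ∀ {a b : C} (f : a ⟶ b), Z.map (Groupoid.inv f) ≫ Z.map f = 𝟙 _ := fun f => by
    rw [← Z.map_comp, Groupoid.inv_comp, Z.map_id]
  -- the transport of `H` along an isomorphism is adjoint to that of `X` and the inverse one of `Z`
  choose m hm _ using fun {a b : C} (f : a ⟶ b) =>
    hc a (H b) (X.map f ≫ c b ≫ H b ◁ Z.map (Groupoid.inv f))
  have hm' : ∀ {a b : C} (f : a ⟶ b), X.map f ≫ c b = c a ≫ (m f ⊗ₘ Z.map f) := fun f => by
    rw [MonoidalCategory.tensorHom_def, ← Category.assoc, hm, Category.assoc, Category.assoc,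
      ← MonoidalCategory.whiskerLeft_comp, hZ', MonoidalCategory.whiskerLeft_id, Category.comp_id]
  let HF : C ⥤ G :=
    { obj := H
      map := m
      map_id := fun a => (hc a).hom_ext (by
        rw [hm]
        simp)
      map_comp := fun {a b d} f g => (hc a).hom_ext (by
        rw [hm, comp_whiskerRight, ← Category.assoc (c a), hm, Category.assoc, Category.assoc,
          whisker_exchange, ← Category.assoc (c b), hm, X.map_comp]
        simp only [Category.assoc, ← MonoidalCategory.whiskerLeft_comp, ← Z.map_comp]
        simp) }
  let cF : X ⟶ HF ⊗ Z := { app := c, naturality := fun a b f => hm' f }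
  refine ⟨HF, cF, fun Y f => ?_⟩
  let t (a : C) : X.obj a ⟶ Y.obj a ⊗ Z.obj a := f.app a
  have ht : ∀ {a b : C} (s : a ⟶ b), X.map s ≫ t b = t a ≫ (Y.map s ⊗ₘ Z.map s) :=
    fun s => f.naturality s
  choose g hg hu using fun a => hc a (Y.obj a) (t a)
  have hgn : ∀ {a b : C} (s : a ⟶ b), m s ≫ g b = g a ≫ Y.map s := fun {a b} s => by
    refine (hc a).hom_ext ?_
    rw [comp_whiskerRight, ← Category.assoc, hm, Category.assoc, Category.assoc, whisker_exchange,
      ← Category.assoc (c b), hg, ← Category.assoc, ht, Category.assoc,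
      MonoidalCategory.tensorHom_def, Category.assoc, ← MonoidalCategory.whiskerLeft_comp, hZ,
      MonoidalCategory.whiskerLeft_id, Category.comp_id, comp_whiskerRight, ← Category.assoc, hg]
  refine ⟨{ app := g, naturality := fun a b s => hgn s }, ?_, fun g' hg' => ?_⟩
  · ext a
    exact hg a
  · ext a
    exact hu a _ (congrArg (fun t => NatTrans.app t a) hg')

theorem zero_whiskerRight_functor [Abelian G] [ExactTensor G] {X Y Z : C ⥤ G} :
    (0 : X ⟶ Y) ▷ Z = 0 := by
  ext a
  exact (tensorRight (Z.obj a)).map_zero _ _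

end CohomFunctor

/-! ### Inner cohomomorphism operads -/

section Main

open Operad

variable {Γ : Type u} [Category.{v} Γ] [MonoidalCategory Γ] [SymmetricCategory Γ]
  {ψ : Γ ⥤ Graph} {G : Type u'} [Category.{v'} G] [MonoidalCategory G] [SymmetricCategory G]

/-- The functor `- ○ B` on operads and the functor `- ⊗ B` on collections agree on morphisms. -/
theorem coll_map_whiteMap {A A' : Operad ψ G} (f : A ⟶ A') (B : Operad ψ G) :
    (coll ψ G).map (whiteMap f B) ≫ (collWhite A' B).hom =
      (collWhite A B).hom ≫ ((coll ψ G).map f ▷ (coll ψ G).obj B) :=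
  (Category.comp_id _).trans (Category.id_comp _).symm

variable [ψ.Braided] [GraphCategory ψ] [Abelian G] [ExactTensor G] [HasGraphColimits ψ G]

/-- The product `𝓕 ⊙ 𝓖` is the image of the free operad on `F₁ ⊗ G₁` in `F ○ G`; it is minimal,
because morphisms of presented operads lift to a suboperad as soon as they do so on generators. -/
theorem exists_blackProduct (𝓕 𝓖 : OP ψ G) : Nonempty (BlackProduct 𝓕 𝓖) := by
  obtain ⟨E, p, m, hp, hm, h⟩ := exists_image
    (freeExt ((𝓕.i ⊗ₘ 𝓖.i) ≫ (collWhite 𝓕.operad 𝓖.operad).inv))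
  have hi := (isPresentation_freeι (𝓕.gen ⊗ 𝓖.gen)).comp (f := p) fun σ => hp _
  have fac : (freeι (𝓕.gen ⊗ 𝓖.gen) ≫ (coll ψ G).map p) ≫ (coll ψ G).map m ≫
      (collWhite 𝓕.operad 𝓖.operad).hom = 𝓕.i ⊗ₘ 𝓖.i := by
    rw [Category.assoc, ← Functor.map_comp_assoc, h, ← Category.assoc, freeι_freeExt,
      Category.assoc, Iso.inv_hom_id, Category.comp_id]
  exact ⟨{
    operad := E
    incl := m
    mono := hm
    i := freeι _ ≫ (coll ψ G).map p
    fac := fac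
    minimal := fun D m' j hm' hj => by
      obtain ⟨n, hn, -⟩ := hi.exists_lift m hm' j (by
        rw [← cancel_mono (collWhite 𝓕.operad 𝓖.operad).hom, Category.assoc, Category.assoc, hj,
          fac])
      exact ⟨n, hn⟩
    isPresentation := hi }⟩

/-- The inner cohomomorphism operad: it is generated by `E₁`, and `A ⟶ E ○ B` is universal among
the morphisms compatible with presentations. A morphism `Free(E₁) ⟶ F` corresponds to a morphism
`Free(A₁) ⟶ F ○ B`, and the latter kills the relations of `A` if and only if the former kills the
relations that correspond to them by adjunction between cohomomorphisms and `- ⊗ B`. -/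
theorem exists_initial (hcohom : ∀ X Z : G, ∃ (H : G) (c : X ⟶ H ⊗ Z), IsCohom c)
    (𝒜 ℬ : OP ψ G) {E₁ : Collection ψ G} {c : 𝒜.gen ⟶ E₁ ⊗ ℬ.gen} (hc : IsCohom c) :
    ∃ (E : Operad ψ G) (i_E : E₁ ⟶ (coll ψ G).obj E) (_ : IsPresentation i_E)
      (δ : 𝒜.operad ⟶ white E ℬ.operad)
      (hδ : 𝒜.i ≫ (coll ψ G).map δ ≫ (collWhite E ℬ.operad).hom =
        (c ≫ (i_E ▷ ℬ.gen)) ≫ ((coll ψ G).obj E ◁ ℬ.i)),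
      Nonempty (IsInitial (⟨E, δ, c ≫ (i_E ▷ ℬ.gen), hδ⟩ : Diag 𝒜 ℬ)) := by
  -- `a : Free(A₁) ⟶ A` is the presentation of `A`, and `γ` extends the coevaluation `c`
  let a := freeExt 𝒜.i
  have ha : ∀ τ, Epi (a.natTrans.app τ) := 𝒜.isPresentation.epi_freeExt
  have hia : freeι 𝒜.gen ≫ (coll ψ G).map a = 𝒜.i := freeι_freeExt _
  have hca : Epi ((coll ψ G).map a) :=
    @NatTrans.epi_of_epi_app _ _ _ _ _ _ _ fun σ => ha ((corInclusion ψ).obj σ)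
  let γ : freeOperad 𝒜.gen ⟶ white (freeOperad E₁) ℬ.operad :=
    freeExt (c ≫ (freeι E₁ ⊗ₘ ℬ.i) ≫ (collWhite _ _).inv)
  have hγ : freeι 𝒜.gen ≫ (coll ψ G).map γ ≫ (collWhite _ _).hom = c ≫ (freeι E₁ ⊗ₘ ℬ.i) := by
    rw [← Category.assoc, freeι_freeExt, Category.assoc, Category.assoc, Iso.inv_hom_id,
      Category.comp_id]
  -- the relations `ker a` of `A` are turned into relations of `E` by adjunction: the image of
  -- `ρ : R ⟶ Free(E₁)`, where `R` is the inner cohomomorphism object of `ker a` and `B`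
  obtain ⟨R, cR, hcR⟩ := exists_isCohom_functor hcohom (kernel ((coll ψ G).map a))
    ((coll ψ G).obj ℬ.operad)
  obtain ⟨ρ, hρ, -⟩ := hcR _ (kernel.ι ((coll ψ G).map a) ≫ (coll ψ G).map γ ≫ (collWhite _ _).hom)
  obtain ⟨E, p, h, hp, hph, hE⟩ := exists_quotient_coll (freeOperad E₁) (cokernel.π ρ)
  have hρp : ρ ≫ (coll ψ G).map p = 0 := by
    rw [hph, ← Category.assoc, cokernel.condition, zero_comp]
  have hiE : IsPresentation (freeι E₁ ≫ (coll ψ G).map p) :=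
    (isPresentation_freeι E₁).comp fun σ => hp _
  -- composites of `γ` with a morphism out of `Free(E₁)`, on generators and on relations
  have key : ∀ {F : Operad ψ G} (f : freeOperad E₁ ⟶ F),
      freeι 𝒜.gen ≫ (coll ψ G).map (γ ≫ whiteMap f ℬ.operad) ≫ (collWhite F ℬ.operad).hom =
        (c ≫ ((freeι E₁ ≫ (coll ψ G).map f) ▷ ℬ.gen)) ≫ ((coll ψ G).obj F ◁ ℬ.i) := by
    intro F f
    rw [Functor.map_comp, Category.assoc, coll_map_whiteMap, ← Category.assoc ((coll ψ G).map γ),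
      ← Category.assoc (freeι 𝒜.gen), hγ, Category.assoc, Category.assoc,
      MonoidalCategory.tensorHom_def, Category.assoc, whisker_exchange, comp_whiskerRight,
      Category.assoc]
  have key' : ∀ {F : Operad ψ G} (f : freeOperad E₁ ⟶ F),
      kernel.ι ((coll ψ G).map a) ≫ (coll ψ G).map (γ ≫ whiteMap f ℬ.operad) ≫
        (collWhite F ℬ.operad).hom = cR ≫ ((ρ ≫ (coll ψ G).map f) ▷ (coll ψ G).obj ℬ.operad) := by
    intro F f
    rw [Functor.map_comp, Category.assoc, coll_map_whiteMap, comp_whiskerRight, ← Category.assoc cR,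
      hρ, Category.assoc, Category.assoc]
  -- `δ` is the descent of `γ` to `A`, which exists because `γ` kills the relations in `E ○ B`
  obtain ⟨δ, hδ⟩ := exists_desc_of_corollas (fun σ => ha _) (γ ≫ whiteMap p ℬ.operad) fun σ => by
    have h1 : kernel.ι ((coll ψ G).map a) ≫ (coll ψ G).map (γ ≫ whiteMap p ℬ.operad) = 0 := by
      rw [← cancel_mono (collWhite E ℬ.operad).hom, Category.assoc, key', hρp,
        zero_whiskerRight_functor, comp_zero, zero_comp]
    exact ⟨(Abelian.epiDesc _ _ h1).app σ,
      congrArg (fun t => NatTrans.app t σ) (Abelian.comp_epiDesc _ _ h1)⟩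
  refine ⟨E, freeι E₁ ≫ (coll ψ G).map p, hiE, δ, ?_, ⟨?_⟩⟩
  · rw [← key, ← hδ, ← hia, Functor.map_comp, Category.assoc, Category.assoc]
  · -- the condition on generators alone determines the morphism
    have uniq : ∀ (Y : Diag 𝒜 ℬ) (v v' : E ⟶ Y.F),
        (c ≫ ((freeι E₁ ≫ (coll ψ G).map p) ▷ ℬ.gen)) ≫ ((coll ψ G).map v ▷ ℬ.gen) = Y.u₁ →
        (c ≫ ((freeι E₁ ≫ (coll ψ G).map p) ▷ ℬ.gen)) ≫ ((coll ψ G).map v' ▷ ℬ.gen) = Y.u₁ →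
        v = v' := by
      intro Y v v' hv hv'
      refine hiE.hom_ext (hc.hom_ext ?_)
      rw [comp_whiskerRight, comp_whiskerRight _ ((coll ψ G).map v'), ← Category.assoc, hv,
        ← Category.assoc, hv']
    have ex : ∀ Y : Diag 𝒜 ℬ, ∃ v : E ⟶ Y.F, δ ≫ whiteMap v ℬ.operad = Y.u ∧
        (c ≫ ((freeι E₁ ≫ (coll ψ G).map p) ▷ ℬ.gen)) ≫ ((coll ψ G).map v ▷ ℬ.gen) = Y.u₁ := by
      intro Y
      obtain ⟨t, ht, -⟩ := hc _ Y.u₁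
      have h1 : γ ≫ whiteMap (freeExt t) ℬ.operad = a ≫ Y.u := by
        refine (isPresentation_freeι _).hom_ext ?_
        rw [← cancel_mono (collWhite Y.F ℬ.operad).hom, Category.assoc, key, freeι_freeExt, ht,
          ← Y.comm, ← hia, Functor.map_comp]
        simp only [Category.assoc]
      have h2 : ρ ≫ (coll ψ G).map (freeExt t) = 0 := by
        refine hcR.hom_ext ?_
        rw [← key', h1, zero_whiskerRight_functor, comp_zero, Functor.map_comp, Category.assoc,
          ← Category.assoc, kernel.condition, zero_comp]
      obtain ⟨v, hv⟩ := hE (freeExt t) (cokernel.desc _ _ h2) (cokernel.π_desc _ _ h2).symm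
      refine ⟨v, epi_hom_ext ha ?_, ?_⟩
      · rw [← Category.assoc, hδ, Category.assoc, ← whiteMap_comp, hv, h1]
      · rw [Category.assoc, ← comp_whiskerRight, Category.assoc, ← Functor.map_comp, hv,
          freeι_freeExt, ht]
    exact IsInitial.ofUniqueHom (fun Y => ⟨(ex Y).choose, (ex Y).choose_spec.1,
      (ex Y).choose_spec.2⟩) fun Y v => Diag.Hom.ext (uniq Y _ _ v.comm₁ (ex Y).choose_spec.2)

/-- The product with `ℬ` is functorial: the restriction of `g ○ ℬ` to `𝓔 ⊙ ℬ` has values in `𝓕 ⊙ ℬ`,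
since this holds on generators. -/
theorem BlackProduct.existsUnique_isMap {𝓔 𝓕 ℬ : OP ψ G} (P : BlackProduct 𝓔 ℬ)
    (Q : BlackProduct 𝓕 ℬ) (g : 𝓔 ⟶ 𝓕) : ∃! k : P.toOP ⟶ Q.toOP, P.IsMap Q g k := by
  obtain ⟨k, hk, hk'⟩ := P.isPresentation.exists_lift (P.incl ≫ whiteMap g.operadHom ℬ.operad)
    Q.mono ((g.genHom ▷ ℬ.gen) ≫ Q.i) (by
      rw [← cancel_mono (collWhite 𝓕.operad ℬ.operad).hom, Category.assoc, Category.assoc, Q.fac,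
        Functor.map_comp, Category.assoc, Category.assoc, coll_map_whiteMap,
        ← Category.assoc ((coll ψ G).map P.incl), ← Category.assoc P.i, P.fac, ← tensorHom_id,
        ← tensorHom_id, tensorHom_comp_tensorHom, tensorHom_comp_tensorHom, g.comm,
        Category.id_comp, Category.comp_id])
  refine ⟨⟨g.genHom ▷ ℬ.gen, k, hk'⟩, ⟨rfl, hk⟩, fun k' h => OP.Hom.ext h.1 ?_⟩
  exact mono_hom_ext Q.mono (h.2.trans hk.symm)

end Main

end GraphOperad

theorem theorem2p2
    {Γ : Type u} [Category.{v} Γ] [MonoidalCategory Γ] [SymmetricCategory Γ]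
    (ψ : Γ ⥤ Graph) [ψ.Braided] [GraphCategory ψ]
    {G : Type u'} [Category.{v'} G] [Abelian G] [MonoidalCategory G] [SymmetricCategory G]
    [ExactTensor G] [HasGraphColimits ψ G]
    (hcohom : ∀ X Z : G, ∃ (H : G) (c : X ⟶ H ⊗ Z), IsCohom c)
    (𝒜 ℬ : OP ψ G) :
    (∃ (E₁ : Collection ψ G) (c : 𝒜.gen ⟶ E₁ ⊗ ℬ.gen), IsCohom c) ∧
    (∀ 𝓕 𝓖 : OP ψ G, Nonempty (BlackProduct 𝓕 𝓖)) ∧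
    ∀ (E₁ : Collection ψ G) (c : 𝒜.gen ⟶ E₁ ⊗ ℬ.gen), IsCohom c →
      ∃ (E : Operad ψ G) (i_E : E₁ ⟶ (Operad.coll ψ G).obj E) (hE : IsPresentation i_E)
        (δ : 𝒜.operad ⟶ Operad.white E ℬ.operad)
        (hδ : 𝒜.i ≫ (Operad.coll ψ G).map δ ≫ (Operad.collWhite E ℬ.operad).hom =
          (c ≫ (i_E ▷ ℬ.gen)) ≫ ((Operad.coll ψ G).obj E ◁ ℬ.i)),
        let 𝓔 : OP ψ G := ⟨E, E₁, i_E, hE⟩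
        let X : Diag 𝒜 ℬ := ⟨E, δ, c ≫ (i_E ▷ ℬ.gen), hδ⟩
        Nonempty (IsInitial X) ∧
        (∀ Y : Diag 𝒜 ℬ, Nonempty (IsInitial Y) → Nonempty (Unique (X ≅ Y))) ∧
        (∀ (𝓕 : OP ψ G) (u : 𝒜.operad ⟶ Operad.white 𝓕.operad ℬ.operad)
          (w : 𝒜.gen ⟶ 𝓕.gen ⊗ ℬ.gen)
          (hu : 𝒜.i ≫ (Operad.coll ψ G).map u ≫ (Operad.collWhite 𝓕.operad ℬ.operad).hom =
            (w ≫ (𝓕.i ▷ ℬ.gen)) ≫ ((Operad.coll ψ G).obj 𝓕.operad ◁ ℬ.i))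
          (can : X ⟶ (⟨𝓕.operad, u, w ≫ (𝓕.i ▷ ℬ.gen), hu⟩ : Diag 𝒜 ℬ)),
          ∃ g : 𝓔 ⟶ 𝓕, g.operadHom = can.v ∧ c ≫ (g.genHom ▷ ℬ.gen) = w ∧
            ∀ g' : 𝓔 ⟶ 𝓕, c ≫ (g'.genHom ▷ ℬ.gen) = w → g' = g) ∧
        (∀ P : BlackProduct 𝓔 ℬ, ∃ coev : 𝒜 ⟶ P.toOP,
          coev.genHom = c ∧ coev.operadHom ≫ P.incl = δ ∧ IsCohomOP P coev) := by
  refine ⟨exists_isCohom_functor hcohom _ _, exists_blackProduct, fun E₁ c hc => ?_⟩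
  obtain ⟨E, i_E, hE, δ, hδ, ⟨hX⟩⟩ := exists_initial hcohom 𝒜 ℬ hc
  refine ⟨E, i_E, hE, δ, hδ, ?_⟩
  intro 𝓔 X
  have hb : ∀ (𝓕 : OP ψ G) (u : 𝒜.operad ⟶ Operad.white 𝓕.operad ℬ.operad)
      (w : 𝒜.gen ⟶ 𝓕.gen ⊗ ℬ.gen)
      (hu : 𝒜.i ≫ (Operad.coll ψ G).map u ≫ (Operad.collWhite 𝓕.operad ℬ.operad).hom =
        (w ≫ (𝓕.i ▷ ℬ.gen)) ≫ ((Operad.coll ψ G).obj 𝓕.operad ◁ ℬ.i))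
      (can : X ⟶ (⟨𝓕.operad, u, w ≫ (𝓕.i ▷ ℬ.gen), hu⟩ : Diag 𝒜 ℬ)),
      ∃ g : 𝓔 ⟶ 𝓕, g.operadHom = can.v ∧ c ≫ (g.genHom ▷ ℬ.gen) = w ∧
        ∀ g' : 𝓔 ⟶ 𝓕, c ≫ (g'.genHom ▷ ℬ.gen) = w → g' = g := by
    intro 𝓕 u w hu can
    -- the map of generators is forced by the universal property of `c`; it is compatible with the
    -- canonical morphism, because both have the same image under the adjunction defining `E₁`
    obtain ⟨g₁, hg₁, -⟩ := hc _ w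
    have hcomm : i_E ≫ (Operad.coll ψ G).map can.v = g₁ ≫ 𝓕.i := by
      refine hc.hom_ext ?_
      have h1 := can.comm₁
      rw [comp_whiskerRight, comp_whiskerRight, ← Category.assoc, ← Category.assoc, hg₁]
      exact h1
    refine ⟨⟨g₁, can.v, hcomm⟩, rfl, hg₁, fun g' hg' => ?_⟩
    have h2 : g'.genHom = g₁ := hc.hom_ext (hg'.trans hg₁.symm)
    refine OP.Hom.ext h2 (hE.hom_ext ?_)
    exact g'.comm.trans ((congrArg (· ≫ 𝓕.i) h2).trans hcomm.symm)
  refine ⟨⟨hX⟩, ?_, hb, fun P => ?_⟩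
  · rintro Y ⟨hY⟩
    exact ⟨⟨⟨hX.uniqueUpToIso hY⟩, fun e => Iso.ext (hX.hom_ext _ _)⟩⟩
  · -- `δ` takes values in the suboperad `𝓔 ⊙ ℬ`, because `δ₁` does
    obtain ⟨d, hd, hd'⟩ := 𝒜.isPresentation.exists_lift δ P.mono (c ≫ P.i) (by
      rw [← cancel_mono (Operad.collWhite E ℬ.operad).hom, Category.assoc, Category.assoc,
        Category.assoc, hδ, P.fac, MonoidalCategory.tensorHom_def, Category.assoc])
    refine ⟨⟨c, d, hd'⟩, rfl, hd, fun 𝓕 Q => ⟨P.existsUnique_isMap Q, fun h => ?_⟩⟩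
    -- composed with the inclusion into `𝓕 ○ ℬ`, a morphism `h : 𝒜 ⟶ 𝓕 ⊙ ℬ` becomes an object of
    -- `𝒜 ⇒ ℬ` of the form to which `hb` applies
    let h₀ : 𝒜.operad ⟶ Q.operad := h.operadHom
    let h₁ : 𝒜.gen ⟶ 𝓕.gen ⊗ ℬ.gen := h.genHom
    have hcomm : 𝒜.i ≫ (Operad.coll ψ G).map h₀ = h₁ ≫ Q.i := h.comm
    have hu : 𝒜.i ≫ (Operad.coll ψ G).map (h₀ ≫ Q.incl) ≫
        (Operad.collWhite 𝓕.operad ℬ.operad).hom =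
          (h₁ ≫ (𝓕.i ▷ ℬ.gen)) ≫ ((Operad.coll ψ G).obj 𝓕.operad ◁ ℬ.i) := by
      rw [Functor.map_comp, Category.assoc, ← Category.assoc, hcomm, Category.assoc, Q.fac,
        MonoidalCategory.tensorHom_def, Category.assoc]
    obtain ⟨g, hg, hgw, huniq⟩ := hb 𝓕 (h₀ ≫ Q.incl) h₁ hu (hX.to _)
    obtain ⟨k, hk, -⟩ := P.existsUnique_isMap Q g
    refine ⟨g, ⟨k, hk, OP.Hom.ext ?_ (Operad.mono_hom_ext Q.mono ?_)⟩, ?_⟩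
    · exact (congrArg (c ≫ ·) hk.1).trans hgw
    · refine (Category.assoc _ _ _).trans ((congrArg (d ≫ ·) hk.2).trans ?_)
      rw [← Category.assoc, hd, hg]
      exact (hX.to _).comm
    · rintro g' ⟨k', hk', rfl⟩
      exact huniq g' (congrArg (c ≫ ·) hk'.1).symm
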